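/- **Setting.** Let $M$ be a (Hausdorff, second countable) complex manifold of dimension $n$ with a pseudo-Kähler form $\omega_{-1}=i g_{kl}\,dz^k\wedge d\bar z^l$ (a real closed nondegenerate (1,1)-form), and let $(g^{lk})$ be the inverse matrix of $(g_{kl})$, the corresponding Kähler–Poisson tensor, with bracket $\{u,v\}_0=g^{lk}\left(\frac{\partial u}{\partial\bar z^l}\frac{\partial v}{\partial z^k}-\frac{\partial v}{\partial\bar z^l}\frac{\partial u}{\partial z^k}\right)$. A star product $f\ast g=\sum_{r\ge0}\nu^rC_r(f,g)$ on $C^\infty(M)[[\nu]]$ (associative, with unit $1$, $C_r$ bidifferential, $C_0(f,g)=fg$, $C_1(f,g)-C_1(g,f)=\{f,g\}_0$) is *with separation of variables* if every $C_r$ differentiates its first argument only in antiholomorphic and its second argument only in holomorphic directions. Let $L_f,R_f$ be the operators of left and right $\ast$-multiplication by $f$. The star product is *parametrized* by a formal form $\omega=\frac1\nu\omega_{-1}+\omega_0+\nu\omega_1+\dots$, where the $\omega_r$ are closed (1,1)-forms, if locally there are potentials, $\omega_r=i\partial\bar\partial\Phi_r$, such that with $\Phi=\frac1\nu\Phi_{-1}+\Phi_0+\nu\Phi_1+\dots$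 $$L_{\nu\,\partial\Phi/\partial z^k}=\nu\left(\frac{\partial\Phi}{\partial z^k}+\frac{\partial}{\partial z^k}\right),\qquad R_{\nu\,\partial\Phi/\partial\bar z^l}=\nu\left(\frac{\partial\Phi}{\partial\bar z^l}+\frac{\partial}{\partial\bar z^l}\right).$$ A formal differential operator $A=\sum_r\nu^rA_r$ is *natural* if $A_r$ has order at most $r$ for all $r$; then $\sigma(A)=\sum_r\sigma_r(A_r)$, where $\sigma_r$ is the principal symbol of order $r$, is a function on the formal neighbourhood of the zero section $Z$ of $T^*M$, given by its Taylor series in the fibre coordinates $\zeta_k,\bar\zeta_l$ dual to $z^k,\bar z^l$. The Poisson bracket of $T^*M$ is normalized by $\{\zeta_k,f\}_{T^*M}=\partial f/\partial z^k$, and $E$ denotes restriction to $Z$. Let $\varepsilon^2=0$. For a tensor $h^{lk}$ satisfying the Jacobi identity for $g^{lk}+\varepsilon h^{lk}$ to first order in $\varepsilon$ (an *infinitesimal deformation* of $g^{lk}$), equip $C^\infty(M)[\varepsilon]$ with the bracket $\{\cdot,\cdot\}=\{\cdot,\cdot\}_0+\varepsilon\{\cdot,\cdot\}_1$ given by $g^{lk}+\varepsilon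 h^{lk}$. *Source and target mappings of a deformation formal symplectic groupoid over $(M,g^{lk}+\varepsilon h^{lk})$* are $\varepsilon$-linear maps $S=S_0+\varepsilon S_1$, $T=T_0+\varepsilon T_1$ from $C^\infty(M)[\varepsilon]$ to $C^\infty(T^*M,Z)[\varepsilon]$ with $ESf=ETf=f$, $S(fg)=Sf\,Sg$, $T(fg)=Tf\,Tg$, $S\{f,g\}=\{Sf,Sg\}_{T^*M}$, $T\{f,g\}=-\{Tf,Tg\}_{T^*M}$, $\{Sf,Tg\}_{T^*M}=0$. The groupoid has *separation of variables* if $Sa=a$ and $Tb=b$ for local holomorphic $a$ and antiholomorphic $b$. The deformation groupoid with separation of variables corresponding to $g^{lk}+\varepsilon h^{lk}$ is the one given by $$Sf=\exp\left(\zeta_k(g^{lk}+\varepsilon h^{lk})\frac{\partial}{\partial\bar z^l}\right)f,\qquad Tf=\exp\left(\bar\zeta_l(g^{lk}+\varepsilon h^{lk})\frac{\partial}{\partial z^k}\right)f .$$ **Proposition.** Let $\ast$ and $\tilde\ast$ be star products with separation of variables on the pseudo-Kähler manifold $(M,\omega_{-1})$, parametrized by $\omega=\frac1\nu\omega_{-1}+\omega_0+\nu\omega_1+\dots$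 and $\tilde\omega=\frac1\nu\omega_{-1}+\tilde\omega_0+\nu\tilde\omega_1+\dots$, with bidifferential operators $C_r,\tilde C_r$ and multiplication operators $L_f,R_f,\tilde L_f,\tilde R_f$. Let $\varkappa=\omega_0-\tilde\omega_0=i\varkappa_{pq}\,dz^p\wedge d\bar z^q$ and $$h^{lk}=-g^{lp}\varkappa_{pq}g^{qk}.$$ Then $h^{lk}$ is an infinitesimal deformation of $g^{lk}$, and the deformation groupoid of the pair $(\ast,\tilde\ast)$ is the deformation groupoid with separation of variables corresponding to $g^{lk}+\varepsilon h^{lk}$. That is: 1. for all $u,v\in C^\infty(M)$, $$\big(C_2(u,v)-C_2(v,u)\big)-\big(\tilde C_2(u,v)-\tilde C_2(v,u)\big)=h^{lk}\left(\frac{\partial u}{\partial\bar z^l}\frac{\partial v}{\partial z^k}-\frac{\partial v}{\partial\bar z^l}\frac{\partial u}{\partial z^k}\right);$$ 2. for every $f\in C^\infty(M)$ the operators $L_f,\tilde L_f,R_f,\tilde R_f$, $\frac1\nu(L_f-\tilde L_f)$, $\frac1\nu(R_f-\tilde R_f)$ are natural, $\sigma(L_f)=\sigma(\tilde L_f)$,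 $\sigma(R_f)=\sigma(\tilde R_f)$, and the maps $S=S_0+\varepsilon S_1$, $T=T_0+\varepsilon T_1$ of the pair, given by $$S_0f=\sigma(L_f),\quad S_1f=\sigma\big(\tfrac1\nu(L_f-\tilde L_f)\big),\quad T_0f=\sigma(R_f),\quad T_1f=\sigma\big(\tfrac1\nu(R_f-\tilde R_f)\big),$$ are the source and target mappings of a deformation formal symplectic groupoid over $(M,g^{lk}+\varepsilon h^{lk})$, have the property of separation of variables, and are given by the exponential formulas above. -/

import Mathlib

open scoped Manifold ContDiff Topology

noncomputable section

/-- The model space `ℂⁿ`. -/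
abbrev Cn (n : ℕ) : Type := Fin n → ℂ

/-- Local complex coordinate systems: the charts of the complex manifold `M`. -/
abbrev IsHolChart {n : ℕ} {M : Type*} [TopologicalSpace M] [ChartedSpace (Cn n) M]
    (φ : OpenPartialHomeomorph M (Cn n)) : Prop :=
  φ ∈ IsManifold.maximalAtlas 𝓘(ℂ, Cn n) ω M

/-- `C^∞(M)`: complex-valued functions on `M` that are smooth in the real sense. -/
def Sm (n : ℕ) (M : Type*) [TopologicalSpace M] [ChartedSpace (Cn n) M] :
    Subalgebra ℂ (M → ℂ) where
  carrier := {f | ContMDiff 𝓘(ℝ, Cn n) 𝓘(ℝ, ℂ) ∞ f}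
  mul_mem' := by
    intro f g hf hg
    exact ContDiff.comp_contMDiff (g := fun p : ℂ × ℂ => p.1 * p.2) contDiff_mul
      (hf.prodMk_space hg)
  add_mem' := by
    intro f g hf hg
    exact ContDiff.comp_contMDiff (g := fun p : ℂ × ℂ => p.1 + p.2) contDiff_add
      (hf.prodMk_space hg)
  algebraMap_mem' := fun _ => contMDiff_const

/-! ### Wirtinger derivatives on `ℂⁿ` -/

/-- `∂F/∂z^k`. -/
def dz {n : ℕ} (k : Fin n) (F : Cn n → ℂ) (y : Cn n) : ℂ :=
  (fderiv ℝ F y (Pi.single k 1) - Complex.I * fderiv ℝ F y (Pi.single k Complex.I)) / 2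

/-- `∂F/∂z̄^l`. -/
def dzb {n : ℕ} (l : Fin n) (F : Cn n → ℂ) (y : Cn n) : ℂ :=
  (fderiv ℝ F y (Pi.single l 1) + Complex.I * fderiv ℝ F y (Pi.single l Complex.I)) / 2

/-- Multi-indices; `Sum.inl k` counts holomorphic and `Sum.inr k` antiholomorphic directions. -/
abbrev MultiIdx (n : ℕ) : Type := Fin n ⊕ Fin n → ℕ

/-- The multi-indices of length `r`. -/
def idxEq (n r : ℕ) : Finset (MultiIdx n) := Finset.univ.piAntidiag r

/-- The multi-indices of length at most `r`. -/
def idxLE (n r : ℕ) : Finset (MultiIdx n) := (Finset.range (r + 1)).biUnion (idxEq n)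

/-- The iterated partial derivative `∂_z^α ∂_z̄^β F`, where `γ = (α, β)`. -/
def pderiv {n : ℕ} (γ : MultiIdx n) (F : Cn n → ℂ) : Cn n → ℂ :=
  (List.finRange n).foldr
    (fun k G => (dz k)^[γ (Sum.inl k)] ((dzb k)^[γ (Sum.inr k)] G)) F

/-- The fibre monomial `ζ^α ζ̄^β`, where `γ = (α, β)`. -/
def fibMon {n : ℕ} (γ : MultiIdx n) (ζ : Cn n) : ℂ :=
  ∏ k, ζ k ^ γ (Sum.inl k) * (starRingEnd ℂ) (ζ k) ^ γ (Sum.inr k)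

section

variable {n : ℕ} {M : Type*} [TopologicalSpace M] [ChartedSpace (Cn n) M]

/-- The coordinate expression of a function on `M`. -/
def loc (φ : OpenPartialHomeomorph M (Cn n)) (f : M → ℂ) : Cn n → ℂ := fun y => f (φ.symm y)

/-- The property `P V` holds for some open neighbourhood `V` of every point of the image of
every holomorphic chart `φ`. -/
def LocallyInCharts (M : Type*) [TopologicalSpace M] [ChartedSpace (Cn n) M]
    (P : OpenPartialHomeomorph M (Cn n) → Set (Cn n) → Prop) : Prop :=
  ∀ φ : OpenPartialHomeomorph M (Cn n), IsHolChart φ → ∀ y ∈ φ.target,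
    ∃ V : Set (Cn n), IsOpen V ∧ y ∈ V ∧ V ⊆ φ.target ∧ P φ V

/-! ### Closed (1,1)-forms -/

variable (n M) in
/-- Complex-valued 2-forms on `M` (no regularity). -/
abbrev TwoForm : Type _ := (x : M) → TangentSpace 𝓘(ℝ, Cn n) x [⋀^Fin 2]→L[ℝ] ℂ

/-- The expression of a 2-form in a chart, i.e. its pull-back along `φ⁻¹`. -/
def formLoc (φ : OpenPartialHomeomorph M (Cn n)) (w : TwoForm n M) (y : Cn n) :
    Cn n [⋀^Fin 2]→L[ℝ] ℂ :=
  (w (φ.symm y)).compContinuousLinearMap (mfderiv 𝓘(ℝ, Cn n) 𝓘(ℝ, Cn n) φ.symm y)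

lemma formLoc_add (φ : OpenPartialHomeomorph M (Cn n)) (w w' : TwoForm n M) :
    formLoc φ (w + w') = formLoc φ w + formLoc φ w' := rfl

lemma formLoc_neg (φ : OpenPartialHomeomorph M (Cn n)) (w : TwoForm n M) :
    formLoc φ (-w) = (-1 : ℝ) • formLoc φ w := by
  funext y
  ext v
  change -(w (φ.symm y) _) = (-1 : ℝ) • (w (φ.symm y) _)
  rw [neg_smul, one_smul]

lemma formLoc_zero (φ : OpenPartialHomeomorph M (Cn n)) :
    formLoc φ (0 : TwoForm n M) = fun _ => 0 := rfl

variable (n M) in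
/-- Smooth closed complex-valued 2-forms of type (1,1) on `M`. -/
def ClosedForm11 : AddSubgroup (TwoForm n M) where
  carrier := {w | ∀ φ : OpenPartialHomeomorph M (Cn n), IsHolChart φ →
    ContDiffOn ℝ ∞ (formLoc φ w) φ.target ∧
    (∀ y ∈ φ.target, ∀ u v : Cn n,
      formLoc φ w y ![Complex.I • u, Complex.I • v] = formLoc φ w y ![u, v]) ∧
    (∀ y ∈ φ.target, extDeriv (formLoc φ w) y = 0)}
  add_mem' := by
    intro w w' hw hw' φ hφ
    obtain ⟨h1, h2, h3⟩ := hw φ hφ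
    obtain ⟨h1', h2', h3'⟩ := hw' φ hφ
    rw [formLoc_add]
    refine ⟨h1.add h1', fun y hy u v => ?_, fun y hy => ?_⟩
    · simp only [Pi.add_apply, ContinuousAlternatingMap.add_apply, h2 y hy, h2' y hy]
    · have d1 := (h1.contDiffAt (φ.open_target.mem_nhds hy)).differentiableAt (by simp)
      have d2 := (h1'.contDiffAt (φ.open_target.mem_nhds hy)).differentiableAt (by simp)
      rw [extDeriv_add d1 d2, h3 y hy, h3' y hy, add_zero]
  zero_mem' := by
    intro φ _
    rw [formLoc_zero]
    refine ⟨contDiffOn_const, fun y hy u v => rfl, fun y hy => ?_⟩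
    have h : (fun _ : Cn n => (0 : Cn n [⋀^Fin 2]→L[ℝ] ℂ)) =
        (0 : ℝ) • (fun _ : Cn n => (0 : Cn n [⋀^Fin 2]→L[ℝ] ℂ)) := by
      funext y
      exact (smul_zero (A := Cn n [⋀^Fin 2]→L[ℝ] ℂ) (0 : ℝ)).symm
    rw [h, extDeriv_smul, zero_smul]
  neg_mem' := by
    intro w hw φ hφ
    obtain ⟨h1, h2, h3⟩ := hw φ hφ
    rw [formLoc_neg]
    refine ⟨contDiffOn_const.smul h1, fun y hy u v => ?_, fun y hy => ?_⟩
    · simp only [Pi.smul_apply, ContinuousAlternatingMap.smul_apply, h2 y hy]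
    · rw [extDeriv_smul, h3 y hy, smul_zero]

/-- The coefficients `w_{kl} = -i w(∂/∂z^k, ∂/∂z̄^l)` of a (1,1)-form
`w = i w_{kl} dz^k ∧ dz̄^l`, where `w` is extended complex bilinearly,
`∂/∂z^k = (e_k - i J e_k) / 2` and `∂/∂z̄^l = (e_l + i J e_l) / 2`. -/
def coef (φ : OpenPartialHomeomorph M (Cn n)) (w : TwoForm n M) (y : Cn n) :
    Matrix (Fin n) (Fin n) ℂ := fun k l =>
  -(Complex.I / 4) *
    (formLoc φ w y ![Pi.single k 1, Pi.single l 1]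
      + Complex.I * formLoc φ w y ![Pi.single k 1, Pi.single l Complex.I]
      - Complex.I * formLoc φ w y ![Pi.single k Complex.I, Pi.single l 1]
      + formLoc φ w y ![Pi.single k Complex.I, Pi.single l Complex.I])

/-- A closed (1,1)-form is pseudo-Kähler if it is real and nondegenerate. -/
structure IsPseudoKahler (w : ClosedForm11 n M) : Prop where
  real : ∀ x v, ((w : TwoForm n M) x v).im = 0
  nondeg : ∀ φ : OpenPartialHomeomorph M (Cn n), IsHolChart φ → ∀ y ∈ φ.target,
    (coef φ w y).det ≠ 0

/-! ### Tensors `g^{lk}` of type (1,1), their brackets, and infinitesimal deformations -/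

variable (n M) in
/-- Components `g^{lk}` (`l` antiholomorphic, `k` holomorphic) of a bivector field of type (1,1)
in all charts. -/
abbrev Tensor11 : Type _ := OpenPartialHomeomorph M (Cn n) → Cn n → Matrix (Fin n) (Fin n) ℂ

/-- The Kähler-Poisson tensor of a pseudo-Kähler form: the inverse `g^{lk}` of `g_{kl}`. -/
def kahlerPoisson (w : ClosedForm11 n M) : Tensor11 n M := fun φ y => (coef φ w y)⁻¹

/-- The tensor `h^{lk} = - g^{lp} κ_{pq} g^{qk}` determined by a closed (1,1)-form `κ`; if
`κ = i ∂∂̄ψ` then `κ_{pq} = ∂²ψ / ∂z^p ∂z̄^q`. -/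
def deformationTensor (w κ : ClosedForm11 n M) : Tensor11 n M := fun φ y =>
  -(kahlerPoisson w φ y * coef φ κ y * kahlerPoisson w φ y)

/-- `b = g^{lk} (∂f₁/∂z̄^l ∂f₂/∂z^k - ∂f₂/∂z̄^l ∂f₁/∂z^k)`, the bracket of `f₁` and `f₂` given by
the bivector field `g^{lk}`. -/
def IsBracket (g : Tensor11 n M) (f₁ f₂ b : Sm n M) : Prop :=
  ∀ φ : OpenPartialHomeomorph M (Cn n), IsHolChart φ → ∀ y ∈ φ.target,
    loc φ b y = ∑ l, ∑ k, g φ y l k *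
      (dzb l (loc φ f₁) y * dz k (loc φ f₂) y - dzb l (loc φ f₂) y * dz k (loc φ f₁) y)

/-- `g^{lk} + ε h^{lk}` satisfies the Jacobi identity modulo `ε²`, to order one in `ε`. -/
def IsInfinitesimalDeformation (g h : Tensor11 n M) : Prop :=
  ∀ φ : OpenPartialHomeomorph M (Cn n), IsHolChart φ → ∀ y ∈ φ.target,
    (∀ l q p : Fin n,
      ∑ k, (g φ y l k * dz k (fun z => h φ z q p) y + h φ y l k * dz k (fun z => g φ z q p) y) =
      ∑ k, (g φ y q k * dz k (fun z => h φ z l p) y + h φ y q k * dz k (fun z => g φ z l p) y)) ∧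
    (∀ k q p : Fin n,
      ∑ l, (g φ y l k * dzb l (fun z => h φ z q p) y + h φ y l k * dzb l (fun z => g φ z q p) y) =
      ∑ l, (g φ y l p * dzb l (fun z => h φ z q k) y + h φ y l p * dzb l (fun z => g φ z q k) y))

/-! ### Star products with separation of variables -/

variable (n M) in
/-- A sequence `C_r` of bilinear operators on `C^∞(M)`; it defines the product
`f ∗ g = ∑ ν^r C_r(f, g)` on `C^∞(M)[[ν]]`. -/
abbrev BilinSeq : Type _ := ℕ → Sm n M →ₗ[ℂ] Sm n M →ₗ[ℂ] Sm n M

/-- `C` is a bidifferential operator such that, in local coordinates, only the derivatives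
`∂^γ f ∂^δ g` with `A γ δ` occur in `C(f, g)`. -/
def IsBidifferential (A : MultiIdx n → MultiIdx n → Prop)
    (C : Sm n M →ₗ[ℂ] Sm n M →ₗ[ℂ] Sm n M) : Prop :=
  LocallyInCharts M fun φ V => ∃ (N : ℕ) (c : MultiIdx n → MultiIdx n → Cn n → ℂ),
    (∀ γ δ, ContDiffOn ℝ ∞ (c γ δ) V) ∧
    (∀ γ δ, ¬ A γ δ → c γ δ = 0) ∧
    ∀ f g : Sm n M, ∀ y ∈ V, loc φ (C f g) y = ∑ γ ∈ idxLE n N, ∑ δ ∈ idxLE n N,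
      c γ δ y * pderiv γ (loc φ f) y * pderiv δ (loc φ g) y

/-- `C` defines a differential star product on `M` with the Poisson tensor `g`. -/
structure IsStarProduct (g : Tensor11 n M) (C : BilinSeq n M) : Prop where
  bidifferential : ∀ r, IsBidifferential (fun _ _ => True) (C r)
  zero : ∀ f₁ f₂, C 0 f₁ f₂ = f₁ * f₂
  one_left : ∀ r f, 1 ≤ r → C r 1 f = 0
  one_right : ∀ r f, 1 ≤ r → C r f 1 = 0
  assoc : ∀ f₁ f₂ f₃ r,
    ∑ p ∈ Finset.HasAntidiagonal.antidiagonal r, C p.1 (C p.2 f₁ f₂) f₃ =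
    ∑ p ∈ Finset.HasAntidiagonal.antidiagonal r, C p.1 f₁ (C p.2 f₂ f₃)
  bracket : ∀ f₁ f₂, IsBracket g f₁ f₂ (C 1 f₁ f₂ - C 1 f₂ f₁)

/-- Separation of variables: each `C_r` differentiates its first argument only in
antiholomorphic and its second argument only in holomorphic directions. -/
def HasSeparationOfVariables (C : BilinSeq n M) : Prop :=
  ∀ r, IsBidifferential
    (fun γ δ => (∀ k, γ (Sum.inl k) = 0) ∧ (∀ k, δ (Sum.inr k) = 0)) (C r)

/-- The coefficients of `ν ω = ω₋₁ + ν ω₀ + ν² ω₁ + …`. -/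
def formalForm (wm : ClosedForm11 n M) (W : ℕ → ClosedForm11 n M) : ℕ → ClosedForm11 n M
  | 0 => wm
  | r + 1 => W r

/-- The star product with separation of variables `C` is parametrized by the formal form
`ω = ν⁻¹ ω₋₁ + ω₀ + ν ω₁ + …` (`ω₋₁ = wm`, `ω_r = W r`): near each point of each coordinate chart
there are potentials `Φ` of `ω`, `ω_r = i ∂∂̄Φ_r`, such that
`L_{ν ∂Φ/∂z^k} = ν (∂Φ/∂z^k + ∂/∂z^k)` and `R_{ν ∂Φ/∂z̄^l} = ν (∂Φ/∂z̄^l + ∂/∂z̄^l)`.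
In the code `Φ r` is the coefficient of `ν^r` in `ν Φ`. The star product of the local function
`ν ∂Φ/∂z^k` and `v` at a point is computed by replacing `ν ∂Φ/∂z^k` with any global formal
function `u` with the same germ at that point. -/
def IsParametrizedBy (C : BilinSeq n M) (wm : ClosedForm11 n M) (W : ℕ → ClosedForm11 n M) :
    Prop :=
  LocallyInCharts M fun φ V => ∃ Φ : ℕ → Cn n → ℂ,
    (∀ r, ContDiffOn ℝ ∞ (Φ r) V) ∧
    (∀ r, ∀ y ∈ V, ∀ k l, coef φ (formalForm wm W r) y k l = dz k (dzb l (Φ r)) y) ∧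
    (∀ y ∈ V, ∀ k, ∀ u : ℕ → Sm n M, (∀ r, loc φ (u r) =ᶠ[𝓝 y] dz k (Φ r)) →
      ∀ (v : Sm n M) (r : ℕ),
        ∑ p ∈ Finset.HasAntidiagonal.antidiagonal r, loc φ (C p.1 (u p.2) v) y =
          dz k (Φ r) y * loc φ v y + if r = 1 then dz k (loc φ v) y else 0) ∧
    (∀ y ∈ V, ∀ l, ∀ u : ℕ → Sm n M, (∀ r, loc φ (u r) =ᶠ[𝓝 y] dzb l (Φ r)) →
      ∀ (v : Sm n M) (r : ℕ),
        ∑ p ∈ Finset.HasAntidiagonal.antidiagonal r, loc φ (C p.1 v (u p.2)) y =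
          dzb l (Φ r) y * loc φ v y + if r = 1 then dzb l (loc φ v) y else 0)

/-! ### Functions on the formal neighbourhood of the zero section of `T^*M` -/

variable (n M) in
/-- Complex-valued functions on the real cotangent bundle of `M` (no regularity). -/
abbrev CotFn : Type _ := (x : M) → (TangentSpace 𝓘(ℝ, Cn n) x →L[ℝ] ℝ) → ℂ

/-- The real covector `ζ_k dz^k + ζ̄_k dz̄^k` at `x`. -/
def covec (φ : OpenPartialHomeomorph M (Cn n)) (x : M) (ζ : Cn n) :
    TangentSpace 𝓘(ℝ, Cn n) x →L[ℝ] ℝ :=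
  mfderiv 𝓘(ℝ, Cn n) 𝓘(ℝ, ℝ) (fun p : M => 2 * (∑ k, ζ k * φ p k).re) x

/-- The expression of a function on `T^*M` in the coordinates `(z, ζ)` induced by a chart. -/
def cotLoc (φ : OpenPartialHomeomorph M (Cn n)) (P : CotFn n M) (z ζ : Cn n) : ℂ :=
  P (φ.symm z) (covec φ (φ.symm z) ζ)

/-- `P` is a smooth function on `T^*M` which is a homogeneous polynomial of degree `r` on the
fibres. -/
def IsFibrePolynomial (r : ℕ) (P : CotFn n M) : Prop :=
  LocallyInCharts M fun φ V => ∃ a : MultiIdx n → Cn n → ℂ,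
    (∀ γ, ContDiffOn ℝ ∞ (a γ) V) ∧
    ∀ z ∈ V, ∀ ζ, cotLoc φ P z ζ = ∑ γ ∈ idxEq n r, a γ z * fibMon γ ζ

variable (n M) in
/-- `C^∞(T^*M, Z)`: functions on the formal neighbourhood of the zero section `Z`, given by their
Taylor series along the fibres, i.e. formal sums `F = ∑ F_r` where `F_r` is a smooth function on
`T^*M` that is a homogeneous polynomial of degree `r` on the fibres. -/
def FormalFn : Submodule ℂ (ℕ → CotFn n M) where
  carrier := {F | ∀ r, IsFibrePolynomial r (F r)}
  add_mem' := by
    intro F G hF hG r φ hφ y hy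
    obtain ⟨V, hV, hyV, hVt, a, ha, hFa⟩ := hF r φ hφ y hy
    obtain ⟨V', hV', hyV', -, b, hb, hGb⟩ := hG r φ hφ y hy
    refine ⟨V ∩ V', hV.inter hV', ⟨hyV, hyV'⟩, Set.inter_subset_left.trans hVt,
      fun γ z => a γ z + b γ z,
      fun γ => ((ha γ).mono Set.inter_subset_left).add ((hb γ).mono Set.inter_subset_right),
      fun z hz ζ => ?_⟩
    have h : cotLoc φ ((F + G) r) z ζ = cotLoc φ (F r) z ζ + cotLoc φ (G r) z ζ := rfl
    rw [h, hFa z hz.1, hGb z hz.2, ← Finset.sum_add_distrib]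
    simp only [add_mul]
  zero_mem' := by
    intro r φ hφ y hy
    refine ⟨φ.target, φ.open_target, hy, subset_rfl, fun _ _ => 0, fun _ => contDiffOn_const,
      fun z hz ζ => ?_⟩
    simp [cotLoc]
  smul_mem' := by
    intro c F hF r φ hφ y hy
    obtain ⟨V, hV, hyV, hVt, a, ha, hFa⟩ := hF r φ hφ y hy
    refine ⟨V, hV, hyV, hVt, fun γ z => c * a γ z, fun γ => contDiffOn_const.mul (ha γ),
      fun z hz ζ => ?_⟩
    have h : cotLoc φ ((c • F) r) z ζ = c * cotLoc φ (F r) z ζ := rfl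
    rw [h, hFa z hz, Finset.mul_sum]
    simp only [mul_assoc]

/-- The component of degree `r` of `F`. -/
def fcomp (F : FormalFn n M) (r : ℕ) : CotFn n M := (F : ℕ → CotFn n M) r

/-- The component of degree `r` of the product of `F` and `G`. -/
def formalMul (F G : FormalFn n M) (r : ℕ) : CotFn n M :=
  ∑ p ∈ Finset.HasAntidiagonal.antidiagonal r, fcomp F p.1 * fcomp G p.2

/-- The standard Poisson bracket on `T^*M` in the coordinates induced by a chart, with the sign
such that `{ζ_k, f} = ∂f/∂z^k`. -/
def pbLoc (φ : OpenPartialHomeomorph M (Cn n)) (P Q : CotFn n M) (z ζ : Cn n) : ℂ :=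
  ∑ k, (dz k (fun η => cotLoc φ P z η) ζ * dz k (fun y => cotLoc φ Q y ζ) z
      - dz k (fun y => cotLoc φ P y ζ) z * dz k (fun η => cotLoc φ Q z η) ζ
      + dzb k (fun η => cotLoc φ P z η) ζ * dzb k (fun y => cotLoc φ Q y ζ) z
      - dzb k (fun y => cotLoc φ P y ζ) z * dzb k (fun η => cotLoc φ Q z η) ζ)

/-- The component of degree `r` of the Poisson bracket of `F` and `G`, in coordinates. -/
def formalPbLoc (φ : OpenPartialHomeomorph M (Cn n)) (F G : FormalFn n M) (r : ℕ)
    (z ζ : Cn n) : ℂ :=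
  ∑ p ∈ Finset.HasAntidiagonal.antidiagonal (r + 1), pbLoc φ (fcomp F p.1) (fcomp G p.2) z ζ

/-- The restriction `E F` of `F` to the zero section. -/
def restrictZero (F : FormalFn n M) : M → ℂ := fun x => fcomp F 0 x 0

/-! ### The `σ`-symbol of a natural formal differential operator -/

/-- `A` is a differential operator of order at most `r` with principal symbol `σ_r(A) = P`. -/
def HasPrincipalSymbol (A : Sm n M →ₗ[ℂ] Sm n M) (r : ℕ) (P : CotFn n M) : Prop :=
  LocallyInCharts M fun φ V => ∃ a : MultiIdx n → Cn n → ℂ,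
    (∀ γ, ContDiffOn ℝ ∞ (a γ) V) ∧
    (∀ f : Sm n M, ∀ y ∈ V, loc φ (A f) y = ∑ γ ∈ idxLE n r, a γ y * pderiv γ (loc φ f) y) ∧
    ∀ y ∈ V, ∀ ζ, cotLoc φ P y ζ = ∑ γ ∈ idxEq n r, a γ y * fibMon γ ζ

/-- The formal differential operator `A = ∑ ν^r A_r` is natural (the order of `A_r` is at most
`r`) and its `σ`-symbol is `σ(A) = ∑ σ_r(A_r) = F`. -/
def HasSigmaSymbol (A : ℕ → Sm n M →ₗ[ℂ] Sm n M) (F : FormalFn n M) : Prop :=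
  ∀ r, HasPrincipalSymbol (A r) r (fcomp F r)

/-- The left multiplication operator `L_f`. -/
def leftMul (C : BilinSeq n M) (f : Sm n M) : ℕ → Sm n M →ₗ[ℂ] Sm n M := fun r => C r f

/-- The right multiplication operator `R_f`. -/
def rightMul (C : BilinSeq n M) (f : Sm n M) : ℕ → Sm n M →ₗ[ℂ] Sm n M := fun r => (C r).flip f

/-! ### Deformation formal symplectic groupoids -/

variable (n M) in
/-- An `ε`-linear map `S = S₀ + ε S₁` from `C^∞(M)[ε]` to `C^∞(T^*M, Z)[ε]`, `ε² = 0`. -/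
structure EpsMap where
  /-- The component `S₀`. -/
  c0 : Sm n M →ₗ[ℂ] FormalFn n M
  /-- The component `S₁`. -/
  c1 : Sm n M →ₗ[ℂ] FormalFn n M

/-- `S = S₀ + ε S₁` is a unital multiplicative map with `E S f = f`. -/
structure IsUnitalMorphism (S : EpsMap n M) : Prop where
  unit0 : ∀ f, restrictZero (S.c0 f) = f
  unit1 : ∀ f, restrictZero (S.c1 f) = 0
  mul0 : ∀ f g r, fcomp (S.c0 (f * g)) r = formalMul (S.c0 f) (S.c0 g) r
  mul1 : ∀ f g r, fcomp (S.c1 (f * g)) r =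
    formalMul (S.c0 f) (S.c1 g) r + formalMul (S.c1 f) (S.c0 g) r

/-- With `s = 1` (`s = -1`): `S = S₀ + ε S₁` is a Poisson (an anti-Poisson) map for the bracket
`{·,·}₀ + ε {·,·}₁` on `C^∞(M)[ε]` given by `g + ε h`. -/
structure IsPoissonMap (s : ℂ) (g h : Tensor11 n M) (S : EpsMap n M) : Prop where
  bracket0 : ∀ f₁ f₂ b₀ : Sm n M, IsBracket g f₁ f₂ b₀ →
    ∀ φ : OpenPartialHomeomorph M (Cn n), IsHolChart φ → ∀ z ∈ φ.target, ∀ ζ r,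
      cotLoc φ (fcomp (S.c0 b₀) r) z ζ = s * formalPbLoc φ (S.c0 f₁) (S.c0 f₂) r z ζ
  bracket1 : ∀ f₁ f₂ b₀ b₁ : Sm n M, IsBracket g f₁ f₂ b₀ → IsBracket h f₁ f₂ b₁ →
    ∀ φ : OpenPartialHomeomorph M (Cn n), IsHolChart φ → ∀ z ∈ φ.target, ∀ ζ r,
      cotLoc φ (fcomp (S.c1 b₀) r) z ζ + cotLoc φ (fcomp (S.c0 b₁) r) z ζ =
        s * (formalPbLoc φ (S.c0 f₁) (S.c1 f₂) r z ζ + formalPbLoc φ (S.c1 f₁) (S.c0 f₂) r z ζ)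

/-- `S` and `T` are the source and target mappings of a deformation formal symplectic groupoid
over `(M, g + ε h)`. -/
structure IsDeformationGroupoid (g h : Tensor11 n M) (S T : EpsMap n M) : Prop where
  source : IsUnitalMorphism S
  target : IsUnitalMorphism T
  source_poisson : IsPoissonMap 1 g h S
  target_antiPoisson : IsPoissonMap (-1) g h T
  commute0 : ∀ f₁ f₂, ∀ φ : OpenPartialHomeomorph M (Cn n), IsHolChart φ →
    ∀ z ∈ φ.target, ∀ ζ r, formalPbLoc φ (S.c0 f₁) (T.c0 f₂) r z ζ = 0
  commute1 : ∀ f₁ f₂, ∀ φ : OpenPartialHomeomorph M (Cn n), IsHolChart φ →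
    ∀ z ∈ φ.target, ∀ ζ r,
      formalPbLoc φ (S.c0 f₁) (T.c1 f₂) r z ζ + formalPbLoc φ (S.c1 f₁) (T.c0 f₂) r z ζ = 0

/-- Near `x`, the map `S` sends `f` to (the pull-back to `T^*M` of) `f`. -/
def FixesAt (S : EpsMap n M) (f : Sm n M) (x : M) : Prop :=
  ∀ r ξ, fcomp (S.c0 f) r x ξ = (if r = 0 then (f : M → ℂ) x else 0) ∧ fcomp (S.c1 f) r x ξ = 0

/-- Separation of variables for a groupoid: `S a = a` for local holomorphic functions `a` and
`T b = b` for local antiholomorphic functions `b`. -/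
structure GroupoidSeparatesVariables (S T : EpsMap n M) : Prop where
  source : ∀ (a : Sm n M) (x : M),
    (∀ᶠ p in 𝓝 x, MDifferentiableAt 𝓘(ℂ, Cn n) 𝓘(ℂ, ℂ) (a : M → ℂ) p) → FixesAt S a x
  target : ∀ (b : Sm n M) (x : M),
    (∀ᶠ p in 𝓝 x, MDifferentiableAt 𝓘(ℂ, Cn n) 𝓘(ℂ, ℂ)
      (fun q => (starRingEnd ℂ) ((b : M → ℂ) q)) p) → FixesAt T b x

/-- The operator `ζ_k g^{lk} ∂/∂z̄^l` on functions of `(z, ζ)`. -/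
def sourceField (g : Tensor11 n M) (φ : OpenPartialHomeomorph M (Cn n))
    (F : Cn n → Cn n → ℂ) (z ζ : Cn n) : ℂ :=
  ∑ k, ∑ l, ζ k * g φ z l k * dzb l (fun y => F y ζ) z

/-- The operator `ζ̄_l g^{lk} ∂/∂z^k` on functions of `(z, ζ)`. -/
def targetField (g : Tensor11 n M) (φ : OpenPartialHomeomorph M (Cn n))
    (F : Cn n → Cn n → ℂ) (z ζ : Cn n) : ℂ :=
  ∑ k, ∑ l, (starRingEnd ℂ) (ζ l) * g φ z l k * dz k (fun y => F y ζ) z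

/-- The operator `D + ε E` acting on `F₀ + ε F₁`, written as the pair `(F₀, F₁)`. -/
def epsOp (D E : (Cn n → Cn n → ℂ) → Cn n → Cn n → ℂ)
    (F : (Cn n → Cn n → ℂ) × (Cn n → Cn n → ℂ)) : (Cn n → Cn n → ℂ) × (Cn n → Cn n → ℂ) :=
  (D F.1, D F.2 + E F.1)

/-- `S f = exp(D + ε E) f` in all charts, where `D` and `E` are operators of degree one in `ζ`;
thus the component of degree `r` of `S f` is `(D + ε E)^r f / r!`. -/
def IsExpOf (S : EpsMap n M)
    (D E : OpenPartialHomeomorph M (Cn n) → (Cn n → Cn n → ℂ) → Cn n → Cn n → ℂ) : Prop :=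
  ∀ φ : OpenPartialHomeomorph M (Cn n), IsHolChart φ → ∀ (f : Sm n M) (r : ℕ),
    ∀ z ∈ φ.target, ∀ ζ,
      cotLoc φ (fcomp (S.c0 f) r) z ζ =
        ((epsOp (D φ) (E φ))^[r] (fun y _ => loc φ f y, 0)).1 z ζ / (r.factorial : ℂ) ∧
      cotLoc φ (fcomp (S.c1 f) r) z ζ =
        ((epsOp (D φ) (E φ))^[r] (fun y _ => loc φ f y, 0)).2 z ζ / (r.factorial : ℂ)

/-- `S` and `T` are the source and target mappings of the deformation groupoid with separation of
variables corresponding to the infinitesimal deformation `g + ε h` of the Kähler-Poisson tensor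
`g`. -/
structure IsGroupoidOfDeformation (g h : Tensor11 n M) (S T : EpsMap n M) : Prop where
  deformation : IsInfinitesimalDeformation g h
  groupoid : IsDeformationGroupoid g h S T
  separation : GroupoidSeparatesVariables S T
  source_exp : IsExpOf S (sourceField g) (sourceField h)
  target_exp : IsExpOf T (targetField g) (targetField h)

/-- The pair of star products `C`, `C'` is natural with the same formal symplectic groupoid, and
`S`, `T` are the mappings of its deformation groupoid:
`S₀ f = σ(L_f) = σ(L̃_f)`, `S₁ f = σ(ν⁻¹ (L_f - L̃_f))`,
`T₀ f = σ(R_f) = σ(R̃_f)`, `T₁ f = σ(ν⁻¹ (R_f - R̃_f))`. -/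
structure IsGroupoidOfPair (C C' : BilinSeq n M) (S T : EpsMap n M) : Prop where
  source0 : ∀ f, HasSigmaSymbol (leftMul C f) (S.c0 f) ∧ HasSigmaSymbol (leftMul C' f) (S.c0 f)
  source1 : ∀ f, HasSigmaSymbol (fun r => leftMul C f (r + 1) - leftMul C' f (r + 1)) (S.c1 f)
  target0 : ∀ f, HasSigmaSymbol (rightMul C f) (T.c0 f) ∧ HasSigmaSymbol (rightMul C' f) (T.c0 f)
  target1 : ∀ f, HasSigmaSymbol (fun r => rightMul C f (r + 1) - rightMul C' f (r + 1)) (T.c1 f)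

/-- The bracket `{f₁, f₂}₁ = D₂(f₁, f₂) - D̃₂(f₁, f₂)` of a pair of star products, where
`D₂(f₁, f₂) = C₂(f₁, f₂) - C₂(f₂, f₁)`. -/
def pairBracket (C C' : BilinSeq n M) (f₁ f₂ : Sm n M) : Sm n M :=
  (C 2 f₁ f₂ - C 2 f₂ f₁) - (C' 2 f₁ f₂ - C' 2 f₂ f₁)

end

end

/-! Write `L_f = ∑ ν^r A_r`. By associativity `L_f` commutes with all right multiplications, in
particular with the first order operators `R_{ν∂Φ/∂z̄^l} = ν(∂Φ/∂z̄^l + ∂/∂z̄^l)`. If `νΦ = ∑ ν^q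
Φ_q` and `u_{l,q} = ∂Φ_q/∂z̄^l`, the coefficient of `ν^{r+1}` reads `∑_{p+q=r+1} [A_p, u_{l,q}] =
[∂/∂z̄^l, A_r]`. The operators `A_p` differentiate in holomorphic directions only and `∂u_{l,0}/∂z^k
= g_{kl}` is invertible, so the commutators with `u_{l,0}` determine the leading part of `A_{r+1}`.
By induction `A_r` has order at most `r` (`IsCommutingPair.hasSidedOrder`), and `(r+1)
σ_{r+1}(A_{r+1}) = ζ_k g^{lk} ∂σ_r(A_r)/∂z̄^l` (`cotLoc_symb_succ`). Hence `σ(L_f) = exp(ζ_k g^{lk}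
∂/∂z̄^l) f`, which depends on `ω₋₁` alone. For two products with the same `ω₋₁` the leading parts
cancel, so the difference of the operators loses one order (`IsCommutant.sub_order`). Its symbol
satisfies the same recursion with one more term, the symbol of `[Ã_{r+1}, u_{l,1} - ũ_{l,1}]`. The
functions `u_{l,1} - ũ_{l,1}` have holomorphic derivatives `ϰ_{kl}`; expressing them to first order
through the `u_{q,0}` puts `ϰ` between two copies of the inverse matrix and produces `h = -gϰg`
(`cotLoc_symb_sub_succ`). So `S₀ + εS₁` is the exponential for `g + εh`; its component of fibre
degree one is the assertion about `C₂ - C̃₂` (`IsPolarizedPair.loc_sub_two`). The groupoid axioms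
are algebra over the dual numbers. There `g + εh` is the inverse of the matrix `g_{kl} + εϰ_{kl}`,
which is closed because it has local potentials. Closedness gives the Jacobi identity and makes the
fields `∑_l g^{lk} ∂/∂z̄^l` commute, whence `∂F/∂ζ_k = g^{lk} ∂F/∂z̄^l` for an exponential series
`F` (`p_succ`, `y_eq`). Such a series is determined by its restriction to the zero section
(`IsExpSeq.ext`), so the source map is multiplicative and Poisson as soon as products and brackets
of exponential series are exponential series (`IsExpSeq.mul`, `bracket_expSeq`). The bracket of a
source series and a target series telescopes to zero. Right multiplications are left multiplications
of the opposite product, which exchanges the holomorphic and antiholomorphic directions. For this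
reason everything is proved for a pair of complementary families of directions `σ`, `τ`, and is used
once for each order of the two. -/

noncomputable section

/-! ### Wirtinger-type derivations -/

/-- The complex derivation `(∂_a + s ∂_b) / 2` acting on complex-valued functions. -/
def wirt {E : Type*} [NormedAddCommGroup E] [NormedSpace ℝ E] (s : ℂ) (a b : E) (F : E → ℂ)
    (y : E) : ℂ :=
  (fderiv ℝ F y a + s * fderiv ℝ F y b) / 2

section wirt

variable {E : Type*} [NormedAddCommGroup E] [NormedSpace ℝ E] (s : ℂ) (a b : E)

lemma wirt_congr {F G : E → ℂ} {y : E} (h : F =ᶠ[𝓝 y] G) : wirt s a b F y = wirt s a b G y := by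
  simp only [wirt, h.fderiv_eq]

lemma wirt_congr_of_eqOn {F G : E → ℂ} {U : Set E} (hU : IsOpen U) (h : Set.EqOn F G U) :
    Set.EqOn (wirt s a b F) (wirt s a b G) U := fun _ hy =>
  wirt_congr s a b (h.eventuallyEq_of_mem (hU.mem_nhds hy))

lemma wirt_const (c : ℂ) (y : E) : wirt s a b (fun _ => c) y = 0 := by
  simp [wirt]

lemma wirt_add {F G : E → ℂ} {y : E} (hF : DifferentiableAt ℝ F y)
    (hG : DifferentiableAt ℝ G y) :
    wirt s a b (F + G) y = wirt s a b F y + wirt s a b G y := by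
  simp only [wirt, fderiv_add hF hG, add_apply]
  ring

lemma wirt_mul {F G : E → ℂ} {y : E} (hF : DifferentiableAt ℝ F y)
    (hG : DifferentiableAt ℝ G y) :
    wirt s a b (F * G) y = F y * wirt s a b G y + G y * wirt s a b F y := by
  simp only [wirt, fderiv_mul hF hG, add_apply,
    smul_apply, smul_eq_mul]
  ring

lemma wirt_const_mul {F : E → ℂ} {y : E} (c : ℂ) (hF : DifferentiableAt ℝ F y) :
    wirt s a b (fun z => c * F z) y = c * wirt s a b F y := by
  have h := wirt_mul s a b (differentiableAt_const (x := y) (𝕜 := ℝ) c) hF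
  rw [wirt_const, mul_zero, add_zero] at h
  exact h

lemma ContDiffOn.wirt {F : E → ℂ} {U : Set E} (hF : ContDiffOn ℝ ∞ F U) (hU : IsOpen U) :
    ContDiffOn ℝ ∞ (wirt s a b F) U := by
  have h : ContDiffOn ℝ ∞ (fderiv ℝ F) U := hF.fderiv_of_isOpen hU (by simp)
  have ha : ContDiffOn ℝ ∞ (fun y => fderiv ℝ F y a) U := h.clm_apply contDiffOn_const
  have hb : ContDiffOn ℝ ∞ (fun y => fderiv ℝ F y b) U := h.clm_apply contDiffOn_const
  exact (ha.add (contDiffOn_const.mul hb)).div_const 2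

lemma ContDiffOn.diffAt {F : E → ℂ} {U : Set E} (hF : ContDiffOn ℝ ∞ F U) (hU : IsOpen U)
    {y : E} (hy : y ∈ U) : DifferentiableAt ℝ F y :=
  (hF.contDiffAt (hU.mem_nhds hy)).differentiableAt (by simp)

lemma fderiv_wirt {F : E → ℂ} {U : Set E} (hF : ContDiffOn ℝ ∞ F U) (hU : IsOpen U)
    {y : E} (hy : y ∈ U) (v : E) : fderiv ℝ (_root_.wirt s a b F) y v =
      (fderiv ℝ (fderiv ℝ F) y v a + s * fderiv ℝ (fderiv ℝ F) y v b) / 2 := by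
  have h : ContDiffOn ℝ ∞ (fderiv ℝ F) U := hF.fderiv_of_isOpen hU (by simp)
  have hd : DifferentiableAt ℝ (fderiv ℝ F) y :=
    (h.contDiffAt (hU.mem_nhds hy)).differentiableAt (by simp)
  have key : ∀ e : E, HasFDerivAt (fun y => fderiv ℝ F y e)
      ((fderiv ℝ (fderiv ℝ F) y).flip e) y := by
    intro e
    have := hd.hasFDerivAt.clm_apply (hasFDerivAt_const e y)
    simpa using this
  have hh : HasFDerivAt (_root_.wirt s a b F)
      ((2 : ℂ)⁻¹ • ((fderiv ℝ (fderiv ℝ F) y).flip a +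
        s • (fderiv ℝ (fderiv ℝ F) y).flip b)) y := by
    have := ((key a).add ((key b).const_mul s)).const_mul (2 : ℂ)⁻¹
    refine this.congr_of_eventuallyEq (Filter.Eventually.of_forall fun z => ?_)
    simp only [_root_.wirt, Pi.add_apply]
    ring
  rw [hh.fderiv]
  simp only [smul_apply, add_apply,
    ContinuousLinearMap.flip_apply, smul_eq_mul]
  ring

lemma wirt_comm {F : E → ℂ} {U : Set E} (hF : ContDiffOn ℝ ∞ F U) (hU : IsOpen U)
    (s' : ℂ) (a' b' : E) {y : E} (hy : y ∈ U) :
    wirt s a b (wirt s' a' b' F) y = wirt s' a' b' (wirt s a b F) y := by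
  have hs : IsSymmSndFDerivAt ℝ F y :=
    (hF.contDiffAt (hU.mem_nhds hy)).isSymmSndFDerivAt
      (by rw [minSmoothness_of_isRCLikeNormedField]; exact WithTop.coe_le_coe.2 le_top)
  have e := fun v w => hs.eq v w
  rw [wirt.eq_1 s a b, wirt.eq_1 s' a' b']
  simp only [fderiv_wirt _ _ _ hF hU hy]
  rw [e a a', e a b', e b a', e b b']
  ring

end wirt

lemma dz_eq_wirt {n : ℕ} (k : Fin n) :
    dz k = wirt (-Complex.I) (Pi.single k 1 : Cn n) (Pi.single k Complex.I) := by
  funext F y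
  simp only [dz, wirt]
  ring

lemma dzb_eq_wirt {n : ℕ} (k : Fin n) :
    dzb k = wirt Complex.I (Pi.single k 1 : Cn n) (Pi.single k Complex.I) := rfl

/-- The derivations `∂/∂z^k` and `∂/∂z̄^l`, indexed by a sum type. -/
def wd {n : ℕ} : Fin n ⊕ Fin n → (Cn n → ℂ) → Cn n → ℂ
  | Sum.inl k => dz k
  | Sum.inr k => dzb k

lemma wd_eq_wirt {n : ℕ} (i : Fin n ⊕ Fin n) : ∃ s, ∃ a b : Cn n, wd i = wirt s a b := by
  cases i with
  | inl k => exact ⟨_, _, _, dz_eq_wirt k⟩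
  | inr k => exact ⟨_, _, _, dzb_eq_wirt k⟩

section wd

variable {n : ℕ} {U : Set (Cn n)} (i : Fin n ⊕ Fin n)

lemma wd_congr {F G : Cn n → ℂ} {y : Cn n} (h : F =ᶠ[𝓝 y] G) : wd i F y = wd i G y := by
  obtain ⟨s, a, b, e⟩ := wd_eq_wirt i
  rw [e, wirt_congr _ _ _ h]

lemma wd_congr_of_eqOn {F G : Cn n → ℂ} (hU : IsOpen U) (h : Set.EqOn F G U) :
    Set.EqOn (wd i F) (wd i G) U := fun _ hy =>
  wd_congr i (h.eventuallyEq_of_mem (hU.mem_nhds hy))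

lemma wd_const (c : ℂ) (y : Cn n) : wd i (fun _ => c) y = 0 := by
  obtain ⟨s, a, b, e⟩ := wd_eq_wirt i
  rw [e, wirt_const]

lemma wd_add {F G : Cn n → ℂ} {y : Cn n} (hF : DifferentiableAt ℝ F y)
    (hG : DifferentiableAt ℝ G y) : wd i (F + G) y = wd i F y + wd i G y := by
  obtain ⟨s, a, b, e⟩ := wd_eq_wirt i
  rw [e, wirt_add _ _ _ hF hG]

lemma wd_mul {F G : Cn n → ℂ} {y : Cn n} (hF : DifferentiableAt ℝ F y)
    (hG : DifferentiableAt ℝ G y) : wd i (F * G) y = F y * wd i G y + G y * wd i F y := by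
  obtain ⟨s, a, b, e⟩ := wd_eq_wirt i
  rw [e, wirt_mul _ _ _ hF hG]

lemma wd_const_mul {F : Cn n → ℂ} {y : Cn n} (c : ℂ) (hF : DifferentiableAt ℝ F y) :
    wd i (fun z => c * F z) y = c * wd i F y := by
  obtain ⟨s, a, b, e⟩ := wd_eq_wirt i
  rw [e, wirt_const_mul _ _ _ c hF]

lemma wd_sub {F G : Cn n → ℂ} {y : Cn n} (hF : DifferentiableAt ℝ F y)
    (hG : DifferentiableAt ℝ G y) : wd i (F - G) y = wd i F y - wd i G y := by
  have h := wd_add i hF (hG.const_mul (-1 : ℂ))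
  rw [wd_const_mul i _ hG] at h
  have h2 : F - G = F + fun z => -1 * G z := by
    funext z
    simp [sub_eq_add_neg]
  rw [h2, h]
  ring

lemma wd_sum {ι : Type*} (t : Finset ι) {F : ι → Cn n → ℂ} {y : Cn n}
    (hF : ∀ j ∈ t, DifferentiableAt ℝ (F j) y) :
    wd i (fun z => ∑ j ∈ t, F j z) y = ∑ j ∈ t, wd i (F j) y := by
  classical
  induction t using Finset.induction_on with
  | empty => simpa using wd_const i 0 y
  | insert j t hj ih =>
    have h := wd_add i (hF j (Finset.mem_insert_self j t))
      (DifferentiableAt.fun_sum fun k hk => hF k (Finset.mem_insert_of_mem hk))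
    rw [ih fun k hk => hF k (Finset.mem_insert_of_mem hk)] at h
    rw [Finset.sum_insert hj, ← h]
    congr 1
    funext z
    simp [Finset.sum_insert hj]

lemma ContDiffOn.wd {F : Cn n → ℂ} (hF : ContDiffOn ℝ ∞ F U) (hU : IsOpen U) :
    ContDiffOn ℝ ∞ (wd i F) U := by
  obtain ⟨s, a, b, e⟩ := wd_eq_wirt i
  rw [e]
  exact hF.wirt _ _ _ hU

lemma wd_comm {F : Cn n → ℂ} (hF : ContDiffOn ℝ ∞ F U) (hU : IsOpen U) (j : Fin n ⊕ Fin n)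
    {y : Cn n} (hy : y ∈ U) : wd i (wd j F) y = wd j (wd i F) y := by
  obtain ⟨s, a, b, e⟩ := wd_eq_wirt i
  obtain ⟨s', a', b', e'⟩ := wd_eq_wirt j
  rw [e, e', wirt_comm _ _ _ hF hU _ _ _ hy]

/-! ### Iterated derivatives -/

/-- The composition of the derivations indexed by a list. -/
def wds (L : List (Fin n ⊕ Fin n)) (F : Cn n → ℂ) : Cn n → ℂ := L.foldr wd F

lemma wds_concat (L : List (Fin n ⊕ Fin n)) (F : Cn n → ℂ) :
    wds (L ++ [i]) F = wds L (wd i F) := by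
  simp [wds]

variable (L : List (Fin n ⊕ Fin n))

lemma wds_congr_of_eqOn {F G : Cn n → ℂ} (hU : IsOpen U) (h : Set.EqOn F G U) :
    Set.EqOn (wds L F) (wds L G) U := by
  induction L with
  | nil => exact h
  | cons i L ih => exact wd_congr_of_eqOn i hU ih

lemma ContDiffOn.wds {F : Cn n → ℂ} (hF : ContDiffOn ℝ ∞ F U) (hU : IsOpen U) :
    ContDiffOn ℝ ∞ (wds L F) U := by
  induction L with
  | nil => exact hF
  | cons i L ih => exact ih.wd i hU

lemma wd_wds {F : Cn n → ℂ} (hF : ContDiffOn ℝ ∞ F U) (hU : IsOpen U) :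
    Set.EqOn (wd i (wds L F)) (wds L (wd i F)) U := by
  induction L with
  | nil => exact fun _ _ => rfl
  | cons j L ih =>
    intro y hy
    change wd i (wd j (wds L F)) y = wd j (wds L (wd i F)) y
    rw [wd_comm i (hF.wds L hU) hU j hy]
    exact wd_congr_of_eqOn j hU ih hy

lemma wds_add {F G : Cn n → ℂ} (hF : ContDiffOn ℝ ∞ F U) (hG : ContDiffOn ℝ ∞ G U)
    (hU : IsOpen U) : Set.EqOn (wds L (F + G)) (wds L F + wds L G) U := by
  induction L with
  | nil => exact fun _ _ => rfl
  | cons j L ih =>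
    intro y hy
    change wd j (wds L (F + G)) y = wd j (wds L F) y + wd j (wds L G) y
    rw [wd_congr_of_eqOn j hU ih hy,
      wd_add j ((hF.wds L hU).diffAt hU hy) ((hG.wds L hU).diffAt hU hy)]

lemma wds_mul_of_wd_eq_zero {q F : Cn n → ℂ} (hq : ContDiffOn ℝ ∞ q U)
    (hF : ContDiffOn ℝ ∞ F U) (hU : IsOpen U) (h : ∀ i ∈ L, ∀ y ∈ U, wd i q y = 0) :
    Set.EqOn (wds L (q * F)) (q * wds L F) U := by
  induction L with
  | nil => exact fun _ _ => rfl
  | cons j L ih =>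
    intro y hy
    change wd j (wds L (q * F)) y = q y * wd j (wds L F) y
    rw [wd_congr_of_eqOn j hU (ih fun i hi => h i (List.mem_cons_of_mem _ hi)) hy,
      wd_mul j (hq.diffAt hU hy) ((hF.wds L hU).diffAt hU hy), h j List.mem_cons_self y hy]
    ring

/-- A derivation lowers the exponent of `v` by exactly one and leaves a smooth cofactor. This drives
the inductions that read off symbols from powers of a function vanishing at a point. -/
lemma wd_pow_succ_mul {v u : Cn n → ℂ} (hv : ContDiffOn ℝ ∞ v U) (hu : ContDiffOn ℝ ∞ u U)
    (hU : IsOpen U) (m : ℕ) :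
    Set.EqOn (wd i (v ^ (m + 1) * u))
      (v ^ m * ((fun z => (m + 1 : ℂ) * (wd i v z * u z)) + v * wd i u)) U := by
  have hs : ∀ m : ℕ, ContDiffOn ℝ ∞ (v ^ m) U := fun m => hv.pow m
  have hp : ∀ m : ℕ, Set.EqOn (wd i (v ^ (m + 1)))
      (fun z => (m + 1 : ℂ) * (v z ^ m * wd i v z)) U := by
    intro m
    induction m with
    | zero =>
      intro y hy
      simp
    | succ m ih =>
      intro y hy
      rw [pow_succ, wd_mul i ((hs (m + 1)).diffAt hU hy) (hv.diffAt hU hy), ih hy]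
      simp only [Pi.pow_apply]
      push_cast
      ring
  intro y hy
  rw [wd_mul i ((hs (m + 1)).diffAt hU hy) (hu.diffAt hU hy), hp m hy]
  simp only [Pi.pow_apply, Pi.mul_apply, Pi.add_apply]
  ring

lemma contDiffOn_wd_remainder {v u : Cn n → ℂ} (hv : ContDiffOn ℝ ∞ v U)
    (hu : ContDiffOn ℝ ∞ u U) (hU : IsOpen U) (m : ℕ) :
    ContDiffOn ℝ ∞ ((fun z => (m + 1 : ℂ) * (wd i v z * u z)) + v * wd i u) U :=
  (contDiffOn_const.mul ((hv.wd i hU).mul hu)).add (hv.mul (hu.wd i hU))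

/-- Derivatives of order at most `m` of a multiple of `v ^ m` at a zero of `v`. -/
lemma wds_pow_mul {v : Cn n → ℂ} (hv : ContDiffOn ℝ ∞ v U)
    (hU : IsOpen U) {y : Cn n} (hy : y ∈ U) (hvy : v y = 0) (m : ℕ) (hL : L.length ≤ m)
    {u : Cn n → ℂ} (hu : ContDiffOn ℝ ∞ u U) :
    wds L (v ^ m * u) y =
      if L.length = m then m.factorial * (L.map fun i => wd i v y).prod * u y else 0 := by
  induction L using List.reverseRecOn generalizing m u with
  | nil =>
    change v y ^ m * u y = _
    rcases m with _ | m
    · simp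
    · simp [hvy]
  | append_singleton L i ih =>
    -- A nonempty list has length greater than zero, so the exponent is positive and one factor `v`
    -- can absorb the innermost derivation.
    rcases m with _ | m
    · simp at hL
    rw [wds_concat, wds_congr_of_eqOn L hU (wd_pow_succ_mul i hv hu hU m) hy,
      ih m (by simpa using hL) (contDiffOn_wd_remainder i hv hu hU m)]
    simp only [List.length_append, List.length_singleton, Nat.add_right_cancel_iff,
      List.map_append, List.prod_append, List.map_cons, List.map_nil, List.prod_singleton,
      Pi.add_apply, Pi.mul_apply, hvy, Nat.factorial_succ]
    split_ifs
    · push_cast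
      ring
    · rfl

/-- Derivatives of order at most `m + 1` of `v ^ m u` at a common zero of `u`, `v` and of the first
derivatives of `u`. -/
lemma wds_pow_mul_eq_zero {v : Cn n → ℂ} (hv : ContDiffOn ℝ ∞ v U)
    (hU : IsOpen U) {y : Cn n} (hy : y ∈ U) (hvy : v y = 0) (m : ℕ) (hL : L.length ≤ m + 1)
    {u : Cn n → ℂ} (hu : ContDiffOn ℝ ∞ u U) (huy : u y = 0) (hL' : ∀ i ∈ L, wd i u y = 0) :
    wds L (v ^ m * u) y = 0 := by
  induction L using List.reverseRecOn generalizing m u with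
  | nil =>
    change v y ^ m * u y = _
    simp [huy]
  | append_singleton L i ih =>
    rcases m with _ | m
    · have : L = [] := List.length_eq_zero_iff.1 (by simpa using hL)
      subst this
      change wd i (v ^ 0 * u) y = 0
      rw [pow_zero, one_mul, hL' i (by simp)]
    have hlen : L.length ≤ m + 1 := by simpa using hL
    -- The first summand is again `v ^ m` times a function flat at `y`, so the induction hypothesis
    -- applies. The second has the exponent `m + 1`; its only possible contribution, at top length,
    -- carries the factor `wd i u y = 0`.
    have e : Set.EqOn (wd i (v ^ (m + 1) * u))
        (v ^ m * (fun z => (m + 1 : ℂ) * (wd i v z * u z)) + v ^ (m + 1) * wd i u) U := by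
      intro z hz
      rw [wd_pow_succ_mul i hv hu hU m hz]
      simp only [Pi.pow_apply, Pi.mul_apply, Pi.add_apply]
      ring
    have h1 : ContDiffOn ℝ ∞ (fun z => (m + 1 : ℂ) * (wd i v z * u z)) U :=
      contDiffOn_const.mul ((hv.wd i hU).mul hu)
    have hs : ∀ m : ℕ, ContDiffOn ℝ ∞ (v ^ m) U := fun m => hv.pow m
    have h2 : ContDiffOn ℝ ∞ (v ^ m * fun z => (m + 1 : ℂ) * (wd i v z * u z)) U :=
      (hs m).mul h1
    have h3 : ContDiffOn ℝ ∞ (v ^ (m + 1) * wd i u) U := (hs (m + 1)).mul (hu.wd i hU)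
    rw [wds_concat, wds_congr_of_eqOn L hU e hy, wds_add L h2 h3 hU hy, Pi.add_apply,
      ih m hlen h1 (by simp [huy]) ?_, wds_pow_mul L hv hU hy hvy (m + 1) hlen (hu.wd i hU),
      hL' i (by simp)]
    · simp
    · intro j hj
      rw [wd_const_mul j _ (((hv.wd i hU).mul hu).diffAt hU hy)]
      have := wd_mul j ((hv.wd i hU).diffAt hU hy) (hu.diffAt hU hy)
      rw [show (fun z => wd i v z * u z) = wd i v * u from rfl, this, huy,
        hL' j (by simp [hj])]
      simp

end wd

/-! ### Multi-index derivatives and the monomials of a symbol -/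

section pderiv

variable {n : ℕ} {U : Set (Cn n)}

/-- The list of derivations that make up the derivative with a given multi-index. -/
def idxList (γ : MultiIdx n) : List (Fin n ⊕ Fin n) :=
  (List.finRange n).flatMap fun k =>
    List.replicate (γ (Sum.inl k)) (Sum.inl k) ++ List.replicate (γ (Sum.inr k)) (Sum.inr k)

lemma foldr_replicate_wd (i : Fin n ⊕ Fin n) (m : ℕ) (F : Cn n → ℂ) :
    (List.replicate m i).foldr wd F = (wd i)^[m] F := by
  induction m with
  | zero => rfl
  | succ m ih => rw [List.replicate_succ, List.foldr_cons, ih, Function.iterate_succ_apply']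

/-- Lists permit induction on the innermost derivation, which is how products with powers are
differentiated. -/
lemma pderiv_eq_wds (γ : MultiIdx n) (F : Cn n → ℂ) : pderiv γ F = wds (idxList γ) F := by
  unfold pderiv wds idxList
  induction List.finRange n with
  | nil => rfl
  | cons k l ih =>
    rw [List.foldr_cons, ih, List.flatMap_cons, List.foldr_append, List.foldr_append,
      foldr_replicate_wd, foldr_replicate_wd]
    rfl

/-- The target is an arbitrary commutative monoid because two cases are needed: complex values give
the monomial of the symbol, and a constant in `Multiplicative ℕ` gives the length of the list. -/
lemma prod_map_idxList {R : Type*} [CommMonoid R] (γ : MultiIdx n) (t : Fin n ⊕ Fin n → R) :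
    ((idxList γ).map t).prod = ∏ i, t i ^ γ i := by
  rw [Fintype.prod_sum_type, ← Finset.prod_mul_distrib, ← Fin.prod_ofFn, List.ofFn_eq_map]
  unfold idxList
  induction List.finRange n with
  | nil => simp
  | cons k l ih =>
    rw [List.flatMap_cons, List.map_append, List.prod_append, ih]
    simp

lemma length_idxList (γ : MultiIdx n) : (idxList γ).length = ∑ i, γ i := by
  have h := prod_map_idxList γ fun _ => Multiplicative.ofAdd 1
  rw [List.map_const', List.prod_replicate] at h
  simpa [← ofAdd_nsmul, ← ofAdd_sum, ← ofAdd_add] using congrArg Multiplicative.toAdd h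

lemma mem_idxList {γ : MultiIdx n} {i : Fin n ⊕ Fin n} (h : i ∈ idxList γ) : γ i ≠ 0 := by
  simp only [idxList, List.mem_flatMap, List.mem_append, List.mem_replicate] at h
  obtain ⟨k, -, ⟨h, rfl⟩ | ⟨h, rfl⟩⟩ := h <;> exact h

/-- The monomial of multi-degree `γ`. -/
def mon (γ : MultiIdx n) (t : Fin n ⊕ Fin n → ℂ) : ℂ := ∏ i, t i ^ γ i

lemma fibMon_eq_mon (γ : MultiIdx n) (ζ : Cn n) :
    fibMon γ ζ = mon γ (Sum.elim ζ fun k => (starRingEnd ℂ) (ζ k)) := by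
  rw [fibMon, mon, Fintype.prod_sum_type, ← Finset.prod_mul_distrib]
  rfl

lemma mem_idxEq {r : ℕ} {γ : MultiIdx n} : γ ∈ idxEq n r ↔ ∑ i, γ i = r := by
  simp [idxEq]

lemma mem_idxLE {r : ℕ} {γ : MultiIdx n} : γ ∈ idxLE n r ↔ ∑ i, γ i ≤ r := by
  simp [idxLE, mem_idxEq]

lemma pderiv_congr_of_eqOn (γ : MultiIdx n) {F G : Cn n → ℂ} (hU : IsOpen U)
    (h : Set.EqOn F G U) : Set.EqOn (pderiv γ F) (pderiv γ G) U := by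
  rw [pderiv_eq_wds, pderiv_eq_wds]
  exact wds_congr_of_eqOn _ hU h

lemma ContDiffOn.pderiv (γ : MultiIdx n) {F : Cn n → ℂ} (hF : ContDiffOn ℝ ∞ F U)
    (hU : IsOpen U) : ContDiffOn ℝ ∞ (pderiv γ F) U := by
  rw [pderiv_eq_wds]
  exact hF.wds _ hU

lemma wd_pderiv (i : Fin n ⊕ Fin n) (γ : MultiIdx n) {F : Cn n → ℂ} (hF : ContDiffOn ℝ ∞ F U)
    (hU : IsOpen U) : Set.EqOn (wd i (_root_.pderiv γ F)) (_root_.pderiv γ (wd i F)) U := by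
  rw [pderiv_eq_wds, pderiv_eq_wds]
  exact wd_wds i _ hF hU

lemma pderiv_pow_mul (γ : MultiIdx n) {v u : Cn n → ℂ} (hv : ContDiffOn ℝ ∞ v U)
    (hu : ContDiffOn ℝ ∞ u U) (hU : IsOpen U) {y : Cn n} (hy : y ∈ U) (hvy : v y = 0) {m : ℕ}
    (hγ : ∑ i, γ i ≤ m) :
    pderiv γ (v ^ m * u) y =
      if ∑ i, γ i = m then m.factorial * mon γ (fun i => wd i v y) * u y else 0 := by
  rw [pderiv_eq_wds, wds_pow_mul _ hv hU hy hvy m (by rwa [length_idxList]) hu, length_idxList,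
    prod_map_idxList, mon]

lemma pderiv_pow_mul_eq_zero (γ : MultiIdx n) {v u : Cn n → ℂ} (hv : ContDiffOn ℝ ∞ v U)
    (hu : ContDiffOn ℝ ∞ u U) (hU : IsOpen U) {y : Cn n} (hy : y ∈ U) (hvy : v y = 0) {m : ℕ}
    (hγ : ∑ i, γ i ≤ m + 1) (huy : u y = 0) (hu' : ∀ i, γ i ≠ 0 → wd i u y = 0) :
    pderiv γ (v ^ m * u) y = 0 := by
  rw [pderiv_eq_wds]
  exact wds_pow_mul_eq_zero _ hv hU hy hvy m (by rwa [length_idxList]) hu huy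
    fun i hi => hu' i (mem_idxList hi)

lemma pderiv_mul_of_wd_eq_zero (γ : MultiIdx n) {q F : Cn n → ℂ} (hq : ContDiffOn ℝ ∞ q U)
    (hF : ContDiffOn ℝ ∞ F U) (hU : IsOpen U) (h : ∀ i, γ i ≠ 0 → ∀ y ∈ U, wd i q y = 0) :
    Set.EqOn (pderiv γ (q * F)) (q * pderiv γ F) U := by
  rw [pderiv_eq_wds, pderiv_eq_wds]
  exact wds_mul_of_wd_eq_zero _ hq hF hU fun i hi => h i (mem_idxList hi)

/-- A polynomial function on `ℂ²ⁿ` determines its coefficients. -/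
lemma coeff_eq_zero_of_sum_mon {s : Finset (MultiIdx n)} {a : MultiIdx n → ℂ}
    (h : ∀ t, ∑ γ ∈ s, a γ * mon γ t = 0) {γ : MultiIdx n} (hγ : γ ∈ s) : a γ = 0 := by
  classical
  set p : MvPolynomial (Fin n ⊕ Fin n) ℂ :=
    ∑ γ ∈ s, MvPolynomial.monomial (Finsupp.equivFunOnFinite.symm γ) (a γ) with hp
  have h0 : p = 0 := by
    refine MvPolynomial.funext fun t => ?_
    rw [hp, map_sum, map_zero, ← h t]
    refine Finset.sum_congr rfl fun γ _ => ?_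
    rw [MvPolynomial.eval_monomial, mon, Finsupp.prod_fintype _ _ (by simp)]
    simp
  have h1 := congrArg (MvPolynomial.coeff (Finsupp.equivFunOnFinite.symm γ)) h0
  rw [hp, MvPolynomial.coeff_sum, MvPolynomial.coeff_zero] at h1
  simpa [MvPolynomial.coeff_monomial, hγ] using h1

end pderiv

/-! ### The underlying real manifold -/

lemma mem_contDiffGroupoid_real {n : ℕ} {e : OpenPartialHomeomorph (Cn n) (Cn n)}
    (h : e ∈ contDiffGroupoid ω 𝓘(ℂ, Cn n)) : e ∈ contDiffGroupoid ∞ 𝓘(ℝ, Cn n) := by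
  rw [contDiffGroupoid, mem_groupoid_of_pregroupoid] at h ⊢
  exact ⟨(h.1.restrict_scalars ℝ).of_le le_top, (h.2.restrict_scalars ℝ).of_le le_top⟩

section manifold

variable {n : ℕ} {M : Type*} [TopologicalSpace M] [ChartedSpace (Cn n) M]

variable (n M) in
lemma isManifold_real [IsManifold 𝓘(ℂ, Cn n) ω M] : IsManifold 𝓘(ℝ, Cn n) ∞ M :=
  haveI : HasGroupoid M (contDiffGroupoid ∞ 𝓘(ℝ, Cn n)) :=
    ⟨fun he he' => mem_contDiffGroupoid_real
      (HasGroupoid.compatible (G := contDiffGroupoid ω 𝓘(ℂ, Cn n)) he he')⟩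
  IsManifold.mk' _ _ _

lemma IsHolChart.real {φ : OpenPartialHomeomorph M (Cn n)} (hφ : IsHolChart φ) :
    φ ∈ IsManifold.maximalAtlas 𝓘(ℝ, Cn n) ∞ M := by
  rw [IsHolChart, IsManifold.mem_maximalAtlas_iff, mem_maximalAtlas_iff] at hφ
  rw [IsManifold.mem_maximalAtlas_iff, mem_maximalAtlas_iff]
  exact fun e he => ⟨mem_contDiffGroupoid_real (hφ e he).1, mem_contDiffGroupoid_real (hφ e he).2⟩

lemma isHolChart_chartAt [IsManifold 𝓘(ℂ, Cn n) ω M] (x : M) :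
    IsHolChart (chartAt (Cn n) x) := IsManifold.chart_mem_maximalAtlas x

/-! ### Local functions and covectors in holomorphic charts -/

section charts

variable {φ : OpenPartialHomeomorph M (Cn n)}

lemma contDiffOn_loc (hφ : IsHolChart φ) (f : Sm n M) :
    ContDiffOn ℝ ∞ (loc φ f) φ.target := by
  rw [← contMDiffOn_iff_contDiffOn]
  exact (ContMDiff.contMDiffOn (s := Set.univ) f.2).comp
    (contMDiffOn_symm_of_mem_maximalAtlas hφ.real) fun _ _ => Set.mem_univ _

/-- Local smooth functions extend to global ones after shrinking their domain. -/
lemma exists_loc_eqOn [T2Space M] [IsManifold 𝓘(ℂ, Cn n) ω M] (hφ : IsHolChart φ)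
    {V : Set (Cn n)} (hV : IsOpen V)
    (hVt : V ⊆ φ.target) {y : Cn n} (hy : y ∈ V) :
    ∃ V' : Set (Cn n), IsOpen V' ∧ y ∈ V' ∧ V' ⊆ V ∧
      ∀ F : Cn n → ℂ, ContDiffOn ℝ ∞ F V → ∃ u : Sm n M, Set.EqOn (loc φ u) F V' := by
  have := isManifold_real n M
  set x := φ.symm y with hx
  have hxs : x ∈ φ.source := φ.map_target (hVt hy)
  have hO : IsOpen (φ.source ∩ φ ⁻¹' V) := φ.isOpen_inter_preimage hV
  have hxO : x ∈ φ.source ∩ φ ⁻¹' V := ⟨hxs, by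
    rw [Set.mem_preimage, hx, φ.right_inv (hVt hy)]
    exact hy⟩
  obtain ⟨χ, -, hχ⟩ := (SmoothBumpFunction.nhds_basis_tsupport (I := 𝓘(ℝ, Cn n)) x).mem_iff.1
    (hO.mem_nhds hxO)
  obtain ⟨O, hO1, hOo, hxO'⟩ := mem_nhds_iff.1 χ.eventuallyEq_one
  -- The smaller neighbourhood is where the cutoff equals one. It is chosen before `F`, so all the
  -- infinitely many coefficients of a formal potential extend from the same set.
  refine ⟨V ∩ (φ.target ∩ φ.symm ⁻¹' O), hV.inter (φ.symm.isOpen_inter_preimage hOo),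
    ⟨hy, hVt hy, hxO'⟩, Set.inter_subset_left, fun F hF => ?_⟩
  refine ⟨⟨fun p => (χ p : ℂ) * F (φ p), ?_⟩, fun z hz => ?_⟩
  · refine contMDiff_of_tsupport fun p hp => ?_
    have hp' : p ∈ φ.source ∩ φ ⁻¹' V := by
      refine hχ (closure_mono ?_ hp)
      intro q hq hq0
      exact hq (by simp [hq0])
    have h1 : ContMDiffAt 𝓘(ℝ, Cn n) 𝓘(ℝ, ℂ) ∞ (fun p => (χ p : ℂ)) p :=
      (Complex.ofRealCLM.contDiff (n := ∞)).contMDiff.contMDiffAt.comp p χ.contMDiff.contMDiffAt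
    have h2 : ContMDiffAt 𝓘(ℝ, Cn n) 𝓘(ℝ, ℂ) ∞ (fun p => F (φ p)) p :=
      ContMDiffAt.comp p ((hF.contDiffAt (hV.mem_nhds hp'.2)).contMDiffAt)
        ((contMDiffOn_of_mem_maximalAtlas hφ.real).contMDiffAt
          (φ.open_source.mem_nhds hp'.1))
    exact ContDiff.comp_contMDiffAt (g := fun p : ℂ × ℂ => p.1 * p.2) contDiff_mul
      (h1.prodMk_space h2)
  · have h1 : χ (φ.symm z) = 1 := hO1 hz.2.2
    change (χ (φ.symm z) : ℂ) * F (φ (φ.symm z)) = F z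
    rw [h1, φ.right_inv hz.2.1]
    simp

/-! ### Covectors -/

/-- The linear functional `2 Re ∑ ζ_k h_k` on `ℂⁿ`. -/
def reForm (ζ : Cn n) : Cn n →L[ℝ] ℝ :=
  (2 : ℝ) • ∑ k, Complex.reCLM.comp
    (((ContinuousLinearMap.mul ℝ ℂ) (ζ k)).comp (ContinuousLinearMap.proj k))

lemma reForm_apply (ζ h : Cn n) : reForm ζ h = 2 * (∑ k, ζ k * h k).re := by
  simp [reForm]

lemma exists_eq_reForm (η : Cn n →L[ℝ] ℝ) : ∃ ζ, η = reForm ζ := by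
  -- Forced by `η = 2 Re ∑ ζ_k h_k`: the values on `e_k` and `i e_k` are `2 Re ζ_k` and `-2 Im ζ_k`.
  refine ⟨fun k => (η (Pi.single k 1) - Complex.I * η (Pi.single k Complex.I)) / 2, ?_⟩
  ext h
  rw [reForm_apply]
  have e : h = ∑ k, ((h k).re • (Pi.single k 1 : Cn n) +
      (h k).im • (Pi.single k Complex.I : Cn n)) := by
    funext j
    simp only [Finset.sum_apply, Pi.add_apply, Pi.smul_apply, Pi.single_apply, smul_ite, smul_zero,
      Finset.sum_add_distrib, Finset.sum_ite_eq, Finset.mem_univ, if_true]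
    simp [Complex.re_add_im]
  conv_lhs => rw [e]
  simp only [map_sum, map_add, map_smul, smul_eq_mul, Complex.re_sum, Finset.mul_sum]
  refine Finset.sum_congr rfl fun k _ => ?_
  simp
  ring

lemma mdifferentiableAt_chart (hφ : IsHolChart φ) {x : M} (hx : x ∈ φ.source) :
    MDifferentiableAt 𝓘(ℝ, Cn n) 𝓘(ℝ, Cn n) φ x := by
  exact ((contMDiffOn_of_mem_maximalAtlas hφ.real).contMDiffAt
    (φ.open_source.mem_nhds hx)).mdifferentiableAt (by simp)

lemma mdifferentiableAt_symm (hφ : IsHolChart φ) {y : Cn n} (hy : y ∈ φ.target) :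
    MDifferentiableAt 𝓘(ℝ, Cn n) 𝓘(ℝ, Cn n) φ.symm y := by
  exact ((contMDiffOn_symm_of_mem_maximalAtlas hφ.real).contMDiffAt
    (φ.open_target.mem_nhds hy)).mdifferentiableAt (by simp)

lemma covec_eq (hφ : IsHolChart φ) {x : M} (hx : x ∈ φ.source) (ζ : Cn n) :
    covec φ x ζ = (reForm ζ).comp (mfderiv 𝓘(ℝ, Cn n) 𝓘(ℝ, Cn n) φ x) := by
  have h : (fun p : M => 2 * (∑ k, ζ k * φ p k).re) = reForm ζ ∘ φ := by
    funext p
    rw [Function.comp_apply, reForm_apply]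
  rw [covec, h, mfderiv_comp x (reForm ζ).mdifferentiableAt (mdifferentiableAt_chart hφ hx)]
  rw [ContinuousLinearMap.mfderiv_eq]
  rfl

lemma mfderiv_symm_comp_chart (hφ : IsHolChart φ) {x : M} (hx : x ∈ φ.source) :
    (mfderiv 𝓘(ℝ, Cn n) 𝓘(ℝ, Cn n) φ.symm (φ x)).comp (mfderiv 𝓘(ℝ, Cn n) 𝓘(ℝ, Cn n) φ x) =
      ContinuousLinearMap.id ℝ (TangentSpace 𝓘(ℝ, Cn n) x) := by
  rw [← mfderiv_comp x (mdifferentiableAt_symm hφ (φ.map_source hx))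
    (mdifferentiableAt_chart hφ hx), ← mfderiv_id]
  refine Filter.EventuallyEq.mfderiv_eq ?_
  filter_upwards [φ.open_source.mem_nhds hx] with p hp
  simp [φ.left_inv hp]

lemma mfderiv_chart_comp_symm (hφ : IsHolChart φ) {y : Cn n} (hy : y ∈ φ.target) :
    (mfderiv 𝓘(ℝ, Cn n) 𝓘(ℝ, Cn n) φ (φ.symm y)).comp
      (mfderiv 𝓘(ℝ, Cn n) 𝓘(ℝ, Cn n) φ.symm y) =
      ContinuousLinearMap.id ℝ (TangentSpace 𝓘(ℝ, Cn n) y) := by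
  rw [← mfderiv_comp y (mdifferentiableAt_chart hφ (φ.map_target hy))
    (mdifferentiableAt_symm hφ hy), ← mfderiv_id]
  refine Filter.EventuallyEq.mfderiv_eq ?_
  filter_upwards [φ.open_target.mem_nhds hy] with p hp
  simp [φ.right_inv hp]

/-- Every real covector has coordinates. -/
lemma exists_eq_covec (hφ : IsHolChart φ) {x : M} (hx : x ∈ φ.source)
    (ξ : TangentSpace 𝓘(ℝ, Cn n) x →L[ℝ] ℝ) : ∃ ζ, ξ = covec φ x ζ := by
  obtain ⟨ζ, hζ⟩ := exists_eq_reForm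
    ((show Cn n →L[ℝ] ℝ from ξ).comp (mfderiv 𝓘(ℝ, Cn n) 𝓘(ℝ, Cn n) φ.symm (φ x)))
  refine ⟨ζ, ?_⟩
  rw [covec_eq hφ hx, ← hζ]
  change ξ = ContinuousLinearMap.comp (show TangentSpace 𝓘(ℝ, Cn n) x →L[ℝ] ℝ from ξ)
    ((mfderiv 𝓘(ℝ, Cn n) 𝓘(ℝ, Cn n) φ.symm (φ x)).comp (mfderiv 𝓘(ℝ, Cn n) 𝓘(ℝ, Cn n) φ x))
  rw [mfderiv_symm_comp_chart hφ hx]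
  rfl

/-- The same `ζ` serves all `P`, so identities between functions on the cotangent bundle may be
checked in the coordinates of a single chart at each point. -/
lemma exists_cotLoc (hφ : IsHolChart φ) {x : M} (hx : x ∈ φ.source)
    (ξ : TangentSpace 𝓘(ℝ, Cn n) x →L[ℝ] ℝ) :
    ∃ ζ, ∀ P : CotFn n M, P x ξ = cotLoc φ P (φ x) ζ := by
  obtain ⟨ζ, rfl⟩ := exists_eq_covec hφ hx ξ
  refine ⟨ζ, fun P => ?_⟩
  rw [cotLoc, φ.left_inv hx]

/-- The function `v` vanishes at `x` and has the real differential `ξ` there. -/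
def Represents (x : M) (ξ : TangentSpace 𝓘(ℝ, Cn n) x →L[ℝ] ℝ) (v : Sm n M) : Prop :=
  (v : M → ℂ) x = 0 ∧ mfderiv 𝓘(ℝ, Cn n) 𝓘(ℝ, ℂ) (v : M → ℂ) x = Complex.ofRealCLM.comp ξ

lemma fderiv_loc_of_represents (hφ : IsHolChart φ) {y ζ : Cn n} (hy : y ∈ φ.target) {v : Sm n M}
    (hv : Represents (φ.symm y) (covec φ (φ.symm y) ζ) v) (h : Cn n) :
    fderiv ℝ (loc φ v) y h = ((reForm ζ h : ℝ) : ℂ) := by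
  have hd : MDifferentiableAt 𝓘(ℝ, Cn n) 𝓘(ℝ, ℂ) (v : M → ℂ) (φ.symm y) :=
    (ContMDiff.contMDiffAt v.2).mdifferentiableAt (by simp)
  have e : loc φ v = (v : M → ℂ) ∘ φ.symm := rfl
  rw [← mfderiv_eq_fderiv, e, mfderiv_comp y hd (mdifferentiableAt_symm hφ hy), hv.2,
    covec_eq hφ (φ.map_target hy)]
  have := congrArg (fun L => L h) (mfderiv_chart_comp_symm hφ hy)
  exact congrArg (fun w => ((reForm ζ w : ℝ) : ℂ)) this

/-- The coordinates of the covector `(ζ, ζ̄)`. -/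
def fibCoord (ζ : Cn n) : Fin n ⊕ Fin n → ℂ := Sum.elim ζ fun k => (starRingEnd ℂ) (ζ k)

/-- The differential of such a `v` is the real covector `ζ dz + ζ̄ dz̄`, so monomials in the
derivatives of `v` are precisely the fibre monomials at that covector. -/
lemma wd_loc_of_represents (hφ : IsHolChart φ) {y ζ : Cn n} (hy : y ∈ φ.target) {v : Sm n M}
    (hv : Represents (φ.symm y) (covec φ (φ.symm y) ζ) v) (i : Fin n ⊕ Fin n) :
    wd i (loc φ v) y = fibCoord ζ i := by
  have h1 : ∀ (k : Fin n) (c : ℂ), ∑ j, ζ j * (Pi.single k c : Cn n) j = ζ k * c := by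
    intro k c
    rw [Finset.sum_eq_single k]
    · simp
    · intro j _ hj
      simp [hj]
    · simp
  cases i with
  | inl k =>
    change dz k (loc φ v) y = ζ k
    rw [dz, fderiv_loc_of_represents hφ hy hv, fderiv_loc_of_represents hφ hy hv, reForm_apply,
      reForm_apply, h1, h1]
    apply Complex.ext <;> simp
  | inr k =>
    change dzb k (loc φ v) y = (starRingEnd ℂ) (ζ k)
    rw [dzb, fderiv_loc_of_represents hφ hy hv, fderiv_loc_of_represents hφ hy hv, reForm_apply,
      reForm_apply, h1, h1]
    apply Complex.ext <;> simp [neg_div]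

lemma exists_represents [T2Space M] [IsManifold 𝓘(ℂ, Cn n) ω M] (x : M)
    (ξ : TangentSpace 𝓘(ℝ, Cn n) x →L[ℝ] ℝ) :
    ∃ v : Sm n M, Represents x ξ v := by
  set φ := chartAt (Cn n) x
  have hφ : IsHolChart φ := isHolChart_chartAt x
  have hx : x ∈ φ.source := mem_chart_source _ x
  have hy : φ x ∈ φ.target := φ.map_source hx
  obtain ⟨ζ, hζ⟩ := exists_eq_covec hφ hx ξ
  obtain ⟨V', hV', hyV', hV't, h⟩ := exists_loc_eqOn hφ φ.open_target subset_rfl hy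
  set L : Cn n →L[ℝ] ℂ := Complex.ofRealCLM.comp (reForm ζ)
  obtain ⟨v, hv⟩ := h (fun z => L (z - φ x)) (by fun_prop)
  have hev : (v : M → ℂ) =ᶠ[𝓝 x] (fun z => L (z - φ x)) ∘ φ := by
    filter_upwards [(φ.isOpen_inter_preimage hV').mem_nhds ⟨hx, hyV'⟩] with p hp
    have := hv hp.2
    rwa [loc, φ.left_inv hp.1] at this
  refine ⟨v, ?_, ?_⟩
  · rw [hev.eq_of_nhds]
    simp
  · have hd : HasFDerivAt (fun z => L (z - φ x)) L (φ x) := by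
      have := L.hasFDerivAt.comp (φ x) ((hasFDerivAt_id (φ x)).sub_const (φ x))
      rwa [ContinuousLinearMap.comp_id] at this
    rw [hev.mfderiv_eq, mfderiv_comp x hd.differentiableAt.mdifferentiableAt
      (mdifferentiableAt_chart hφ hx), hζ, covec_eq hφ hx, mfderiv_eq_fderiv, hd.fderiv]
    rfl

end charts

end manifold

section operators

variable {n : ℕ} {M : Type*} [TopologicalSpace M] [ChartedSpace (Cn n) M]

/-! ### Local expressions of differential operators -/

lemma loc_mul (φ : OpenPartialHomeomorph M (Cn n)) (f g : Sm n M) :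
    loc φ ((f * g : Sm n M) : M → ℂ) = loc φ f * loc φ g := rfl

lemma loc_add (φ : OpenPartialHomeomorph M (Cn n)) (f g : Sm n M) :
    loc φ ((f + g : Sm n M) : M → ℂ) = loc φ f + loc φ g := rfl

lemma loc_sub (φ : OpenPartialHomeomorph M (Cn n)) (f g : Sm n M) :
    loc φ ((f - g : Sm n M) : M → ℂ) = loc φ f - loc φ g := rfl

lemma loc_pow (φ : OpenPartialHomeomorph M (Cn n)) (f : Sm n M) (m : ℕ) :
    loc φ ((f ^ m : Sm n M) : M → ℂ) = loc φ f ^ m := rfl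

lemma loc_smul (φ : OpenPartialHomeomorph M (Cn n)) (c : ℂ) (f : Sm n M) :
    loc φ ((c • f : Sm n M) : M → ℂ) = fun y => c * loc φ f y := rfl

/-- The value at a point of a chart, as a linear functional. -/
def evalLoc (φ : OpenPartialHomeomorph M (Cn n)) (y : Cn n) : Sm n M →ₗ[ℂ] ℂ where
  toFun f := loc φ f y
  map_add' _ _ := rfl
  map_smul' _ _ := rfl

lemma loc_sum (φ : OpenPartialHomeomorph M (Cn n)) {ι : Type*} (s : Finset ι) (f : ι → Sm n M)
    (y : Cn n) : loc φ ((∑ i ∈ s, f i : Sm n M) : M → ℂ) y = ∑ i ∈ s, loc φ (f i) y :=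
  map_sum (evalLoc φ y) f s

/-- The function `f - f(y)`. -/
def centered (φ : OpenPartialHomeomorph M (Cn n)) (y : Cn n) (f : Sm n M) : Sm n M :=
  f - algebraMap ℂ (Sm n M) (loc φ f y)

lemma loc_centered (φ : OpenPartialHomeomorph M (Cn n)) (y : Cn n) (f : Sm n M) (z : Cn n) :
    loc φ (centered φ y f) z = loc φ f z - loc φ f y := rfl

/-- Applying an operator `A` and evaluating at `y` gives the commutator `[A, f] v` at `y`. All
commutators below are written in this form. -/
lemma centered_mul (φ : OpenPartialHomeomorph M (Cn n)) (y : Cn n) (f v : Sm n M) :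
    centered φ y f * v = f * v - loc φ f y • v := by
  rw [centered, sub_mul, Algebra.smul_def]

lemma wd_loc_centered {φ : OpenPartialHomeomorph M (Cn n)} (hφ : IsHolChart φ) (y : Cn n)
    (f : Sm n M) (i : Fin n ⊕ Fin n) {z : Cn n} (hz : z ∈ φ.target) :
    wd i (loc φ (centered φ y f)) z = wd i (loc φ f) z := by
  have h := wd_sub i ((contDiffOn_loc hφ f).diffAt φ.open_target hz)
    (differentiableAt_const (loc φ f y))
  rwa [wd_const, sub_zero] at h

/-- The operator `A` is given on `V` by the coefficients `a` of order at most `N`. -/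
structure IsRep (φ : OpenPartialHomeomorph M (Cn n)) (V : Set (Cn n)) (A : Sm n M →ₗ[ℂ] Sm n M)
    (N : ℕ) (a : MultiIdx n → Cn n → ℂ) : Prop where
  smooth : ∀ γ, ContDiffOn ℝ ∞ (a γ) V
  order : ∀ γ, N < ∑ i, γ i → ∀ y ∈ V, a γ y = 0
  eq : ∀ f : Sm n M, ∀ y ∈ V, loc φ (A f) y = ∑ γ ∈ idxLE n N, a γ y * pderiv γ (loc φ f) y

/-- The multi-index `γ` does not involve the directions in the range of `τ`. -/
def OffSide (τ : Fin n → Fin n ⊕ Fin n) (γ : MultiIdx n) : Prop := ∀ k, γ (τ k) = 0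

/-- The coefficients `a` of derivatives in the directions `τ` vanish on `V`. -/
def IsSided (τ : Fin n → Fin n ⊕ Fin n) (V : Set (Cn n)) (a : MultiIdx n → Cn n → ℂ) : Prop :=
  ∀ γ, ¬ OffSide τ γ → ∀ y ∈ V, a γ y = 0

lemma mon_congr {σ τ : Fin n → Fin n ⊕ Fin n} (hστ : ∀ i, (∃ k, i = σ k) ∨ ∃ k, i = τ k)
    {γ : MultiIdx n} (hγ : OffSide τ γ) {t t' : Fin n ⊕ Fin n → ℂ}
    (h : ∀ k, t (σ k) = t' (σ k)) : mon γ t = mon γ t' := by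
  refine Finset.prod_congr rfl fun i _ => ?_
  rcases hστ i with ⟨k, rfl⟩ | ⟨k, rfl⟩
  · rw [h]
  · rw [hγ k, pow_zero, pow_zero]

/-- The symbol of an operator in the directions `σ` sees only the `σ` components of a covector. Test
functions therefore need prescribed derivatives only in these directions. -/
lemma sum_mon_congr {σ τ : Fin n → Fin n ⊕ Fin n} (hστ : ∀ i, (∃ k, i = σ k) ∨ ∃ k, i = τ k)
    {s : Finset (MultiIdx n)} {c : MultiIdx n → ℂ} (hc : ∀ γ, ¬ OffSide τ γ → c γ = 0)
    {t t' : Fin n ⊕ Fin n → ℂ} (h : ∀ k, t (σ k) = t' (σ k)) :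
    ∑ γ ∈ s, c γ * mon γ t = ∑ γ ∈ s, c γ * mon γ t' := by
  refine Finset.sum_congr rfl fun γ _ => ?_
  by_cases hγ : OffSide τ γ
  · rw [mon_congr hστ hγ h]
  · rw [hc γ hγ, zero_mul, zero_mul]

/-- Derivatives of order below `m` kill `v ^ m * u` at a zero of `v`, those of order `m` give `m!`
times a monomial, and higher ones have zero coefficient. The bound `N` used in the sum and the
effective order `m` at the point are unrelated, since both `m < N` and `m > N` occur. -/
lemma jet_pow_mul {c : MultiIdx n → ℂ} {N m : ℕ} (hN : ∀ γ, N < ∑ i, γ i → c γ = 0)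
    (hm : ∀ γ, m < ∑ i, γ i → c γ = 0) {U : Set (Cn n)} (hU : IsOpen U) {v u : Cn n → ℂ}
    (hv : ContDiffOn ℝ ∞ v U) (hu : ContDiffOn ℝ ∞ u U) {y : Cn n} (hy : y ∈ U) (hvy : v y = 0) :
    ∑ γ ∈ idxLE n N, c γ * pderiv γ (v ^ m * u) y =
      m.factorial * (∑ γ ∈ idxEq n m, c γ * mon γ fun i => wd i v y) * u y := by
  have h1 : ∀ γ : MultiIdx n, c γ * pderiv γ (v ^ m * u) y =
      if ∑ i, γ i = m then m.factorial * (c γ * mon γ fun i => wd i v y) * u y else 0 := by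
    intro γ
    by_cases hγ : ∑ i, γ i ≤ m
    · rw [pderiv_pow_mul γ hv hu hU hy hvy hγ]
      split_ifs
      · ring
      · rw [mul_zero]
    · rw [hm γ (not_le.1 hγ), if_neg (by omega), zero_mul]
  simp only [h1]
  rw [← Finset.sum_filter, Finset.mul_sum, Finset.sum_mul]
  refine Finset.sum_subset_zero_on_sdiff (fun γ hγ => ?_) (fun γ hγ => ?_) fun _ _ => rfl
  · rw [Finset.mem_filter] at hγ
    exact mem_idxEq.2 hγ.2
  · rw [Finset.mem_sdiff, Finset.mem_filter, mem_idxLE, mem_idxEq] at hγ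
    rw [hN γ (by omega)]
    ring

lemma jet_pow {c : MultiIdx n → ℂ} {N m : ℕ} (hN : ∀ γ, N < ∑ i, γ i → c γ = 0)
    (hm : ∀ γ, m < ∑ i, γ i → c γ = 0) {U : Set (Cn n)} (hU : IsOpen U) {v : Cn n → ℂ}
    (hv : ContDiffOn ℝ ∞ v U) {y : Cn n} (hy : y ∈ U) (hvy : v y = 0) :
    ∑ γ ∈ idxLE n N, c γ * pderiv γ (v ^ m) y =
      m.factorial * ∑ γ ∈ idxEq n m, c γ * mon γ fun i => wd i v y := by
  have h := jet_pow_mul hN hm hU hv (contDiffOn_const (c := (1 : ℂ))) hy hvy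
  rw [mul_one] at h
  rw [← h]
  congr! 3
  exact (mul_one (v ^ m)).symm

namespace IsRep

variable {φ : OpenPartialHomeomorph M (Cn n)} {V : Set (Cn n)} {A B : Sm n M →ₗ[ℂ] Sm n M}
  {N N' : ℕ} {a b : MultiIdx n → Cn n → ℂ}

lemma mono (h : IsRep φ V A N a) {V' : Set (Cn n)} (hV : V' ⊆ V) : IsRep φ V' A N a :=
  ⟨fun γ => (h.smooth γ).mono hV, fun γ hγ y hy => h.order γ hγ y (hV hy),
    fun f y hy => h.eq f y (hV hy)⟩

lemma eq_of_le (h : IsRep φ V A N a) (hN : N ≤ N') (f : Sm n M) {y : Cn n} (hy : y ∈ V) :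
    loc φ (A f) y = ∑ γ ∈ idxLE n N', a γ y * pderiv γ (loc φ f) y := by
  rw [h.eq f y hy]
  refine Finset.sum_subset (fun γ hγ => ?_) fun γ _ hγ => ?_
  · rw [mem_idxLE] at hγ ⊢
    omega
  · rw [mem_idxLE, not_le] at hγ
    rw [h.order γ hγ y hy, zero_mul]

lemma raise (h : IsRep φ V A N a) (hN : N ≤ N') : IsRep φ V A N' a :=
  ⟨h.smooth, fun γ hγ => h.order γ (by omega), fun f _ hy => h.eq_of_le hN f hy⟩

lemma lower (h : IsRep φ V A N' a) (h' : ∀ γ, N < ∑ i, γ i → ∀ y ∈ V, a γ y = 0) (hN : N ≤ N') :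
    IsRep φ V A N a := by
  refine ⟨h.smooth, h', fun f y hy => ?_⟩
  rw [h.eq f y hy]
  refine (Finset.sum_subset (fun γ hγ => ?_) fun γ _ hγ => ?_).symm
  · rw [mem_idxLE] at hγ ⊢
    omega
  · rw [mem_idxLE, not_le] at hγ
    rw [h' γ hγ y hy, zero_mul]

lemma sub (ha : IsRep φ V A N a) (hb : IsRep φ V B N b) :
    IsRep φ V (A - B) N (fun γ => a γ - b γ) := by
  refine ⟨fun γ => (ha.smooth γ).sub (hb.smooth γ), fun γ hγ y hy => ?_, fun f y hy => ?_⟩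
  · rw [Pi.sub_apply, ha.order γ hγ y hy, hb.order γ hγ y hy, sub_zero]
  · rw [LinearMap.sub_apply, loc_sub, Pi.sub_apply, ha.eq f y hy, hb.eq f y hy,
      ← Finset.sum_sub_distrib]
    exact Finset.sum_congr rfl fun γ _ => by rw [Pi.sub_apply, sub_mul]

lemma congr (h : IsRep φ V A N a) (hV : IsOpen V) {f g : Sm n M}
    (hfg : Set.EqOn (loc φ f) (loc φ g) V) {y : Cn n} (hy : y ∈ V) :
    loc φ (A f) y = loc φ (A g) y := by
  rw [h.eq f y hy, h.eq g y hy]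
  exact Finset.sum_congr rfl fun γ _ => by rw [pderiv_congr_of_eqOn γ hV hfg hy]

variable (hφ : IsHolChart φ) (hV : IsOpen V) (hVt : V ⊆ φ.target)
include hφ hV hVt

/-- The derivative of `A f` along a derivation that commutes with coordinate derivatives. -/
lemma wd_loc (h : IsRep φ V A N a) (f : Sm n M) (i : Fin n ⊕ Fin n) {y : Cn n} (hy : y ∈ V) :
    wd i (loc φ (A f)) y = ∑ γ ∈ idxLE n N, wd i (a γ) y * pderiv γ (loc φ f) y +
      ∑ γ ∈ idxLE n N, a γ y * pderiv γ (wd i (loc φ f)) y := by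
  have hf := (contDiffOn_loc hφ f).mono hVt
  rw [wd_congr_of_eqOn i hV (h.eq f) hy, wd_sum, ← Finset.sum_add_distrib]
  · refine Finset.sum_congr rfl fun γ _ => ?_
    have := wd_mul i ((h.smooth γ).diffAt hV hy) ((hf.pderiv γ hV).diffAt hV hy)
    rw [← wd_pderiv i γ hf hV hy]
    refine Eq.trans ?_ (this.trans ?_)
    · rfl
    · ring
  · exact fun γ _ => ((h.smooth γ).diffAt hV hy).mul ((hf.pderiv γ hV).diffAt hV hy)

lemma pow_mul (h : IsRep φ V A N a) {m : ℕ} {y : Cn n} (hy : y ∈ V)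
    (hm : ∀ γ, m < ∑ i, γ i → a γ y = 0) {v : Sm n M} (hv : loc φ v y = 0) (u : Sm n M) :
    loc φ (A (v ^ m * u)) y = m.factorial *
      (∑ γ ∈ idxEq n m, a γ y * mon γ fun i => wd i (loc φ v) y) * loc φ u y := by
  rw [h.eq _ y hy, loc_mul, loc_pow, jet_pow_mul (fun γ hγ => h.order γ hγ y hy) hm hV
    ((contDiffOn_loc hφ v).mono hVt) ((contDiffOn_loc hφ u).mono hVt) hy hv]

lemma pow_eq (h : IsRep φ V A N a) {m : ℕ} {y : Cn n} (hy : y ∈ V)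
    (hm : ∀ γ, m < ∑ i, γ i → a γ y = 0) {v : Sm n M} (hv : loc φ v y = 0) :
    loc φ (A (v ^ m)) y = m.factorial *
      ∑ γ ∈ idxEq n m, a γ y * mon γ fun i => wd i (loc φ v) y := by
  have := h.pow_mul hφ hV hVt hy hm hv 1
  rw [mul_one] at this
  rw [this]
  exact mul_one _

/-- The product vanishes at `y` to order `m + 1`, which exceeds the order of the operator.
Equivalently, a commutator with a function has order below `m`, so it kills the `m`-th power. -/
lemma pow_mul_eq_zero (h : IsRep φ V A N a) {m : ℕ} (hm : N ≤ m) {y : Cn n} (hy : y ∈ V)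
    {v u : Sm n M} (hv : loc φ v y = 0) (hu : loc φ u y = 0) :
    loc φ (A (u * v ^ m)) y = 0 := by
  rw [mul_comm, h.pow_mul hφ hV hVt hy (fun γ hγ => h.order γ (by omega) y hy) hv, hu, mul_zero]

/-- If `u` vanishes at `y` to first order in the directions `σ`, then `A (u v ^ m)` vanishes there
for every operator `A` of order at most `m + 1` in these directions. -/
lemma pow_mul_eq_zero_of_flat {σ τ : Fin n → Fin n ⊕ Fin n}
    (hστ : ∀ i, (∃ k, i = σ k) ∨ ∃ k, i = τ k) (h : IsRep φ V A N a) (hs : IsSided τ V a)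
    {m : ℕ} (hm : N ≤ m + 1) {y : Cn n} (hy : y ∈ V) {v u : Sm n M} (hv : loc φ v y = 0)
    (hu : loc φ u y = 0) (hu' : ∀ k, wd (σ k) (loc φ u) y = 0) :
    loc φ (A (u * v ^ m)) y = 0 := by
  rw [mul_comm, h.eq _ y hy]
  refine Finset.sum_eq_zero fun γ hγ => ?_
  by_cases hγs : OffSide τ γ
  · rw [loc_mul, loc_pow, pderiv_pow_mul_eq_zero γ ((contDiffOn_loc hφ v).mono hVt)
      ((contDiffOn_loc hφ u).mono hVt) hV hy hv ((mem_idxLE.1 hγ).trans hm) hu, mul_zero]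
    intro i hi
    rcases hστ i with ⟨k, rfl⟩ | ⟨k, rfl⟩
    · exact hu' k
    · exact absurd (hγs k) hi
  · rw [hs γ hγs y hy, zero_mul]

/-- Operators in the directions `σ` commute with functions that are constant in these
directions. -/
lemma mul_of_wd_eq_zero {σ τ : Fin n → Fin n ⊕ Fin n}
    (hστ : ∀ i, (∃ k, i = σ k) ∨ ∃ k, i = τ k) (h : IsRep φ V A N a) (hs : IsSided τ V a)
    {q : Sm n M} (hq : ∀ k, ∀ y ∈ V, wd (σ k) (loc φ q) y = 0) (f : Sm n M) {y : Cn n}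
    (hy : y ∈ V) : loc φ (A (q * f)) y = loc φ q y * loc φ (A f) y := by
  rw [h.eq _ y hy, h.eq _ y hy, Finset.mul_sum]
  refine Finset.sum_congr rfl fun γ hγ => ?_
  by_cases hγs : OffSide τ γ
  · rw [loc_mul, pderiv_mul_of_wd_eq_zero γ ((contDiffOn_loc hφ q).mono hVt)
      ((contDiffOn_loc hφ f).mono hVt) hV ?_ hy, Pi.mul_apply]
    · ring
    intro i hi
    rcases hστ i with ⟨k, rfl⟩ | ⟨k, rfl⟩
    · exact hq k
    · exact absurd (hγs k) hi
  · rw [hs γ hγs y hy]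
    ring

end IsRep

lemma IsSided.mono {τ : Fin n → Fin n ⊕ Fin n} {V V' : Set (Cn n)} {a : MultiIdx n → Cn n → ℂ}
    (h : IsSided τ V a) (hV : V' ⊆ V) : IsSided τ V' a := fun γ hγ y hy => h γ hγ y (hV hy)

lemma IsSided.sub {τ : Fin n → Fin n ⊕ Fin n} {V : Set (Cn n)} {a b : MultiIdx n → Cn n → ℂ}
    (ha : IsSided τ V a) (hb : IsSided τ V b) : IsSided τ V (fun γ => a γ - b γ) :=
  fun γ hγ y hy => by
    change a γ y - b γ y = 0
    rw [ha γ hγ y hy, hb γ hγ y hy, sub_zero]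

/-! ### Principal symbols -/

open Classical in
/-- A smooth function that vanishes at `x` and has the differential `ξ` there. -/
def probe (x : M) (ξ : TangentSpace 𝓘(ℝ, Cn n) x →L[ℝ] ℝ) : Sm n M :=
  if h : ∃ v : Sm n M, Represents x ξ v then h.choose else 0

lemma represents_probe [T2Space M] [IsManifold 𝓘(ℂ, Cn n) ω M] (x : M)
    (ξ : TangentSpace 𝓘(ℝ, Cn n) x →L[ℝ] ℝ) : Represents x ξ (probe x ξ) := by
  rw [probe, dif_pos (exists_represents x ξ)]
  exact (exists_represents x ξ).choose_spec

/-- The principal symbol of order `r` of an operator of order at most `r`. -/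
def symb (A : Sm n M →ₗ[ℂ] Sm n M) (r : ℕ) : CotFn n M := fun x ξ =>
  ((A (probe x ξ ^ r) : Sm n M) : M → ℂ) x / r.factorial

/-- The probe is chosen independently of the operator; hence the symbol is linear in it. -/
lemma symb_add (A B : Sm n M →ₗ[ℂ] Sm n M) (r : ℕ) : symb (A + B) r = symb A r + symb B r := by
  funext x ξ
  exact add_div _ _ _

lemma symb_smul (c : ℂ) (A : Sm n M →ₗ[ℂ] Sm n M) (r : ℕ) : symb (c • A) r = c • symb A r := by
  funext x ξ
  exact mul_div_assoc _ _ _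

/-- An operator of order at most `r` maps the `r`-th power of a function vanishing at the point to
`r!` times its leading part at the differential. So `symb`, defined without charts and with an
arbitrary probe, is the principal symbol, and no gluing is required. -/
lemma cotLoc_symb [T2Space M] [IsManifold 𝓘(ℂ, Cn n) ω M] {φ : OpenPartialHomeomorph M (Cn n)}
    (hφ : IsHolChart φ) {V : Set (Cn n)} (hV : IsOpen V) (hVt : V ⊆ φ.target)
    {A : Sm n M →ₗ[ℂ] Sm n M} {r : ℕ} {a : MultiIdx n → Cn n → ℂ} (h : IsRep φ V A r a)
    {y : Cn n} (hy : y ∈ V) (ζ : Cn n) :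
    cotLoc φ (symb A r) y ζ = ∑ γ ∈ idxEq n r, a γ y * mon γ (fibCoord ζ) := by
  have hp := represents_probe (φ.symm y) (covec φ (φ.symm y) ζ)
  have h1 := h.pow_eq hφ hV hVt hy (fun γ hγ => h.order γ hγ y hy) hp.1
  change loc φ (A (probe (φ.symm y) (covec φ (φ.symm y) ζ) ^ r)) y / _ = _
  rw [h1, mul_div_cancel_left₀ _ (by exact_mod_cast r.factorial_ne_zero)]
  simp only [wd_loc_of_represents hφ (hVt hy) hp]

/-- The operator `A` has order at most `r`, in the directions complementary to `τ`. -/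
def HasSidedOrder (τ : Fin n → Fin n ⊕ Fin n) (A : Sm n M →ₗ[ℂ] Sm n M) (r : ℕ) : Prop :=
  LocallyInCharts M fun φ V => ∃ a, IsRep φ V A r a ∧ IsSided τ V a

lemma HasSidedOrder.hasPrincipalSymbol [T2Space M] [IsManifold 𝓘(ℂ, Cn n) ω M]
    {τ : Fin n → Fin n ⊕ Fin n} {A : Sm n M →ₗ[ℂ] Sm n M} {r : ℕ} (h : HasSidedOrder τ A r) :
    HasPrincipalSymbol A r (symb A r) := by
  intro φ hφ y hy
  obtain ⟨V, hV, hyV, hVt, a, ha, -⟩ := h φ hφ y hy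
  refine ⟨V, hV, hyV, hVt, a, ha.smooth, ha.eq, fun z hz ζ => ?_⟩
  rw [cotLoc_symb hφ hV hVt ha hz]
  simp only [fibMon_eq_mon]
  rfl

lemma HasPrincipalSymbol.isFibrePolynomial {A : Sm n M →ₗ[ℂ] Sm n M} {r : ℕ} {P : CotFn n M}
    (h : HasPrincipalSymbol A r P) : IsFibrePolynomial r P := by
  intro φ hφ y hy
  obtain ⟨V, hV, hyV, hVt, a, ha, -, hP⟩ := h φ hφ y hy
  exact ⟨V, hV, hyV, hVt, a, ha, hP⟩

end operators

section commutant

variable {n : ℕ} {M : Type*} [TopologicalSpace M] [ChartedSpace (Cn n) M]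

/-! ### Formal operators commuting with a family of first order operators -/

/-- The formal operator `∑ ν^r A_r` commutes with operators which on `V` are given by
`∑ ν^q u_{l,q} + ν ∂_{τ l}`. -/
def IsCommutant (τ : Fin n → Fin n ⊕ Fin n) (φ : OpenPartialHomeomorph M (Cn n))
    (V : Set (Cn n)) (A : ℕ → Sm n M →ₗ[ℂ] Sm n M) (u : Fin n → ℕ → Sm n M) : Prop :=
  ∀ l, ∃ R : ℕ → Sm n M →ₗ[ℂ] Sm n M,
    (∀ q v, ∀ z ∈ V, loc φ (R q v) z =
      loc φ (u l q) z * loc φ v z + if q = 1 then wd (τ l) (loc φ v) z else 0) ∧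
    ∀ r v, ∑ p ∈ Finset.HasAntidiagonal.antidiagonal r, R p.1 (A p.2 v) =
      ∑ p ∈ Finset.HasAntidiagonal.antidiagonal r, A p.1 (R p.2 v)

lemma wd_eq_zero_of_eqOn {V : Set (Cn n)} (hV : IsOpen V) {a : Cn n → ℂ}
    (h : ∀ z ∈ V, a z = 0) (i : Fin n ⊕ Fin n) {y : Cn n} (hy : y ∈ V) : wd i a y = 0 := by
  rw [wd_congr_of_eqOn i hV (G := fun _ => 0) h hy, wd_const]

variable {σ τ : Fin n → Fin n ⊕ Fin n} {φ : OpenPartialHomeomorph M (Cn n)} {V : Set (Cn n)}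
  {A A' : ℕ → Sm n M →ₗ[ℂ] Sm n M} {u u' : Fin n → ℕ → Sm n M}
  (hφ : IsHolChart φ) (hV : IsOpen V) (hVt : V ⊆ φ.target)

include hφ hV hVt

/-- This is the coefficient of `ν^{r+1}` in the commutation relation: `∑ [A_p, u_{l,q}] = [∂_{τ l},
A_r]`. Coordinate derivations commute, so the right side differentiates only the coefficients of
`A_r`. -/
lemma IsCommutant.sum_antidiagonal (hA : IsCommutant τ φ V A u) {r N : ℕ}
    (hrep : ∀ p ≤ r + 1, ∃ N a, IsRep φ V (A p) N a) {a : MultiIdx n → Cn n → ℂ}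
    (ha : IsRep φ V (A r) N a) (l : Fin n) (v : Sm n M) {y : Cn n} (hy : y ∈ V) :
    ∑ p ∈ Finset.HasAntidiagonal.antidiagonal (r + 1),
        loc φ (A p.1 (centered φ y (u l p.2) * v)) y =
      ∑ γ ∈ idxLE n N, wd (τ l) (a γ) y * pderiv γ (loc φ v) y := by
  obtain ⟨R, hR, hc⟩ := hA l
  -- Operators act on global functions only; `W` is a global function that agrees with `∂_{τ l} v`
  -- on `V`.
  set W : Sm n M := R 1 v - u l 1 * v with hW
  have hWV : Set.EqOn (loc φ W) (wd (τ l) (loc φ v)) V := fun z hz => by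
    rw [hW, loc_sub, loc_mul, Pi.sub_apply, Pi.mul_apply, hR 1 v z hz, if_pos rfl]
    ring
  have h1 : ∀ p ∈ Finset.HasAntidiagonal.antidiagonal (r + 1), loc φ (A p.1 (R p.2 v)) y =
      loc φ (A p.1 (u l p.2 * v)) y + if p.2 = 1 then loc φ (A r W) y else 0 := by
    intro p hp
    rw [Finset.HasAntidiagonal.mem_antidiagonal] at hp
    obtain ⟨N', a', ha'⟩ := hrep p.1 (by omega)
    split_ifs with h
    · have e : p.1 = r := by omega
      rw [h, e, ← Pi.add_apply, ← loc_add, ← map_add, hW]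
      congr 3
      abel
    · rw [add_zero]
      refine ha'.congr hV (fun z hz => ?_) hy
      rw [hR _ v z hz, if_neg h, add_zero]
      rfl
  have h2 : ∀ p ∈ Finset.HasAntidiagonal.antidiagonal (r + 1), loc φ (R p.1 (A p.2 v)) y =
      loc φ (u l p.1) y * loc φ (A p.2 v) y +
        if p.1 = 1 then wd (τ l) (loc φ (A r v)) y else 0 := by
    intro p hp
    rw [Finset.HasAntidiagonal.mem_antidiagonal] at hp
    rw [hR _ _ y hy]
    split_ifs with h
    · rw [show p.2 = r by omega]
    · rfl
  have h3 := congrArg (fun f : Sm n M => loc φ f y) (hc (r + 1) v)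
  simp only [loc_sum] at h3
  rw [Finset.sum_congr rfl h2, Finset.sum_congr rfl h1, Finset.sum_add_distrib,
    Finset.sum_add_distrib] at h3
  -- The term `ν ∂_{τ l}` has degree one in `ν`, so it meets only the operator of degree `r`, once
  -- on each side of the commutation relation.
  have e1 : ∑ p ∈ Finset.HasAntidiagonal.antidiagonal (r + 1),
      (if p.1 = 1 then wd (τ l) (loc φ (A r v)) y else 0) = wd (τ l) (loc φ (A r v)) y := by
    rw [Finset.sum_eq_single (1, r)]
    · simp
    · rintro ⟨p, q⟩ hp hne
      rw [Finset.HasAntidiagonal.mem_antidiagonal] at hp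
      rw [if_neg]
      rintro rfl
      exact hne (by simp only [Prod.mk.injEq, true_and]; simp only at hp; omega)
    · intro h
      exact absurd (Finset.HasAntidiagonal.mem_antidiagonal.2 (by simp only; omega)) h
  have e2 : ∑ p ∈ Finset.HasAntidiagonal.antidiagonal (r + 1),
      (if p.2 = 1 then loc φ (A r W) y else 0) = loc φ (A r W) y := by
    rw [Finset.sum_eq_single (r, 1)]
    · simp
    · rintro ⟨p, q⟩ hp hne
      rw [Finset.HasAntidiagonal.mem_antidiagonal] at hp
      rw [if_neg]
      rintro rfl
      exact hne (by simp only [Prod.mk.injEq, and_true]; simp only at hp; omega)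
    · intro h
      exact absurd (Finset.HasAntidiagonal.mem_antidiagonal.2 (by simp only)) h
  rw [e1, e2, ha.wd_loc hφ hV hVt v (τ l) hy, ha.eq W y hy] at h3
  have e3 : ∑ γ ∈ idxLE n N, a γ y * pderiv γ (loc φ W) y =
      ∑ γ ∈ idxLE n N, a γ y * pderiv γ (wd (τ l) (loc φ v)) y :=
    Finset.sum_congr rfl fun γ _ => by rw [pderiv_congr_of_eqOn γ hV hWV hy]
  have e4 : ∑ p ∈ Finset.HasAntidiagonal.antidiagonal (r + 1),
      loc φ (A p.1 (centered φ y (u l p.2) * v)) y =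
      ∑ p ∈ Finset.HasAntidiagonal.antidiagonal (r + 1), loc φ (A p.1 (u l p.2 * v)) y -
      ∑ p ∈ Finset.HasAntidiagonal.antidiagonal (r + 1),
        loc φ (u l p.1) y * loc φ (A p.2 v) y := by
    rw [← Finset.Nat.sum_antidiagonal_swap
        (f := fun p : ℕ × ℕ => loc φ (u l p.1) y * loc φ (A p.2 v) y), ← Finset.sum_sub_distrib]
    refine Finset.sum_congr rfl fun p _ => ?_
    rw [centered_mul, map_sub, map_smul]
    rfl
  rw [e4]
  rw [e3] at h3
  linear_combination -h3

/-- On `v ^ m` with `m ≥ r - 1`, the commutators with `A_p`, `p < r`, vanish for reasons of order.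
Only those of `A_{r+1}` with `u_{l,0}` and of `A_r` with `u_{l,1}` survive. -/
lemma IsCommutant.apply_centered_mul_pow (hA : IsCommutant τ φ V A u) {r m : ℕ} (hm : r ≤ m + 1)
    {a : ℕ → MultiIdx n → Cn n → ℂ} (ha : ∀ p ≤ r, IsRep φ V (A p) p (a p))
    (ha' : ∃ N a', IsRep φ V (A (r + 1)) N a') (l : Fin n) {y : Cn n} (hy : y ∈ V) {v : Sm n M}
    (hv : loc φ v y = 0) :
    loc φ (A (r + 1) (centered φ y (u l 0) * v ^ m)) y =
      ∑ γ ∈ idxLE n r, wd (τ l) (a r γ) y * pderiv γ (loc φ v ^ m) y -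
        loc φ (A r (centered φ y (u l 1) * v ^ m)) y := by
  have h := hA.sum_antidiagonal hφ hV hVt (r := r) (N := r) (a := a r) (fun p hp => ?_)
    (ha r le_rfl) l (v ^ m) hy
  -- Splitting off the pair `(r + 1, 0)` shifts the remaining second indices by one, so the pair
  -- `(r, 0)` of the remaining sum carries `u_{l,1}`.
  · rw [Finset.Nat.sum_antidiagonal_succ', Finset.sum_eq_single (r, 0)] at h
    · rw [loc_pow] at h
      rw [← h]
      ring
    · rintro ⟨p, q⟩ hp hne
      rw [Finset.HasAntidiagonal.mem_antidiagonal] at hp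
      simp only at hp
      have hpr : p ≠ r := by
        rintro rfl
        exact hne (by simp only [Prod.mk.injEq, true_and]; omega)
      exact (ha p (by omega)).pow_mul_eq_zero hφ hV hVt (by omega) hy hv
        (by rw [loc_centered, sub_self])
    · intro h'
      exact absurd (Finset.HasAntidiagonal.mem_antidiagonal.2 (by simp)) h'
  · rcases Nat.lt_or_ge r p with h | h
    · rw [show p = r + 1 by omega]
      exact ha'
    · exact ⟨p, a p, ha p h⟩

omit hφ hVt in
lemma IsRep.wd_coeff_eq_zero {a : MultiIdx n → Cn n → ℂ} {B : Sm n M →ₗ[ℂ] Sm n M} {N : ℕ}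
    (h : IsRep φ V B N a) (i : Fin n ⊕ Fin n) {y : Cn n} (hy : y ∈ V) (γ : MultiIdx n)
    (hγ : N < ∑ i, γ i) : wd i (a γ) y = 0 :=
  wd_eq_zero_of_eqOn hV (h.order γ hγ) i hy

omit hV in
/-- The combination `v` of the functions `u_{l,0} - u_{l,0}(y)` with prescribed derivatives. -/
lemma exists_combination {H : Fin n → Fin n → ℂ} {y : Cn n} (hy : y ∈ V)
    (hH : ∀ k k', ∑ l, wd (σ k) (loc φ (u l 0)) y * H l k' = if k = k' then 1 else 0)
    (c : Fin n → ℂ) : ∃ v : Sm n M, v = ∑ l, (∑ k, c k * H l k) • centered φ y (u l 0) ∧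
      loc φ v y = 0 ∧ ∀ k, wd (σ k) (loc φ v) y = c k := by
  -- The coefficients `∑ c_k H_{lk}` solve the linear system with matrix `∂_{σ k} u_{l,0}`, of which
  -- `H` is the inverse at `y`.
  refine ⟨_, rfl, ?_, fun k => ?_⟩
  · rw [loc_sum]
    refine Finset.sum_eq_zero fun l _ => ?_
    rw [loc_smul]
    change _ * loc φ (centered φ y (u l 0)) y = 0
    rw [loc_centered, sub_self, mul_zero]
  · have e : loc φ (∑ l, (∑ k, c k * H l k) • centered φ y (u l 0) : Sm n M) =
        fun z => ∑ l, (∑ k, c k * H l k) * loc φ (centered φ y (u l 0)) z := by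
      funext z
      rw [loc_sum]
      rfl
    have hd := fun l => ((contDiffOn_loc hφ (centered φ y (u l 0))).diffAt φ.open_target (hVt hy))
    rw [e, wd_sum _ _ fun l _ => (hd l).const_mul _]
    have e2 : ∀ l, wd (σ k) (fun z => (∑ k, c k * H l k) * loc φ (centered φ y (u l 0)) z) y =
        ∑ k', c k' * (wd (σ k) (loc φ (u l 0)) y * H l k') := by
      intro l
      rw [wd_const_mul _ _ (hd l), wd_loc_centered hφ _ _ _ (hVt hy), Finset.sum_mul]
      exact Finset.sum_congr rfl fun _ _ => by ring
    simp only [e2]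
    rw [Finset.sum_comm]
    simp only [← Finset.mul_sum, hH]
    simp

-- Expanding a single factor of the power turns the value of `B`, hence its symbol, into a
-- combination of commutators with the functions `u_{l,0}`.
omit hφ hV hVt in
lemma loc_apply_pow_succ (B : Sm n M →ₗ[ℂ] Sm n M) {y : Cn n} {v : Sm n M} {c : Fin n → ℂ}
    (hv : v = ∑ l, c l • centered φ y (u l 0)) (m : ℕ) :
    loc φ (B (v ^ (m + 1))) y = ∑ l, c l * loc φ (B (centered φ y (u l 0) * v ^ m)) y := by
  have : v ^ (m + 1) = ∑ l, c l • (centered φ y (u l 0) * v ^ m) := by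
    rw [pow_succ']
    conv_lhs => arg 1; rw [hv]
    rw [Finset.sum_mul]
    exact Finset.sum_congr rfl fun l _ => by rw [smul_mul_assoc]
  rw [this, map_sum, loc_sum]
  refine Finset.sum_congr rfl fun l _ => ?_
  rw [map_smul, loc_smul]

variable (hστ : ∀ i, (∃ k, i = σ k) ∨ ∃ k, i = τ k)

include hστ

/-- Recursion for the leading coefficients of a commuting formal operator. -/
lemma IsCommutant.leading_coeff (hA : IsCommutant τ φ V A u) {r m : ℕ} (hm : r ≤ m)
    {a : ℕ → MultiIdx n → Cn n → ℂ} (ha : ∀ p ≤ r, IsRep φ V (A p) p (a p))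
    (has : IsSided τ V (a r)) {a' : MultiIdx n → Cn n → ℂ}
    (ha' : IsRep φ V (A (r + 1)) (m + 1) a') (has' : IsSided τ V a') {y : Cn n} (hy : y ∈ V)
    {H : Fin n → Fin n → ℂ}
    (hH : ∀ k k', ∑ l, wd (σ k) (loc φ (u l 0)) y * H l k' = if k = k' then 1 else 0)
    (t : Fin n ⊕ Fin n → ℂ) :
    (m + 1 : ℂ) * ∑ γ ∈ idxEq n (m + 1), a' γ y * mon γ t =
      ∑ l, (∑ k, t (σ k) * H l k) * ∑ γ ∈ idxEq n m, wd (τ l) (a r γ) y * mon γ t := by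
  -- The test function has `σ` derivatives `t` at `y` and is a combination of the functions whose
  -- commutators are known. Evaluating on `v ^ (m + 1)` gives the leading part of `A_{r+1}` at `t`.
  obtain ⟨v, hv, hvy, hvk⟩ := exists_combination hφ hVt hy hH fun k => t (σ k)
  have h1 := ha'.pow_eq hφ hV hVt hy (fun γ hγ => ha'.order γ hγ y hy) hvy
  rw [sum_mon_congr hστ (fun γ hγ => has' γ hγ y hy) hvk] at h1
  -- Since `A_r` has order `r ≤ m`, its commutator with `u_{l,1}` does not contribute. The case `m >
  -- r` will bound the order, the case `m = r` gives the symbol.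
  have h2 : ∀ l, loc φ (A (r + 1) (centered φ y (u l 0) * v ^ m)) y =
      m.factorial * ∑ γ ∈ idxEq n m, wd (τ l) (a r γ) y * mon γ t := by
    intro l
    rw [hA.apply_centered_mul_pow hφ hV hVt (by omega) ha ⟨_, _, ha'⟩ l hy hvy,
      (ha r le_rfl).pow_mul_eq_zero hφ hV hVt hm hy hvy (by rw [loc_centered, sub_self]), sub_zero,
      jet_pow ((ha r le_rfl).wd_coeff_eq_zero hV (τ l) hy)
        (fun γ hγ => (ha r le_rfl).wd_coeff_eq_zero hV (τ l) hy γ (by omega)) hV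
        ((contDiffOn_loc hφ v).mono hVt) hy hvy,
      sum_mon_congr hστ (fun γ hγ => wd_eq_zero_of_eqOn hV (has γ hγ) (τ l) hy) hvk]
  have h3 := loc_apply_pow_succ (A (r + 1)) hv m
  rw [h1] at h3
  simp only [h2] at h3
  have hf : (m.factorial : ℂ) ≠ 0 := by exact_mod_cast m.factorial_ne_zero
  apply mul_left_cancel₀ hf
  rw [Nat.factorial_succ] at h3
  push_cast at h3
  rw [← mul_assoc, mul_comm (m.factorial : ℂ) (m + 1), h3, Finset.mul_sum]
  exact Finset.sum_congr rfl fun l _ => by ring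

/-- Only the derivatives of `u_{l,0}` in the directions `σ` matter. -/
lemma loc_apply_centered_mul_congr {B : Sm n M →ₗ[ℂ] Sm n M} {N : ℕ}
    {a : MultiIdx n → Cn n → ℂ} (ha : IsRep φ V B N a) (has : IsSided τ V a) {f g : Sm n M}
    (hfg : ∀ k, ∀ z ∈ V, wd (σ k) (loc φ f) z = wd (σ k) (loc φ g) z) {y : Cn n} (hy : y ∈ V)
    (v : Sm n M) :
    loc φ (B (centered φ y f * v)) y = loc φ (B (centered φ y g * v)) y := by
  have h := ha.mul_of_wd_eq_zero hφ hV hVt hστ has (q := centered φ y f - centered φ y g)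
    (fun k z hz => ?_) v hy
  · rw [sub_mul, map_sub, loc_sub, loc_sub, Pi.sub_apply, Pi.sub_apply, loc_centered, loc_centered,
      sub_self, sub_self, sub_self, zero_mul] at h
    exact sub_eq_zero.1 h
  · rw [loc_sub, wd_sub _ ((contDiffOn_loc hφ _).diffAt φ.open_target (hVt hz))
      ((contDiffOn_loc hφ _).diffAt φ.open_target (hVt hz)), wd_loc_centered hφ _ _ _ (hVt hz),
      wd_loc_centered hφ _ _ _ (hVt hz), hfg k z hz, sub_self]

/-- Subtract the two relations of degree `r + 1` in `ν`. The unprimed `u_{l,0}` may be used in both,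
because it differs from the primed one by a function constant along `σ`. What survives is the `τ`
derivative of the difference in degree `r` and the commutator of `A'_r` with `u_{l,1} - u'_{l,1}`.
-/
lemma IsCommutant.sub_apply_centered_mul_pow (hA : IsCommutant τ φ V A u)
    (hA' : IsCommutant τ φ V A' u') {r m : ℕ} (hm : r ≤ m + 1)
    {a a' : ℕ → MultiIdx n → Cn n → ℂ} (ha : ∀ p ≤ r + 1, IsRep φ V (A p) p (a p))
    (ha' : ∀ p ≤ r + 1, IsRep φ V (A' p) p (a' p)) (has' : ∀ p ≤ r + 1, IsSided τ V (a' p))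
    (hd : ∀ γ, r ≤ ∑ i, γ i → ∀ z ∈ V, a r γ z = a' r γ z)
    (hw : ∀ k l, ∀ z ∈ V, wd (σ k) (loc φ (u l 0)) z = wd (σ k) (loc φ (u' l 0)) z)
    (l : Fin n) {y : Cn n} (hy : y ∈ V) {v : Sm n M} (hv : loc φ v y = 0) :
    loc φ ((A (r + 1) - A' (r + 1)) (centered φ y (u l 0) * v ^ m)) y =
      m.factorial * ∑ γ ∈ idxEq n m,
        wd (τ l) (a r γ - a' r γ) y * mon γ (fun i => wd i (loc φ v) y) -
      loc φ (A' r ((centered φ y (u l 1) - centered φ y (u' l 1)) * v ^ m)) y := by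
  have har := ha r (by omega)
  have har' := ha' r (by omega)
  have hsub := har.sub har'
  have hd' : ∀ γ : MultiIdx n, m < ∑ i, γ i → ∀ z ∈ V, a r γ z - a' r γ z = 0 :=
    fun γ hγ z hz => sub_eq_zero.2 (hd γ (by omega) z hz)
  have h1 := hA.apply_centered_mul_pow hφ hV hVt hm (fun p hp => ha p (by omega))
    ⟨_, _, ha (r + 1) le_rfl⟩ l hy hv
  have h2 := hA'.apply_centered_mul_pow hφ hV hVt hm (fun p hp => ha' p (by omega))
    ⟨_, _, ha' (r + 1) le_rfl⟩ l hy hv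
  rw [← loc_apply_centered_mul_congr hφ hV hVt hστ (ha' _ le_rfl) (has' _ le_rfl)
    (fun k z hz => hw k l z hz) hy] at h2
  -- `A_r - A'_r` has order at most `r - 1 ≤ m`, so its commutator with `u_{l,1}` kills `v ^ m`.
  have h3 : loc φ (A r (centered φ y (u l 1) * v ^ m)) y =
      loc φ (A' r (centered φ y (u l 1) * v ^ m)) y := by
    have := hsub.pow_mul hφ hV hVt hy (m := m) (fun γ hγ => hd' γ hγ y hy) hv (centered φ y (u l 1))
    rw [loc_centered, sub_self, mul_zero, mul_comm] at this
    exact sub_eq_zero.1 this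
  have h4 := jet_pow (N := r) (m := m) (c := fun γ => wd (τ l) (a r γ - a' r γ) y)
    (fun γ hγ => wd_eq_zero_of_eqOn hV (hsub.order γ hγ) (τ l) hy)
    (fun γ hγ => wd_eq_zero_of_eqOn hV (hd' γ hγ) (τ l) hy) hV
    ((contDiffOn_loc hφ v).mono hVt) hy hv
  rw [← h4, LinearMap.sub_apply, loc_sub, Pi.sub_apply, h1, h2, h3, sub_mul, map_sub, loc_sub,
    Pi.sub_apply]
  have h5 : ∑ γ ∈ idxLE n r, wd (τ l) (a r γ - a' r γ) y * pderiv γ (loc φ v ^ m) y =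
      ∑ γ ∈ idxLE n r, wd (τ l) (a r γ) y * pderiv γ (loc φ v ^ m) y -
      ∑ γ ∈ idxLE n r, wd (τ l) (a' r γ) y * pderiv γ (loc φ v ^ m) y := by
    rw [← Finset.sum_sub_distrib]
    refine Finset.sum_congr rfl fun γ _ => ?_
    rw [wd_sub _ ((har.smooth γ).diffAt hV hy) ((har'.smooth γ).diffAt hV hy), sub_mul]
  rw [h5]
  ring

/-- At `y` the function `u_{l,1} - u'_{l,1}` agrees to first order along `σ` with a combination of
the `u_{q,0}`, and an operator of order at most `m + 1` cannot see the remainder when it is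
multiplied by `v ^ m`. The commutators with `u_{q,0}` are known from the previous degree; this is
where `κ` meets the second copy of `H`. -/
lemma IsCommutant.apply_sub_mul_pow (hA' : IsCommutant τ φ V A' u') {r m : ℕ} (hm : r ≤ m)
    {a' : ℕ → MultiIdx n → Cn n → ℂ}
    (ha' : ∀ p ≤ r + 1, IsRep φ V (A' p) p (a' p)) (has' : ∀ p ≤ r + 1, IsSided τ V (a' p))
    (hw : ∀ k l, ∀ z ∈ V, wd (σ k) (loc φ (u l 0)) z = wd (σ k) (loc φ (u' l 0)) z)
    (l : Fin n) {y : Cn n} (hy : y ∈ V) {H : Fin n → Fin n → ℂ}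
    (hH : ∀ k k', ∑ l, wd (σ k) (loc φ (u l 0)) y * H l k' = if k = k' then 1 else 0)
    {κ : Fin n → Fin n → ℂ}
    (hκ : ∀ k l, wd (σ k) (loc φ (u l 1)) y - wd (σ k) (loc φ (u' l 1)) y = κ k l)
    {v : Sm n M} (hv : loc φ v y = 0) :
    loc φ (A' (r + 1) ((centered φ y (u l 1) - centered φ y (u' l 1)) * v ^ m)) y =
      ∑ q, (∑ k, κ k l * H q k) * (m.factorial * ∑ γ ∈ idxEq n m,
        wd (τ q) (a' r γ) y * mon γ (fun i => wd i (loc φ v) y)) := by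
  obtain ⟨f, hf, hfy, hfk⟩ := exists_combination (u := u) hφ hVt hy hH fun k => κ k l
  have hdiff : ∀ g : Sm n M, DifferentiableAt ℝ (loc φ g) y :=
    fun g => (contDiffOn_loc hφ g).diffAt φ.open_target (hVt hy)
  have h1 := (ha' (r + 1) le_rfl).pow_mul_eq_zero_of_flat hφ hV hVt hστ (has' _ le_rfl)
    (m := m) (by omega) hy hv (u := centered φ y (u l 1) - centered φ y (u' l 1) - f)
    (by rw [loc_sub, loc_sub, Pi.sub_apply, Pi.sub_apply, loc_centered, loc_centered, hfy]; ring)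
    (fun k => by
      rw [loc_sub, wd_sub _ (hdiff _) (hdiff _), loc_sub, wd_sub _ (hdiff _) (hdiff _), hfk,
        wd_loc_centered hφ _ _ _ (hVt hy), wd_loc_centered hφ _ _ _ (hVt hy), hκ, sub_self])
  rw [sub_mul, map_sub, loc_sub, Pi.sub_apply, sub_eq_zero] at h1
  rw [h1, hf, Finset.sum_mul, map_sum, loc_sum]
  refine Finset.sum_congr rfl fun q _ => ?_
  have har' := ha' r (by omega)
  rw [smul_mul_assoc, map_smul]
  refine congrArg (fun x => (∑ k, κ k l * H q k) * x) ?_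
  change loc φ (A' (r + 1) (centered φ y (u q 0) * v ^ m)) y = _
  rw [loc_apply_centered_mul_congr hφ hV hVt hστ (ha' _ le_rfl) (has' _ le_rfl)
    (fun k z hz => hw k q z hz) hy, hA'.apply_centered_mul_pow hφ hV hVt (by omega)
    (fun p hp => ha' p (by omega)) ⟨_, _, ha' (r + 1) le_rfl⟩ q hy hv,
    har'.pow_mul_eq_zero hφ hV hVt hm hy hv (by rw [loc_centered, sub_self]), sub_zero,
    jet_pow (har'.wd_coeff_eq_zero hV (τ q) hy)
      (fun γ hγ => har'.wd_coeff_eq_zero hV (τ q) hy γ (by omega)) hV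
      ((contDiffOn_loc hφ v).mono hVt) hy hv]

/-- The difference of two commuting formal operators has order less than `r` in degree `r`. -/
lemma IsCommutant.sub_order (hA : IsCommutant τ φ V A u)
    (hA' : IsCommutant τ φ V A' u') {r : ℕ}
    {a a' : ℕ → MultiIdx n → Cn n → ℂ} (ha : ∀ p ≤ r + 1, IsRep φ V (A p) p (a p))
    (ha' : ∀ p ≤ r + 1, IsRep φ V (A' p) p (a' p)) (has : ∀ p ≤ r + 1, IsSided τ V (a p))
    (has' : ∀ p ≤ r + 1, IsSided τ V (a' p))
    (hd : ∀ γ, r ≤ ∑ i, γ i → ∀ z ∈ V, a r γ z = a' r γ z)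
    (hw : ∀ k l, ∀ z ∈ V, wd (σ k) (loc φ (u l 0)) z = wd (σ k) (loc φ (u' l 0)) z)
    {y : Cn n} (hy : y ∈ V) {H : Fin n → Fin n → ℂ}
    (hH : ∀ k k', ∑ l, wd (σ k) (loc φ (u l 0)) y * H l k' = if k = k' then 1 else 0)
    (γ : MultiIdx n) (hγ : r + 1 ≤ ∑ i, γ i) : a (r + 1) γ y = a' (r + 1) γ y := by
  have hsub := (ha (r + 1) le_rfl).sub (ha' (r + 1) le_rfl)
  rcases hγ.lt_or_eq with hγ | hγ
  · exact sub_eq_zero.1 (hsub.order γ hγ y hy)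
  refine sub_eq_zero.1 (coeff_eq_zero_of_sum_mon (s := idxEq n (r + 1))
    (a := fun γ => (a (r + 1) γ - a' (r + 1) γ) y) (fun t => ?_) (mem_idxEq.2 hγ.symm))
  obtain ⟨v, hv, hvy, hvk⟩ := exists_combination hφ hVt hy hH fun k => t (σ k)
  have h1 := hsub.pow_eq hφ hV hVt hy (fun γ hγ => hsub.order γ hγ y hy) hvy
  rw [sum_mon_congr hστ (fun γ hγ => (has _ le_rfl).sub (has' _ le_rfl) γ hγ y hy) hvk,
    loc_apply_pow_succ _ hv r, Finset.sum_eq_zero] at h1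
  · have hf : ((r + 1).factorial : ℂ) ≠ 0 := by exact_mod_cast (r + 1).factorial_ne_zero
    exact (mul_eq_zero.1 h1.symm).resolve_left hf
  intro l _
  -- The coefficients of order at least `r` agree on all of `V`, not only at `y`, so their
  -- derivatives agree too.
  have hz : ∑ γ ∈ idxEq n r,
      wd (τ l) (a r γ - a' r γ) y * mon γ (fun i => wd i (loc φ v) y) = 0 :=
    Finset.sum_eq_zero fun γ hγ => by
      rw [wd_eq_zero_of_eqOn hV (a := a r γ - a' r γ)
        (fun z hz => sub_eq_zero.2 (hd γ (mem_idxEq.1 hγ).ge z hz)) _ hy, zero_mul]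
  rw [hA.sub_apply_centered_mul_pow hφ hV hVt hστ hA' (by omega) ha ha' has' hd hw l hy hvy, hz,
    (ha' r (by omega)).pow_mul_eq_zero hφ hV hVt le_rfl hy hvy]
  · simp
  · rw [loc_sub, Pi.sub_apply, loc_centered, loc_centered]
    ring

/-- Recursion for the leading coefficients of the difference of two commuting formal operators. -/
lemma IsCommutant.sub_leading_coeff (hA : IsCommutant τ φ V A u)
    (hA' : IsCommutant τ φ V A' u') {m : ℕ}
    {a a' : ℕ → MultiIdx n → Cn n → ℂ} (ha : ∀ p ≤ m + 2, IsRep φ V (A p) p (a p))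
    (ha' : ∀ p ≤ m + 2, IsRep φ V (A' p) p (a' p)) (has : ∀ p ≤ m + 2, IsSided τ V (a p))
    (has' : ∀ p ≤ m + 2, IsSided τ V (a' p))
    (hd : ∀ γ, m + 1 ≤ ∑ i, γ i → ∀ z ∈ V, a (m + 1) γ z = a' (m + 1) γ z)
    (hd' : ∀ γ, m + 2 ≤ ∑ i, γ i → ∀ z ∈ V, a (m + 2) γ z = a' (m + 2) γ z)
    (hw : ∀ k l, ∀ z ∈ V, wd (σ k) (loc φ (u l 0)) z = wd (σ k) (loc φ (u' l 0)) z)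
    {y : Cn n} (hy : y ∈ V) {H : Fin n → Fin n → ℂ}
    (hH : ∀ k k', ∑ l, wd (σ k) (loc φ (u l 0)) y * H l k' = if k = k' then 1 else 0)
    {κ : Fin n → Fin n → ℂ}
    (hκ : ∀ k l, wd (σ k) (loc φ (u l 1)) y - wd (σ k) (loc φ (u' l 1)) y = κ k l)
    (t : Fin n ⊕ Fin n → ℂ) :
    (m + 1 : ℂ) * ∑ γ ∈ idxEq n (m + 1), (a (m + 2) γ - a' (m + 2) γ) y * mon γ t =
      ∑ l, (∑ k, t (σ k) * H l k) *
        (∑ γ ∈ idxEq n m, wd (τ l) (a (m + 1) γ - a' (m + 1) γ) y * mon γ t -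
          ∑ q, (∑ k, κ k l * H q k) *
            ∑ γ ∈ idxEq n m, wd (τ q) (a' m γ) y * mon γ t) := by
  have hsub := (ha (m + 2) le_rfl).sub (ha' (m + 2) le_rfl)
  obtain ⟨v, hv, hvy, hvk⟩ := exists_combination hφ hVt hy hH fun k => t (σ k)
  have h1 := hsub.pow_eq hφ hV hVt hy (m := m + 1)
    (fun γ hγ => sub_eq_zero.2 (hd' γ (by omega) y hy)) hvy
  rw [sum_mon_congr hστ (fun γ hγ => (has _ le_rfl).sub (has' _ le_rfl) γ hγ y hy) hvk,
    loc_apply_pow_succ _ hv m] at h1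
  have h2 : ∀ l, loc φ ((A (m + 2) - A' (m + 2)) (centered φ y (u l 0) * v ^ m)) y =
      m.factorial * (∑ γ ∈ idxEq n m, wd (τ l) (a (m + 1) γ - a' (m + 1) γ) y * mon γ t -
          ∑ q, (∑ k, κ k l * H q k) *
            ∑ γ ∈ idxEq n m, wd (τ q) (a' m γ) y * mon γ t) := by
    -- The difference relation is used in degree `r = m + 1`, where it leaves a commutator of
    -- `A'_{m+1}`. The latter is evaluated by the relation for `A'` in degree `r = m`.
    intro l
    rw [hA.sub_apply_centered_mul_pow hφ hV hVt hστ hA' le_rfl ha ha' has' hd hw l hy hvy,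
      hA'.apply_sub_mul_pow hφ hV hVt hστ le_rfl (fun p hp => ha' p (by omega))
        (fun p hp => has' p (by omega)) hw l hy hH hκ hvy,
      sum_mon_congr hστ (fun γ hγ => wd_eq_zero_of_eqOn hV
        ((has (m + 1) (by omega)).sub (has' (m + 1) (by omega)) γ hγ) (τ l) hy) hvk, mul_sub]
    congr 1
    rw [Finset.mul_sum]
    refine Finset.sum_congr rfl fun q _ => ?_
    rw [sum_mon_congr hστ (fun γ hγ => wd_eq_zero_of_eqOn hV
        (has' m (by omega) γ hγ) (τ q) hy) hvk]
    ring
  simp only [h2] at h1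
  have hf : (m.factorial : ℂ) ≠ 0 := by exact_mod_cast m.factorial_ne_zero
  apply mul_left_cancel₀ hf
  rw [Nat.factorial_succ] at h1
  push_cast at h1
  rw [← mul_assoc, mul_comm (m.factorial : ℂ) (m + 1), ← h1, Finset.mul_sum]
  exact Finset.sum_congr rfl fun l _ => by ring

end commutant

section pairs

variable {n : ℕ} {M : Type*} [TopologicalSpace M] [ChartedSpace (Cn n) M]

/-! ### Pairs of commuting formal operators on a manifold -/

lemma LocallyInCharts.and {P Q : OpenPartialHomeomorph M (Cn n) → Set (Cn n) → Prop}
    (hP : LocallyInCharts M P) (hQ : LocallyInCharts M Q)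
    (mP : ∀ φ V V', V' ⊆ V → P φ V → P φ V') (mQ : ∀ φ V V', V' ⊆ V → Q φ V → Q φ V') :
    LocallyInCharts M fun φ V => P φ V ∧ Q φ V := by
  intro φ hφ y hy
  obtain ⟨V, hV, hyV, hVt, hPV⟩ := hP φ hφ y hy
  obtain ⟨V', hV', hyV', -, hQV'⟩ := hQ φ hφ y hy
  exact ⟨V ∩ V', hV.inter hV', ⟨hyV, hyV'⟩, Set.inter_subset_left.trans hVt,
    mP _ _ _ Set.inter_subset_left hPV, mQ _ _ _ Set.inter_subset_right hQV'⟩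

/-- The operators `A p`, `p ≤ r`, have order at most `p` with coefficients `a p` on `V`. -/
def NaturalUpTo (τ : Fin n → Fin n ⊕ Fin n) (A : ℕ → Sm n M →ₗ[ℂ] Sm n M) (r : ℕ)
    (φ : OpenPartialHomeomorph M (Cn n)) (V : Set (Cn n)) (a : ℕ → MultiIdx n → Cn n → ℂ) : Prop :=
  ∀ p ≤ r, IsRep φ V (A p) p (a p) ∧ IsSided τ V (a p)

lemma NaturalUpTo.mono {τ : Fin n → Fin n ⊕ Fin n} {A : ℕ → Sm n M →ₗ[ℂ] Sm n M} {r : ℕ}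
    {φ : OpenPartialHomeomorph M (Cn n)} {V V' : Set (Cn n)} {a : ℕ → MultiIdx n → Cn n → ℂ}
    (h : NaturalUpTo τ A r φ V a) (hV : V' ⊆ V) : NaturalUpTo τ A r φ V' a :=
  fun p hp => ⟨(h p hp).1.mono hV, (h p hp).2.mono hV⟩

/-- Each operator has its own neighbourhood. Only finitely many may be intersected, which is why
local data are always collected up to a fixed degree `r`. -/
lemma locally_naturalUpTo {τ : Fin n → Fin n ⊕ Fin n} {A : ℕ → Sm n M →ₗ[ℂ] Sm n M} (r : ℕ)
    (h : ∀ p ≤ r, HasSidedOrder τ (A p) p) :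
    LocallyInCharts M fun φ V => ∃ a, NaturalUpTo τ A r φ V a := by
  induction r with
  | zero =>
    intro φ hφ y hy
    obtain ⟨V, hV, hyV, hVt, a, ha⟩ := h 0 le_rfl φ hφ y hy
    exact ⟨V, hV, hyV, hVt, fun _ => a, fun p hp => by rwa [Nat.le_zero.1 hp]⟩
  | succ r ih =>
    intro φ hφ y hy
    obtain ⟨V, hV, hyV, hVt, ⟨a, ha⟩, a', ha'⟩ :=
      (LocallyInCharts.and (ih fun p hp => h p (by omega)) (h (r + 1) le_rfl)
        (fun _ _ _ hV ⟨a, ha⟩ => ⟨a, ha.mono hV⟩)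
        (fun _ _ _ hV ⟨a, ha⟩ => ⟨a, ha.1.mono hV, ha.2.mono hV⟩)) φ hφ y hy
    refine ⟨V, hV, hyV, hVt, Function.update a (r + 1) a', fun p hp => ?_⟩
    rcases hp.lt_or_eq with hp | rfl
    · rw [Function.update_of_ne (by omega)]
      exact ha p (by omega)
    · rwa [Function.update_self]

/-- Two families of operators in the directions `σ` which commute with operators
`∑ ν^q u_{l,q} + ν ∂_{τ l}` and `∑ ν^q u'_{l,q} + ν ∂_{τ l}`, respectively, where
`∂_{σ k} u_{l,0} = ∂_{σ k} u'_{l,0} = G_{kl}` and `∂_{σ k} (u_{l,1} - u'_{l,1}) = κ_{kl}`. -/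
structure IsCommutingPair (σ τ : Fin n → Fin n ⊕ Fin n) (A A' : ℕ → Sm n M →ₗ[ℂ] Sm n M)
    (G H κ : OpenPartialHomeomorph M (Cn n) → Cn n → Fin n → Fin n → ℂ) : Prop where
  side : ∀ i, (∃ k, i = σ k) ∨ ∃ k, i = τ k
  inverse : ∀ φ : OpenPartialHomeomorph M (Cn n), IsHolChart φ → ∀ y ∈ φ.target, ∀ k k',
    ∑ l, G φ y k l * H φ y l k' = if k = k' then 1 else 0
  sided : ∀ r, LocallyInCharts M fun φ V => ∃ N a, IsRep φ V (A r) N a ∧ IsSided τ V a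
  sided' : ∀ r, LocallyInCharts M fun φ V => ∃ N a, IsRep φ V (A' r) N a ∧ IsSided τ V a
  commutant : LocallyInCharts M fun φ V => ∃ u u' : Fin n → ℕ → Sm n M,
    IsCommutant τ φ V A u ∧ IsCommutant τ φ V A' u' ∧
    (∀ k l, ∀ z ∈ V, wd (σ k) (loc φ (u l 0)) z = G φ z k l) ∧
    (∀ k l, ∀ z ∈ V, wd (σ k) (loc φ (u' l 0)) z = G φ z k l) ∧
    ∀ k l, ∀ z ∈ V, wd (σ k) (loc φ (u l 1)) z - wd (σ k) (loc φ (u' l 1)) z = κ φ z k l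
  zero : HasSidedOrder τ (A 0) 0
  zero_eq : A 0 = A' 0

lemma IsCommutant.mono {τ : Fin n → Fin n ⊕ Fin n} {φ : OpenPartialHomeomorph M (Cn n)}
    {V V' : Set (Cn n)} {A : ℕ → Sm n M →ₗ[ℂ] Sm n M} {u : Fin n → ℕ → Sm n M}
    (h : IsCommutant τ φ V A u) (hV : V' ⊆ V) : IsCommutant τ φ V' A u := fun l => by
  obtain ⟨R, hR, hc⟩ := h l
  exact ⟨R, fun q v z hz => hR q v z (hV hz), hc⟩

namespace IsCommutingPair

variable {σ τ : Fin n → Fin n ⊕ Fin n} {A A' : ℕ → Sm n M →ₗ[ℂ] Sm n M}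
  {G H κ : OpenPartialHomeomorph M (Cn n) → Cn n → Fin n → Fin n → ℂ}

lemma symm (h : IsCommutingPair σ τ A A' G H κ) :
    IsCommutingPair σ τ A' A G H (fun φ y k l => -κ φ y k l) where
  side := h.side
  inverse := h.inverse
  sided := h.sided'
  sided' := h.sided
  commutant := by
    intro φ hφ y hy
    obtain ⟨V, hV, hyV, hVt, u, u', h1, h2, h3, h4, h5⟩ := h.commutant φ hφ y hy
    exact ⟨V, hV, hyV, hVt, u', u, h2, h1, h4, h3, fun k l z hz => by rw [← h5 k l z hz]; ring⟩
  zero := h.zero_eq ▸ h.zero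
  zero_eq := h.zero_eq.symm

/-- Naturality. The commutator of `A_{r+1}` with `u_{l,0}` is given by operators of degree at most
`r` in `ν`, hence has order at most `r`; by invertibility of `G` the operator `A_{r+1}` then has
order at most `r + 1`. -/
lemma hasSidedOrder (h : IsCommutingPair σ τ A A' G H κ) (r : ℕ) : HasSidedOrder τ (A r) r := by
  induction r using Nat.strong_induction_on with
  | _ r ih =>
  rcases r with _ | r
  · exact h.zero
  intro φ hφ y hy
  obtain ⟨V, hV, hyV, hVt, ⟨⟨a, ha⟩, N, a', ha', has'⟩, u, h1, h3⟩ :=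
    (((locally_naturalUpTo r fun p hp => ih p (by omega)).and (h.sided (r + 1))
      (fun _ _ _ hV ⟨a, ha⟩ => ⟨a, ha.mono hV⟩)
      (fun _ _ _ hV ⟨N, a, ha⟩ => ⟨N, a, ha.1.mono hV, ha.2.mono hV⟩)).and
      (Q := fun φ V => ∃ u : Fin n → ℕ → Sm n M, IsCommutant τ φ V A u ∧
        ∀ k l, ∀ z ∈ V, wd (σ k) (loc φ (u l 0)) z = G φ z k l) (fun φ hφ y hy => by
        obtain ⟨V, hV, hyV, hVt, u, u', h1, -, h3, -⟩ := h.commutant φ hφ y hy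
        exact ⟨V, hV, hyV, hVt, u, h1, h3⟩)
      (fun _ _ _ hV ⟨⟨a, ha⟩, N, a', ha'⟩ => ⟨⟨a, ha.mono hV⟩, N, a', ha'.1.mono hV, ha'.2.mono hV⟩)
      (fun _ _ _ hV ⟨u, h1, h2⟩ => ⟨u, h1.mono hV, fun k l z hz => h2 k l z (hV hz)⟩)) φ hφ y hy
  refine ⟨V, hV, hyV, hVt, a', ?_, has'⟩
  -- Only some finite local bound on the order is known at first. The excess `j` over `r + 1` is
  -- removed one unit at a time.
  suffices hlow : ∀ j, IsRep φ V (A (r + 1)) (r + 1 + j) a' → IsRep φ V (A (r + 1)) (r + 1) a' from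
    hlow N (ha'.raise (by omega))
  intro j
  induction j with
  | zero => exact id
  | succ j ihj =>
    intro hrep
    refine ihj (hrep.lower (fun γ hγ z hz => ?_) (by omega))
    rcases (Nat.succ_le_iff.2 hγ).lt_or_eq with hγ | hγ
    · exact hrep.order γ hγ z hz
    refine coeff_eq_zero_of_sum_mon (s := idxEq n (r + 1 + j + 1)) (a := fun γ => a' γ z)
      (fun t => ?_) (mem_idxEq.2 hγ.symm)
    have key := h1.leading_coeff hφ hV hVt h.side (m := r + 1 + j) (by omega)
      (fun p hp => (ha p hp).1) (ha r le_rfl).2 hrep has' hz (H := H φ z)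
      (fun k k' => by simp only [h3 k _ z hz]; exact h.inverse φ hφ z (hVt hz) k k') t
    -- The coefficients of `A_r` of length `r + 1 + j > r` vanish on `V`, so the recursion forces
    -- the top coefficients of `A_{r+1}` to vanish.
    have hz0 : ∀ l, ∑ γ ∈ idxEq n (r + 1 + j), wd (τ l) (a r γ) z * mon γ t = 0 := fun l =>
      Finset.sum_eq_zero fun γ hγ => by
        rw [(ha r le_rfl).1.wd_coeff_eq_zero hV (τ l) hz γ (by rw [mem_idxEq.1 hγ]; omega),
          zero_mul]
    simp only [hz0, mul_zero, Finset.sum_const_zero] at key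
    exact (mul_eq_zero.1 key).resolve_left (by exact_mod_cast (r + 1 + j).succ_ne_zero)

/-- Local data of a commuting pair up to degree `r`. -/
lemma locally (h : IsCommutingPair σ τ A A' G H κ) (r : ℕ) :
    LocallyInCharts M fun φ V => ∃ (a a' : ℕ → MultiIdx n → Cn n → ℂ) (u u' : Fin n → ℕ → Sm n M),
      NaturalUpTo τ A r φ V a ∧ NaturalUpTo τ A' r φ V a' ∧
      IsCommutant τ φ V A u ∧ IsCommutant τ φ V A' u' ∧
      (∀ k l, ∀ z ∈ V, wd (σ k) (loc φ (u l 0)) z = G φ z k l) ∧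
      (∀ k l, ∀ z ∈ V, wd (σ k) (loc φ (u' l 0)) z = G φ z k l) ∧
      (∀ k l, ∀ z ∈ V, wd (σ k) (loc φ (u l 1)) z - wd (σ k) (loc φ (u' l 1)) z = κ φ z k l) ∧
      ∀ p ≤ r, ∀ γ : MultiIdx n, p ≤ ∑ i, γ i → ∀ z ∈ V, a p γ z = a' p γ z := by
  intro φ hφ y hy
  obtain ⟨V, hV, hyV, hVt, ⟨⟨a, ha⟩, a', ha'⟩, u, u', h1, h2, h3, h4, h5⟩ :=
    (((locally_naturalUpTo r fun p _ => h.hasSidedOrder p).and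
      (locally_naturalUpTo r fun p _ => h.symm.hasSidedOrder p)
      (fun _ _ _ hV ⟨a, ha⟩ => ⟨a, ha.mono hV⟩) (fun _ _ _ hV ⟨a, ha⟩ => ⟨a, ha.mono hV⟩)).and
      h.commutant
      (fun _ _ _ hV ⟨⟨a, ha⟩, a', ha'⟩ => ⟨⟨a, ha.mono hV⟩, a', ha'.mono hV⟩)
      (fun _ _ _ hV ⟨u, u', h1, h2, h3, h4, h5⟩ => ⟨u, u', h1.mono hV, h2.mono hV,
        fun k l z hz => h3 k l z (hV hz), fun k l z hz => h4 k l z (hV hz),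
        fun k l z hz => h5 k l z (hV hz)⟩)) φ hφ y hy
  refine ⟨V, hV, hyV, hVt, a, a', u, u', ha, ha', h1, h2, h3, h4, h5, fun p => ?_⟩
  induction p with
  | zero =>
    intro _ γ _ z hz
    have hsub := (ha 0 (by omega)).1.sub (ha' 0 (by omega)).1
    rcases Nat.eq_zero_or_pos (∑ i, γ i) with hγ | hγ
    · refine sub_eq_zero.1 (coeff_eq_zero_of_sum_mon (s := idxEq n 0)
        (a := fun γ => (a 0 γ - a' 0 γ) z) (fun t => ?_) (mem_idxEq.2 hγ))
      -- With exponent zero the test function is the constant `1`, on which `A_0` and `A'_0` agree.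
      have h0 := hsub.pow_eq hφ hV hVt hz (m := 0) (v := 0) (fun γ hγ => hsub.order γ hγ z hz) rfl
      rw [LinearMap.sub_apply, h.zero_eq, loc_sub, Pi.sub_apply, sub_self, Nat.factorial_zero,
        Nat.cast_one, one_mul] at h0
      refine Eq.trans (Finset.sum_congr rfl fun γ hγ => ?_) h0.symm
      have hγ0 : ∀ i, γ i = 0 := by simpa using mem_idxEq.1 hγ
      simp [mon, hγ0]
    · exact sub_eq_zero.1 (hsub.order γ hγ z hz)
  | succ p ih =>
    intro hp γ hγ z hz
    exact h1.sub_order hφ hV hVt h.side h2 (r := p) (fun q hq => (ha q (by omega)).1)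
      (fun q hq => (ha' q (by omega)).1) (fun q hq => (ha q (by omega)).2)
      (fun q hq => (ha' q (by omega)).2) (fun γ hγ => ih (by omega) γ hγ)
      (fun k l z hz => by rw [h3 k l z hz, h4 k l z hz]) hz (H := H φ z)
      (fun k k' => by simp only [h3 k _ z hz]; exact h.inverse φ hφ z (hVt hz) k k') γ hγ

lemma hasSidedOrder_sub (h : IsCommutingPair σ τ A A' G H κ) (r : ℕ) :
    HasSidedOrder τ (A (r + 1) - A' (r + 1)) r := by
  intro φ hφ y hy
  obtain ⟨V, hV, hyV, hVt, a, a', u, u', ha, ha', -, -, -, -, -, h6⟩ := h.locally (r + 1) φ hφ y hy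
  refine ⟨V, hV, hyV, hVt, fun γ => a (r + 1) γ - a' (r + 1) γ,
    ((ha _ le_rfl).1.sub (ha' _ le_rfl).1).lower (fun γ hγ z hz => ?_) (by omega),
    (ha _ le_rfl).2.sub (ha' _ le_rfl).2⟩
  exact sub_eq_zero.2 (h6 _ le_rfl γ hγ z hz)

variable [T2Space M] [IsManifold 𝓘(ℂ, Cn n) ω M]

omit [ChartedSpace (Cn n) M] [T2Space M] [IsManifold 𝓘(ℂ, Cn n) ω M] [TopologicalSpace M] in
lemma wd_sum_mul_mon {V : Set (Cn n)} (hV : IsOpen V) {a : MultiIdx n → Cn n → ℂ}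
    (ha : ∀ γ, ContDiffOn ℝ ∞ (a γ) V) {y : Cn n} (hy : y ∈ V) {F : Cn n → ℂ}
    {s : Finset (MultiIdx n)} {t : Fin n ⊕ Fin n → ℂ}
    (hF : ∀ z ∈ V, F z = ∑ γ ∈ s, a γ z * mon γ t) (i : Fin n ⊕ Fin n) :
    wd i F y = ∑ γ ∈ s, wd i (a γ) y * mon γ t := by
  rw [wd_congr_of_eqOn i hV hF hy, wd_sum i _ fun γ _ => ((ha γ).diffAt hV hy).mul_const _]
  refine Finset.sum_congr rfl fun γ _ => ?_
  simp only [mul_comm _ (mon γ t)]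
  rw [wd_const_mul i _ ((ha γ).diffAt hV hy)]

lemma symb_eq (h : IsCommutingPair σ τ A A' G H κ) (r : ℕ) : symb (A r) r = symb (A' r) r := by
  funext x ξ
  have hφ : IsHolChart (chartAt (Cn n) x) := isHolChart_chartAt x
  have hx := mem_chart_source (Cn n) x
  obtain ⟨ζ, hζ⟩ := exists_cotLoc hφ hx ξ
  obtain ⟨V, hV, hyV, hVt, a, a', u, u', ha, ha', -, -, -, -, -, h6⟩ :=
    h.locally r _ hφ _ (OpenPartialHomeomorph.map_source _ hx)
  rw [hζ (symb (A r) r), hζ (symb (A' r) r), cotLoc_symb hφ hV hVt (ha r le_rfl).1 hyV,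
    cotLoc_symb hφ hV hVt (ha' r le_rfl).1 hyV]
  exact Finset.sum_congr rfl fun γ hγ => by rw [h6 r le_rfl γ (mem_idxEq.1 hγ).ge _ hyV]

/-- The recursion for the homogeneous components of `exp(∑ ζ_k H_{lk} ∂_{τ l})`; since it involves
neither the `u_{l,q}`, `q ≥ 1`, nor `κ`, the two families have the same symbol. -/
lemma cotLoc_symb_succ (h : IsCommutingPair σ τ A A' G H κ) (r : ℕ)
    {φ : OpenPartialHomeomorph M (Cn n)} (hφ : IsHolChart φ) {y : Cn n} (hy : y ∈ φ.target)
    (ζ : Cn n) :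
    (r + 1 : ℂ) * cotLoc φ (symb (A (r + 1)) (r + 1)) y ζ =
      ∑ l, (∑ k, fibCoord ζ (σ k) * H φ y l k) *
        wd (τ l) (fun z => cotLoc φ (symb (A r) r) z ζ) y := by
  obtain ⟨V, hV, hyV, hVt, a, a', u, u', ha, ha', h1, h2, h3, h4, h5, h6⟩ :=
    h.locally (r + 1) φ hφ y hy
  have key := h1.leading_coeff hφ hV hVt h.side (m := r) le_rfl
      (fun p hp => (ha p (by omega)).1) (ha r (by omega)).2 (ha (r + 1) le_rfl).1
      (ha (r + 1) le_rfl).2 hyV (H := H φ y)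
      (fun k k' => by simp only [h3 k _ y hyV]; exact h.inverse φ hφ y hy k k') (fibCoord ζ)
  rw [cotLoc_symb hφ hV hVt (ha (r + 1) le_rfl).1 hyV, key]
  refine Finset.sum_congr rfl fun l _ => ?_
  rw [wd_sum_mul_mon hV (ha r (by omega)).1.smooth hyV
    (fun z hz => cotLoc_symb hφ hV hVt (ha r (by omega)).1 hz ζ)]

/-- The `ε` part of the same exponential recursion: after regrouping, the last sum has the matrix
`HκH = -H'`. Dividing the difference by `ν` shifts the index, so the component of degree `r` comes
from the operators of index `r + 1`. -/
lemma cotLoc_symb_sub_succ (h : IsCommutingPair σ τ A A' G H κ) (r : ℕ)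
    {φ : OpenPartialHomeomorph M (Cn n)} (hφ : IsHolChart φ) {y : Cn n} (hy : y ∈ φ.target)
    (ζ : Cn n) :
    (r + 1 : ℂ) * cotLoc φ (symb (A (r + 2) - A' (r + 2)) (r + 1)) y ζ =
      ∑ l, (∑ k, fibCoord ζ (σ k) * H φ y l k) *
        (wd (τ l) (fun z => cotLoc φ (symb (A (r + 1) - A' (r + 1)) r) z ζ) y -
          ∑ q, (∑ k, κ φ y k l * H φ y q k) *
            wd (τ q) (fun z => cotLoc φ (symb (A r) r) z ζ) y) := by
  obtain ⟨V, hV, hyV, hVt, a, a', u, u', ha, ha', h1, h2, h3, h4, h5, h6⟩ :=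
    h.locally (r + 2) φ hφ y hy
  have hsub : ∀ p ≤ r + 1, IsRep φ V (A (p + 1) - A' (p + 1)) p
      (fun γ => a (p + 1) γ - a' (p + 1) γ) := fun p hp =>
    ((ha _ (by omega)).1.sub (ha' _ (by omega)).1).lower
      (fun γ hγ z hz => sub_eq_zero.2 (h6 _ (by omega) γ hγ z hz)) (by omega)
  have key := h1.sub_leading_coeff hφ hV hVt h.side h2 (m := r)
      (fun p hp => (ha p hp).1) (fun p hp => (ha' p hp).1) (fun p hp => (ha p hp).2)
      (fun p hp => (ha' p hp).2) (h6 (r + 1) (by omega)) (h6 (r + 2) le_rfl)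
      (fun k l z hz => by rw [h3 k l z hz, h4 k l z hz]) hyV (H := H φ y)
      (fun k k' => by simp only [h3 k _ y hyV]; exact h.inverse φ hφ y hy k k')
      (fun k l => h5 k l y hyV) (fibCoord ζ)
  rw [cotLoc_symb hφ hV hVt (hsub (r + 1) le_rfl) hyV, key]
  refine Finset.sum_congr rfl fun l _ => ?_
  rw [wd_sum_mul_mon hV (hsub r (by omega)).smooth hyV
    (fun z hz => cotLoc_symb hφ hV hVt (hsub r (by omega)) hz ζ)]
  congr 2
  refine Finset.sum_congr rfl fun q _ => ?_
  rw [h.symb_eq, wd_sum_mul_mon hV (ha' r (by omega)).1.smooth hyV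
    (fun z hz => cotLoc_symb hφ hV hVt (ha' r (by omega)).1 hz ζ)]

end IsCommutingPair

end pairs

/-! ### Exponential sequences in an algebra with derivations -/

section expSeq

variable {ι R : Type*} [Fintype ι] [DecidableEq ι] [CommRing R] [Algebra ℂ R]

/-- Commuting derivations `x_k, y_l` in the base directions and `p_k, q_l` in the dual fibre
directions, with fibre coordinates `ζ_k` dual to `x_k`, and a closed invertible matrix `G_{kl}` with
inverse `H_{lk}`. -/
structure IsPhaseSpace (x y p q : ι → Derivation ℂ R R) (ζ : ι → R) (G H : Matrix ι ι R) :
    Prop where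
  xy : ∀ i j a, x i (y j a) = y j (x i a)
  yy : ∀ i j a, y i (y j a) = y j (y i a)
  px : ∀ i j a, p i (x j a) = x j (p i a)
  py : ∀ i j a, p i (y j a) = y j (p i a)
  qx : ∀ i j a, q i (x j a) = x j (q i a)
  qy : ∀ i j a, q i (y j a) = y j (q i a)
  pp : ∀ i j a, p i (p j a) = p j (p i a)
  qp : ∀ i j a, q i (p j a) = p j (q i a)
  yζ : ∀ i j, y i (ζ j) = 0
  xζ : ∀ i j, x i (ζ j) = 0
  pζ : ∀ i j, p i (ζ j) = if i = j then 1 else 0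
  qζ : ∀ i j, q i (ζ j) = 0
  pG : ∀ i k l, p i (G k l) = 0
  pH : ∀ i k l, p i (H k l) = 0
  qH : ∀ i k l, q i (H k l) = 0
  GH : G * H = 1
  closed_x : ∀ j k l, x j (G k l) = x k (G j l)
  closed_y : ∀ j k l, y j (G k l) = y l (G k j)

/-- The sequence of coefficients of `exp (∑ ζ_k H_{lk} y_l) F_0`, where `F_0` is constant along the
fibres. -/
structure IsExpSeq (y p q : ι → Derivation ℂ R R) (ζ : ι → R) (H : Matrix ι ι R) (F : ℕ → R) :
    Prop where
  p_zero : ∀ k, p k (F 0) = 0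
  q_zero : ∀ k, q k (F 0) = 0
  succ : ∀ r : ℕ, ((r : ℂ) + 1) • F (r + 1) = ∑ k, ζ k * ∑ l, H l k * y l (F r)

variable {x y p q : ι → Derivation ℂ R R} {ζ : ι → R} {G H : Matrix ι ι R}

/-- Apply `D` to `GH = 1` and multiply by `H` from the left. -/
lemma derivation_inverse (D : Derivation ℂ R R) (h : G * H = 1) (l k : ι) :
    D (H l k) = -∑ b, (∑ a, H l a * D (G a b)) * H b k := by
  have h' : H * G = 1 := mul_eq_one_comm.1 h
  have e : ∀ A B : Matrix ι ι R, (A * B).map D = A.map D * B + A * B.map D := by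
    intro A B
    ext i j
    simp only [Matrix.map_apply, Matrix.mul_apply, Matrix.add_apply, map_sum, Derivation.leibniz,
      smul_eq_mul, ← Finset.sum_add_distrib]
    exact Finset.sum_congr rfl fun _ _ => by ring
  have e1 : (1 : Matrix ι ι R).map D = 0 := by
    ext i j
    rw [Matrix.map_apply, Matrix.one_apply]
    split_ifs <;> simp
  have e2 := e G H
  rw [h, e1] at e2
  have e3 : H.map D = -(H * G.map D * H) := by
    calc H.map D = H * (G.map D * H + G * H.map D) - H * G.map D * H := by
          rw [mul_add, ← mul_assoc H G, h', one_mul, ← mul_assoc, add_sub_cancel_left]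
      _ = -(H * G.map D * H) := by rw [← e2, mul_zero, zero_sub]
  have e4 := congrFun (congrFun e3 l) k
  rw [Matrix.map_apply, Matrix.neg_apply, Matrix.mul_apply] at e4
  rw [e4]
  simp only [Matrix.mul_apply, Matrix.map_apply]

/-- The Jacobi identity for the inverse of a closed matrix. -/
lemma jacobi_of_closed (hGH : G * H = 1) (hy : ∀ j k l, y j (G k l) = y l (G k j)) (k m i : ι) :
    ∑ l, H l k * y l (H i m) = ∑ l, H l m * y l (H i k) := by
  simp only [derivation_inverse _ hGH, mul_neg, Finset.sum_neg_distrib, Finset.mul_sum,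
    Finset.sum_mul]
  congr 1
  rw [Finset.sum_comm]
  refine Finset.sum_congr rfl fun l _ => Finset.sum_congr rfl fun b _ =>
    Finset.sum_congr rfl fun a _ => ?_
  -- After interchanging `l` and `b`, the two sides differ by the closedness of `G` in these
  -- indices.
  rw [hy b a l]
  ring

omit [DecidableEq ι] [Algebra ℂ R] in
lemma sum_antidiagonal_shift_left {f : ℕ × ℕ → R} (hf : ∀ b, f (0, b) = 0) (m : ℕ) :
    ∑ a ∈ Finset.HasAntidiagonal.antidiagonal m, f (a.1 + 1, a.2) =
      ∑ a ∈ Finset.HasAntidiagonal.antidiagonal (m + 1), f a := by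
  rw [Finset.Nat.sum_antidiagonal_succ, hf, zero_add]

omit [DecidableEq ι] [Algebra ℂ R] in
lemma sum_antidiagonal_shift_right {f : ℕ × ℕ → R} (hf : ∀ a, f (a, 0) = 0) (m : ℕ) :
    ∑ a ∈ Finset.HasAntidiagonal.antidiagonal m, f (a.1, a.2 + 1) =
      ∑ a ∈ Finset.HasAntidiagonal.antidiagonal (m + 1), f a := by
  rw [Finset.Nat.sum_antidiagonal_succ', hf, zero_add]

lemma smul_succ_cancel {r : ℕ} {a b : R} (h : ((r : ℂ) + 1) • a = ((r : ℂ) + 1) • b) : a = b := by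
  have h0 : (r : ℂ) + 1 ≠ 0 := by exact_mod_cast r.succ_ne_zero
  have := congrArg (fun c => ((r : ℂ) + 1)⁻¹ • c) h
  simpa only [smul_smul, inv_mul_cancel₀ h0, one_smul] using this

-- The recursion determines a sequence from its term of degree zero, because `r + 1` is invertible.
-- Multiplicativity and the Poisson property thereby reduce to the zero section.
omit [DecidableEq ι] in
lemma IsExpSeq.ext {F F' : ℕ → R} (hF : IsExpSeq y p q ζ H F) (hF' : IsExpSeq y p q ζ H F')
    (h : F 0 = F' 0) (r : ℕ) : F r = F' r := by
  induction r with
  | zero => exact h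
  | succ r ih =>
    refine smul_succ_cancel (r := r) ?_
    rw [hF.succ, hF'.succ, ih]

-- Both sides of the recursion are derivations: multiplication by the degree and the field `∑ ζ_k
-- H_{lk} y_l`.
omit [DecidableEq ι] in
lemma IsExpSeq.mul {F F' : ℕ → R} (hF : IsExpSeq y p q ζ H F) (hF' : IsExpSeq y p q ζ H F') :
    IsExpSeq y p q ζ H
      (fun r => ∑ a ∈ Finset.HasAntidiagonal.antidiagonal r, F a.1 * F' a.2) where
  p_zero k := by simp [hF.p_zero, hF'.p_zero]
  q_zero k := by simp [hF.q_zero, hF'.q_zero]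
  succ (r : ℕ) := by
    -- Here `r + 1` is the sum of the two degrees. A term weighted by its own degree vanishes in
    -- degree zero, which allows the index shifts that follow.
    have h1 : ((r : ℂ) + 1) • ∑ a ∈ Finset.HasAntidiagonal.antidiagonal (r + 1), F a.1 * F' a.2 =
        ∑ a ∈ Finset.HasAntidiagonal.antidiagonal (r + 1), ((a.1 : ℂ) • F a.1) * F' a.2 +
        ∑ a ∈ Finset.HasAntidiagonal.antidiagonal (r + 1), F a.1 * ((a.2 : ℂ) • F' a.2) := by
      rw [Finset.smul_sum, ← Finset.sum_add_distrib]
      refine Finset.sum_congr rfl fun a ha => ?_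
      rw [Finset.HasAntidiagonal.mem_antidiagonal] at ha
      rw [smul_mul_assoc, mul_smul_comm, ← add_smul]
      congr 1
      exact_mod_cast ha.symm
    rw [h1, ← sum_antidiagonal_shift_left (f := fun a => ((a.1 : ℂ) • F a.1) * F' a.2) (by simp),
      ← sum_antidiagonal_shift_right (f := fun a => F a.1 * ((a.2 : ℂ) • F' a.2)) (by simp),
      ← Finset.sum_add_distrib]
    simp only [Nat.cast_add, Nat.cast_one, hF.succ, hF'.succ, map_sum, Derivation.leibniz,
      smul_eq_mul, Finset.mul_sum, Finset.sum_mul, ← Finset.sum_add_distrib]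
    rw [Finset.sum_comm]
    refine Finset.sum_congr rfl fun k _ => ?_
    rw [Finset.sum_comm]
    refine Finset.sum_congr rfl fun l _ => Finset.sum_congr rfl fun a _ => ?_
    ring

namespace IsPhaseSpace

variable (hR : IsPhaseSpace x y p q ζ G H) {F F' : ℕ → R}
include hR

/-- The fields `∑ H_{lk} y_l` commute. -/
lemma field_comm (k m : ι) (a : R) :
    ∑ l, H l k * y l (∑ i, H i m * y i a) = ∑ l, H l m * y l (∑ i, H i k * y i a) := by
  have e : ∀ k m, ∑ l, H l k * y l (∑ i, H i m * y i a) =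
      ∑ i, (∑ l, H l k * y l (H i m)) * y i a + ∑ l, ∑ i, H l k * H i m * y l (y i a) := by
    intro k m
    simp only [map_sum, Derivation.leibniz, smul_eq_mul, Finset.mul_sum, Finset.sum_mul, mul_add,
      Finset.sum_add_distrib]
    rw [add_comm]
    congr 1
    · rw [Finset.sum_comm]
      exact Finset.sum_congr rfl fun _ _ => Finset.sum_congr rfl fun _ _ => by ring
    · exact Finset.sum_congr rfl fun _ _ => Finset.sum_congr rfl fun _ _ => by ring
  rw [e, e]
  congr 1
  · exact Finset.sum_congr rfl fun i _ => by rw [jacobi_of_closed hR.GH hR.closed_y]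
  · rw [Finset.sum_comm]
    exact Finset.sum_congr rfl fun _ _ => Finset.sum_congr rfl fun _ _ => by
      rw [hR.yy]
      ring

/-- The field in the recursion involves only the coordinates `ζ` dual to `x`, and nothing in it
depends on the fibre variables of `q`. -/
lemma q_eq_zero (hF : IsExpSeq y p q ζ H F) (i : ι) (r : ℕ) : q i (F r) = 0 := by
  induction r with
  | zero => exact hF.q_zero i
  | succ r ih =>
    refine smul_succ_cancel (r := r) ?_
    rw [← Derivation.map_smul, hF.succ]
    simp [hR.qζ, hR.qH, hR.qy, ih]

lemma p_field (i k : ι) (a : R) :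
    p i (∑ l, H l k * y l a) = ∑ l, H l k * y l (p i a) := by
  simp [hR.pH, hR.py]

/-- As the fields `X_k = ∑ H_{lk} y_l` commute and do not involve `ζ`, differentiating `exp(∑ ζ_k
X_k)` in `ζ_i` amounts to applying `X_i`. -/
lemma p_succ (hF : IsExpSeq y p q ζ H F) (i : ι) (r : ℕ) :
    p i (F (r + 1)) = ∑ l, H l i * y l (F r) := by
  induction r with
  | zero =>
    refine smul_succ_cancel (r := 0) ?_
    rw [← Derivation.map_smul, hF.succ, map_sum]
    simp only [Derivation.leibniz, hR.p_field, hF.p_zero, hR.pζ, smul_eq_mul]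
    simp
  | succ r ih =>
    refine smul_succ_cancel (r := r + 1) ?_
    rw [← Derivation.map_smul, hF.succ, map_sum]
    simp only [Derivation.leibniz, hR.p_field, ih, hR.pζ, smul_eq_mul]
    have e : ∀ k, ∑ l, H l k * y l (∑ m, H m i * y m (F r)) =
        ∑ l, H l i * y l (∑ m, H m k * y m (F r)) := fun k => hR.field_comm k i (F r)
    simp only [e]
    have e2 : ∑ k, ζ k * ∑ l, H l i * y l (∑ m, H m k * y m (F r)) =
        ∑ l, H l i * y l (((r : ℂ) + 1) • F (r + 1)) := by
      rw [hF.succ]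
      simp only [map_sum, Derivation.leibniz, smul_eq_mul, hR.yζ, mul_zero, add_zero,
        Finset.mul_sum]
      rw [Finset.sum_comm]
      refine Finset.sum_congr rfl fun l _ => Finset.sum_congr rfl fun k _ => ?_
      simp only [Finset.sum_add_distrib, mul_add]
      congr 1 <;> exact Finset.sum_congr rfl fun _ _ => by ring
    rw [Finset.sum_add_distrib, e2]
    simp only [mul_ite, mul_one, mul_zero, Finset.sum_ite_eq, Finset.mem_univ, if_true,
      Derivation.map_smul,
      mul_smul_comm, ← Finset.smul_sum]
    push_cast
    module

/-- The previous identity multiplied by `G`. This form is linear in the derivations with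
coefficients free of `ζ`, which makes it suitable for the Leibniz rule in brackets. -/
lemma y_eq (hF : IsExpSeq y p q ζ H F) (l : ι) (r : ℕ) :
    y l (F r) = ∑ k, G k l * p k (F (r + 1)) := by
  have hHG : H * G = 1 := mul_eq_one_comm.1 hR.GH
  simp only [hR.p_succ hF, Finset.mul_sum]
  rw [Finset.sum_comm]
  have e : ∀ m, ∑ k, G k l * (H m k * y m (F r)) = (H * G) m l * y m (F r) := by
    intro m
    rw [Matrix.mul_apply, Finset.sum_mul]
    exact Finset.sum_congr rfl fun _ _ => by ring
  simp only [e, hHG, Matrix.one_apply]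
  simp

lemma euler (hF : IsExpSeq y p q ζ H F) (r : ℕ) : ∑ k, ζ k * p k (F r) = (r : ℂ) • F r := by
  rcases r with _ | r
  · simp [hF.p_zero]
  · simp only [hR.p_succ hF]
    rw [← hF.succ]
    push_cast
    rfl

/-- The Poisson bracket of two exponential sequences. -/
lemma bracket_expSeq (hF : IsExpSeq y p q ζ H F) (hF' : IsExpSeq y p q ζ H F') :
    IsExpSeq y p q ζ H (fun r => ∑ a ∈ Finset.HasAntidiagonal.antidiagonal (r + 1),
      ∑ k, (p k (F a.1) * x k (F' a.2) - x k (F a.1) * p k (F' a.2))) := by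
  set K : ℕ → R := fun r => ∑ a ∈ Finset.HasAntidiagonal.antidiagonal (r + 1),
      ∑ k, (p k (F a.1) * x k (F' a.2) - x k (F a.1) * p k (F' a.2)) with hK
  have hK0 : K 0 = ∑ k, (p k (F 1) * x k (F' 0) - x k (F 0) * p k (F' 1)) := by
    simp only [hK]
    rw [Finset.Nat.sum_antidiagonal_succ]
    simp only [zero_add, Finset.Nat.antidiagonal_zero, Finset.sum_singleton, hF.p_zero,
      hF'.p_zero, zero_mul, mul_zero, sub_zero, zero_sub]
    rw [← Finset.sum_add_distrib]
    exact Finset.sum_congr rfl fun _ _ => by ring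
  -- The equations of `y_eq` pass to the bracket: differentiate each factor and substitute. The
  -- terms in which `x_j` hits `G_{kl}` cancel by closedness in the `x` directions, and the others
  -- assemble to `p_k` of the next component.
  have hyK : ∀ l r, y l (K r) = ∑ k, G k l * p k (K (r + 1)) := by
    intro l r
    have h1 : y l (K r) = ∑ a ∈ Finset.HasAntidiagonal.antidiagonal (r + 1),
        ∑ j, ∑ k, (G k l * p j (p k (F (a.1 + 1))) * x j (F' a.2) -
          (x j (G k l) * p k (F (a.1 + 1)) + G k l * x j (p k (F (a.1 + 1)))) * p j (F' a.2)) +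
        ∑ a ∈ Finset.HasAntidiagonal.antidiagonal (r + 1),
        ∑ j, ∑ k, (p j (F a.1) *
            (x j (G k l) * p k (F' (a.2 + 1)) + G k l * x j (p k (F' (a.2 + 1)))) -
          x j (F a.1) * (G k l * p j (p k (F' (a.2 + 1))))) := by
      rw [← Finset.sum_add_distrib, hK, map_sum]
      refine Finset.sum_congr rfl fun a _ => ?_
      rw [map_sum, ← Finset.sum_add_distrib]
      refine Finset.sum_congr rfl fun j _ => ?_
      rw [map_sub, Derivation.leibniz, Derivation.leibniz, ← hR.py, ← hR.py, ← hR.xy, ← hR.xy,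
        hR.y_eq hF, hR.y_eq hF']
      simp only [map_sum, Derivation.leibniz, smul_eq_mul, hR.pG, mul_zero, add_zero,
        Finset.mul_sum]
      simp only [← Finset.sum_add_distrib, ← Finset.sum_sub_distrib]
      exact Finset.sum_congr rfl fun _ _ => by ring
    rw [h1, sum_antidiagonal_shift_left (f := fun a => ∑ j, ∑ k,
          (G k l * p j (p k (F a.1)) * x j (F' a.2) -
          (x j (G k l) * p k (F a.1) + G k l * x j (p k (F a.1))) * p j (F' a.2)))
        (by simp [hF.p_zero]),
      sum_antidiagonal_shift_right (f := fun a => ∑ j, ∑ k, (p j (F a.1) *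
            (x j (G k l) * p k (F' a.2) + G k l * x j (p k (F' a.2))) -
          x j (F a.1) * (G k l * p j (p k (F' a.2))))) (by simp [hF'.p_zero]),
      ← Finset.sum_add_distrib]
    simp only [hK, map_sum, Finset.mul_sum]
    rw [Finset.sum_comm (s := Finset.univ)]
    refine Finset.sum_congr rfl fun a _ => ?_
    have h2 : ∑ j, ∑ k, x j (G k l) * (p k (F a.1) * p j (F' a.2)) =
        ∑ j, ∑ k, x j (G k l) * (p j (F a.1) * p k (F' a.2)) := by
      rw [Finset.sum_comm]
      exact Finset.sum_congr rfl fun j _ => Finset.sum_congr rfl fun k _ => by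
        rw [hR.closed_x]
    rw [Finset.sum_comm (s := Finset.univ) (t := Finset.univ)
      (f := fun k j => G k l * p k (p j (F a.1) * x j (F' a.2) - x j (F a.1) * p j (F' a.2)))]
    simp only [← Finset.sum_add_distrib]
    rw [← sub_eq_zero, ← sub_eq_zero.2 h2.symm]
    simp only [← Finset.sum_sub_distrib]
    refine Finset.sum_congr rfl fun j _ => Finset.sum_congr rfl fun k _ => ?_
    simp only [map_sub, Derivation.leibniz, smul_eq_mul, hR.px, hR.pp k j]
    ring
  have hpK : ∀ i r, p i (K (r + 1)) = ∑ l, H l i * y l (K r) := by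
    intro i r
    simp only [hyK, Finset.mul_sum]
    rw [Finset.sum_comm]
    have e : ∀ k, ∑ l, H l i * (G k l * p k (K (r + 1))) = (G * H) k i * p k (K (r + 1)) := by
      intro k
      rw [Matrix.mul_apply, Finset.sum_mul]
      exact Finset.sum_congr rfl fun _ _ => by ring
    simp only [e, hR.GH, Matrix.one_apply]
    simp
  -- Homogeneity: `p` lowers the fibre degree by one and `x` preserves it, so the terms with total
  -- index `r + 1` have degree `r`. Euler's identity combined with `hpK` is the exponential
  -- recursion.
  have hE : ∀ r, ∑ i, ζ i * p i (K r) = (r : ℂ) • K r := by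
    intro r
    have hEp : ∀ {F : ℕ → R}, IsExpSeq y p q ζ H F → ∀ a k,
        ∑ i, ζ i * p i (p k (F a)) = (a : ℂ) • p k (F a) - p k (F a) := by
      intro F hF a k
      rw [← Derivation.map_smul, ← hR.euler hF, map_sum]
      simp only [Derivation.leibniz, smul_eq_mul, hR.pζ, Finset.sum_add_distrib]
      simp [hR.pp k]
    have hEx : ∀ {F : ℕ → R}, IsExpSeq y p q ζ H F → ∀ a k,
        ∑ i, ζ i * p i (x k (F a)) = (a : ℂ) • x k (F a) := by
      intro F hF a k
      rw [← Derivation.map_smul, ← hR.euler hF, map_sum]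
      simp [hR.px, hR.xζ]
    have hEm : ∀ a b : R, ∑ i, ζ i * p i (a * b) =
        a * ∑ i, ζ i * p i b + b * ∑ i, ζ i * p i a := by
      intro a b
      simp only [Derivation.leibniz, smul_eq_mul, Finset.mul_sum, ← Finset.sum_add_distrib]
      exact Finset.sum_congr rfl fun _ _ => by ring
    have h1 : ∑ i, ζ i * p i (K r) = ∑ a ∈ Finset.HasAntidiagonal.antidiagonal (r + 1),
        ∑ k, (∑ i, ζ i * p i (p k (F a.1) * x k (F' a.2)) -
          ∑ i, ζ i * p i (x k (F a.1) * p k (F' a.2))) := by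
      simp only [hK, map_sum, map_sub, Finset.mul_sum, mul_sub, ← Finset.sum_sub_distrib]
      rw [Finset.sum_comm]
      exact Finset.sum_congr rfl fun a _ => Finset.sum_comm
    rw [h1, hK, Finset.smul_sum]
    refine Finset.sum_congr rfl fun a ha => ?_
    rw [Finset.smul_sum]
    refine Finset.sum_congr rfl fun k _ => ?_
    rw [hEm, hEm, hEp hF, hEp hF', hEx hF, hEx hF']
    rw [Finset.HasAntidiagonal.mem_antidiagonal] at ha
    have hr : (r : ℂ) = (a.1 : ℂ) + a.2 - 1 := by
      rw [← Nat.cast_add, ha]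
      push_cast
      ring
    rw [hr]
    simp only [Algebra.smul_def, map_sub, map_add, map_one]
    ring
  refine ⟨fun i => ?_, fun i => ?_, fun r => ?_⟩
  · rw [hK0]
    simp only [map_sum, map_sub, Derivation.leibniz, smul_eq_mul, hR.px, hF.p_zero, hF'.p_zero,
      map_zero, mul_zero, zero_add, add_zero, hR.p_succ hF, hR.p_succ hF', hR.pH, hR.py]
    simp
  · rw [hK0]
    simp [hR.qx, hR.qp, hR.q_eq_zero hF, hR.q_eq_zero hF']
  · rw [← Nat.cast_succ, ← hE]
    simp only [hpK]

/-- On the zero section `p_k F_0` vanishes and `p_k F_1 = ∑ H_{lk} y_l F_0`, so the phase space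
bracket restricts to the bracket of the tensor `H` on the base. -/
lemma bracket_zero (hF : IsExpSeq y p q ζ H F) (hF' : IsExpSeq y p q ζ H F') :
    ∑ a ∈ Finset.HasAntidiagonal.antidiagonal (0 + 1),
      ∑ k, (p k (F a.1) * x k (F' a.2) - x k (F a.1) * p k (F' a.2)) =
    ∑ l, ∑ k, H l k * (y l (F 0) * x k (F' 0) - y l (F' 0) * x k (F 0)) := by
  rw [Finset.Nat.sum_antidiagonal_succ]
  simp only [zero_add, Finset.Nat.antidiagonal_zero, Finset.sum_singleton, hF.p_zero,
    hF'.p_zero, zero_mul, mul_zero, sub_zero, zero_sub]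
  rw [← Finset.sum_add_distrib, Finset.sum_comm]
  refine Finset.sum_congr rfl fun k _ => ?_
  have e1 := hR.p_succ hF k 0
  have e2 := hR.p_succ hF' k 0
  rw [zero_add] at e1 e2
  rw [e1, e2, Finset.sum_mul, Finset.mul_sum, ← Finset.sum_neg_distrib, ← Finset.sum_add_distrib]
  exact Finset.sum_congr rfl fun _ _ => by ring

/-- Exponential sequences for the two polarizations Poisson commute. -/
lemma bracket_eq_zero {ζ' : ι → R} (hR' : IsPhaseSpace y x q p ζ' G.transpose H.transpose)
    (hF : IsExpSeq y p q ζ H F) (hF' : IsExpSeq x q p ζ' H.transpose F') (r : ℕ) :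
    ∑ a ∈ Finset.HasAntidiagonal.antidiagonal (r + 1),
      ∑ k, (p k (F a.1) * x k (F' a.2) - x k (F a.1) * p k (F' a.2) +
        (q k (F a.1) * y k (F' a.2) - y k (F a.1) * q k (F' a.2))) = 0 := by
  -- Each series is independent of the fibre variables of the other. Replacing base derivatives by
  -- fibre derivatives yields the same expression `p_k F G_{kl} q_l F'` twice, with opposite signs
  -- and with the shift by one in different factors; the sums over all degrees cancel.
  have h1 : ∀ a : ℕ × ℕ, ∑ k, (p k (F a.1) * x k (F' a.2) - x k (F a.1) * p k (F' a.2) +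
        (q k (F a.1) * y k (F' a.2) - y k (F a.1) * q k (F' a.2))) =
      ∑ k, ∑ l, p k (F a.1) * G k l * q l (F' (a.2 + 1)) -
      ∑ k, ∑ l, p k (F (a.1 + 1)) * G k l * q l (F' a.2) := by
    intro a
    simp only [hR.q_eq_zero hF, hR'.q_eq_zero hF', hR.y_eq hF, hR'.y_eq hF', mul_zero, zero_mul,
      sub_zero, zero_sub, Finset.mul_sum, Finset.sum_mul, Matrix.transpose_apply,
      ← sub_eq_add_neg, Finset.sum_sub_distrib]
    congr 1
    · exact Finset.sum_congr rfl fun _ _ => Finset.sum_congr rfl fun _ _ => by ring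
    · rw [Finset.sum_comm]
      exact Finset.sum_congr rfl fun _ _ => Finset.sum_congr rfl fun _ _ => by ring
  simp only [h1]
  rw [Finset.sum_sub_distrib,
    sum_antidiagonal_shift_right (f := fun a => ∑ k, ∑ l, p k (F a.1) * G k l * q l (F' a.2))
      (by simp [hF'.p_zero]),
    sum_antidiagonal_shift_left (f := fun a => ∑ k, ∑ l, p k (F a.1) * G k l * q l (F' a.2))
      (by simp [hF.p_zero]), sub_self]

end IsPhaseSpace

end expSeq

/-! ### Smooth functions on an open set and dual numbers over them -/

section smooth

variable {E : Type*} [NormedAddCommGroup E] [NormedSpace ℝ E]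

/-- The algebra of smooth complex-valued functions on an open set. -/
def SmoothFun (U : TopologicalSpace.Opens E) : Subalgebra ℂ (U → ℂ) where
  carrier := {f | ∃ F : E → ℂ, ContDiffOn ℝ ∞ F U ∧ ∀ w : U, f w = F w}
  mul_mem' := by
    rintro f g ⟨F, hF, hfF⟩ ⟨G, hG, hgG⟩
    exact ⟨_, hF.mul hG, fun w => by rw [Pi.mul_apply, hfF, hgG]⟩
  add_mem' := by
    rintro f g ⟨F, hF, hfF⟩ ⟨G, hG, hgG⟩
    exact ⟨_, hF.add hG, fun w => by rw [Pi.add_apply, hfF, hgG]⟩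
  algebraMap_mem' := fun c => ⟨fun _ => c, contDiffOn_const, fun _ => rfl⟩

variable {U : TopologicalSpace.Opens E}

/-- The restriction of a function to an open set on which it is smooth. -/
def SmoothFun.mk (F : E → ℂ) (hF : ContDiffOn ℝ ∞ F U) : SmoothFun U :=
  ⟨fun w => F w, F, hF, fun _ => rfl⟩

lemma SmoothFun.exists_mk (f : SmoothFun U) : ∃ F hF, f = SmoothFun.mk F hF := by
  obtain ⟨F, hF, h⟩ := f.2
  exact ⟨F, hF, Subtype.ext (funext h)⟩

lemma SmoothFun.mk_eq_mk {F G : E → ℂ} {hF : ContDiffOn ℝ ∞ F U} {hG : ContDiffOn ℝ ∞ G U} :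
    SmoothFun.mk F hF = SmoothFun.mk G hG ↔ Set.EqOn F G U :=
  ⟨fun h w hw => congrFun (congrArg Subtype.val h) ⟨w, hw⟩,
    fun h => Subtype.ext (funext fun w => h w.2)⟩

/-- The action of `wirt` on smooth functions. -/
def SmoothFun.derFun (s : ℂ) (a b : E) (f : SmoothFun U) : SmoothFun U :=
  SmoothFun.mk (wirt s a b f.2.choose) (f.2.choose_spec.1.wirt s a b U.2)

/-- The derivation is local and the set is open, so the chosen extension is immaterial. -/
lemma SmoothFun.derFun_mk (s : ℂ) (a b : E) (F : E → ℂ) (hF : ContDiffOn ℝ ∞ F U) :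
    SmoothFun.derFun s a b (SmoothFun.mk F hF) =
      SmoothFun.mk (wirt s a b F) (hF.wirt s a b U.2) :=
  SmoothFun.mk_eq_mk.2 (wirt_congr_of_eqOn s a b U.2 fun w hw =>
    ((SmoothFun.mk F hF).2.choose_spec.2 ⟨w, hw⟩).symm)

/-- The derivation of the algebra of smooth functions given by `wirt`. -/
def SmoothFun.der (U : TopologicalSpace.Opens E) (s : ℂ) (a b : E) :
    Derivation ℂ (SmoothFun U) (SmoothFun U) where
  toFun := SmoothFun.derFun s a b
  map_add' f g := by
    obtain ⟨F, hF, rfl⟩ := SmoothFun.exists_mk f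
    obtain ⟨G, hG, rfl⟩ := SmoothFun.exists_mk g
    change SmoothFun.derFun s a b (SmoothFun.mk (F + G) (hF.add hG)) = _
    rw [SmoothFun.derFun_mk, SmoothFun.derFun_mk, SmoothFun.derFun_mk]
    exact SmoothFun.mk_eq_mk (hG := (hF.wirt s a b U.2).add (hG.wirt s a b U.2)) |>.2
      fun w hw => wirt_add s a b (hF.diffAt U.2 hw) (hG.diffAt U.2 hw)
  map_smul' c f := by
    obtain ⟨F, hF, rfl⟩ := SmoothFun.exists_mk f
    change SmoothFun.derFun s a b (SmoothFun.mk (fun z => c * F z) (contDiffOn_const.mul hF)) = _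
    rw [SmoothFun.derFun_mk, SmoothFun.derFun_mk]
    exact SmoothFun.mk_eq_mk (hG := contDiffOn_const.mul (hF.wirt s a b U.2)) |>.2
      fun w hw => wirt_const_mul s a b c (hF.diffAt U.2 hw)
  map_one_eq_zero' := by
    change SmoothFun.derFun s a b (SmoothFun.mk (fun _ => 1) contDiffOn_const) = _
    rw [SmoothFun.derFun_mk]
    exact SmoothFun.mk_eq_mk (hG := contDiffOn_const (c := (0 : ℂ))) |>.2
      fun w hw => wirt_const s a b 1 w
  leibniz' f g := by
    obtain ⟨F, hF, rfl⟩ := SmoothFun.exists_mk f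
    obtain ⟨G, hG, rfl⟩ := SmoothFun.exists_mk g
    change SmoothFun.derFun s a b (SmoothFun.mk (F * G) (hF.mul hG)) =
      SmoothFun.mk F hF * SmoothFun.derFun s a b (SmoothFun.mk G hG) +
        SmoothFun.mk G hG * SmoothFun.derFun s a b (SmoothFun.mk F hF)
    rw [SmoothFun.derFun_mk, SmoothFun.derFun_mk, SmoothFun.derFun_mk]
    exact SmoothFun.mk_eq_mk
      (hG := (hF.mul (hG.wirt s a b U.2)).add (hG.mul (hF.wirt s a b U.2))) |>.2
      fun w hw => wirt_mul s a b (hF.diffAt U.2 hw) (hG.diffAt U.2 hw)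

lemma SmoothFun.der_mk (s : ℂ) (a b : E) (F : E → ℂ) (hF : ContDiffOn ℝ ∞ F U) :
    SmoothFun.der U s a b (SmoothFun.mk F hF) =
      SmoothFun.mk (wirt s a b F) (hF.wirt s a b U.2) :=
  SmoothFun.derFun_mk s a b F hF

lemma SmoothFun.der_comm (s s' : ℂ) (a b a' b' : E) (f : SmoothFun U) :
    SmoothFun.der U s a b (SmoothFun.der U s' a' b' f) =
      SmoothFun.der U s' a' b' (SmoothFun.der U s a b f) := by
  obtain ⟨F, hF, rfl⟩ := SmoothFun.exists_mk f
  rw [SmoothFun.der_mk, SmoothFun.der_mk, SmoothFun.der_mk, SmoothFun.der_mk]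
  exact SmoothFun.mk_eq_mk.2 fun w hw => wirt_comm s a b hF U.2 s' a' b' hw

end smooth

/-- The extension of a derivation to dual numbers. -/
def dualDer {B : Type*} [CommRing B] [Algebra ℂ B] (D : Derivation ℂ B B) :
    Derivation ℂ (DualNumber B) (DualNumber B) where
  toFun f := (D f.fst, D f.snd)
  map_add' f g := TrivSqZeroExt.ext (map_add D _ _) (map_add D _ _)
  map_smul' c f := TrivSqZeroExt.ext (Derivation.map_smul D c _) (Derivation.map_smul D c _)
  map_one_eq_zero' := TrivSqZeroExt.ext (Derivation.map_one_eq_zero D) (map_zero D)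
  leibniz' f g := by
    refine TrivSqZeroExt.ext (Derivation.leibniz D _ _) ?_
    change D (f.fst * g.snd + f.snd * g.fst) =
      (f.fst * D g.snd + f.snd * D g.fst) + (g.fst * D f.snd + g.snd * D f.fst)
    rw [map_add, Derivation.leibniz, Derivation.leibniz]
    simp only [smul_eq_mul]
    ring

section evaluation

variable {E : Type*} [NormedAddCommGroup E] [NormedSpace ℝ E] {U : TopologicalSpace.Opens E}

/-- The value of the component of degree zero. -/
def ev₀ (w : U) : DualNumber (SmoothFun U) →ₗ[ℂ] ℂ where
  toFun f := (f.fst : U → ℂ) w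
  map_add' _ _ := rfl
  map_smul' _ _ := rfl

/-- The value of the component of degree one. -/
def ev₁ (w : U) : DualNumber (SmoothFun U) →ₗ[ℂ] ℂ where
  toFun f := (f.snd : U → ℂ) w
  map_add' _ _ := rfl
  map_smul' _ _ := rfl

lemma dual_ext {f g : DualNumber (SmoothFun U)} (h₀ : ∀ w, ev₀ w f = ev₀ w g)
    (h₁ : ∀ w, ev₁ w f = ev₁ w g) : f = g :=
  TrivSqZeroExt.ext (Subtype.ext (funext h₀)) (Subtype.ext (funext h₁))

lemma ev₀_mul (w : U) (f g : DualNumber (SmoothFun U)) : ev₀ w (f * g) = ev₀ w f * ev₀ w g := rfl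

lemma ev₁_mul (w : U) (f g : DualNumber (SmoothFun U)) :
    ev₁ w (f * g) = ev₀ w f * ev₁ w g + ev₁ w f * ev₀ w g := rfl

lemma ev₀_zero (w : U) : ev₀ w 0 = 0 := rfl

lemma ev₁_zero (w : U) : ev₁ w 0 = 0 := rfl

lemma ev₀_add (w : U) (f g : DualNumber (SmoothFun U)) : ev₀ w (f + g) = ev₀ w f + ev₀ w g := rfl

lemma ev₁_add (w : U) (f g : DualNumber (SmoothFun U)) : ev₁ w (f + g) = ev₁ w f + ev₁ w g := rfl

lemma ev₀_sub (w : U) (f g : DualNumber (SmoothFun U)) : ev₀ w (f - g) = ev₀ w f - ev₀ w g := rfl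

lemma ev₁_sub (w : U) (f g : DualNumber (SmoothFun U)) : ev₁ w (f - g) = ev₁ w f - ev₁ w g := rfl

lemma ev₀_sum (w : U) {ι : Type*} (s : Finset ι) (f : ι → DualNumber (SmoothFun U)) :
    ev₀ w (∑ i ∈ s, f i) = ∑ i ∈ s, ev₀ w (f i) := map_sum _ _ _

lemma ev₁_sum (w : U) {ι : Type*} (s : Finset ι) (f : ι → DualNumber (SmoothFun U)) :
    ev₁ w (∑ i ∈ s, f i) = ∑ i ∈ s, ev₁ w (f i) := map_sum _ _ _

lemma ev₀_one (w : U) : ev₀ w 1 = 1 := rfl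

lemma ev₁_one (w : U) : ev₁ w 1 = 0 := rfl

/-- The dual number `F + ε F'`. -/
def dual (F F' : E → ℂ) (hF : ContDiffOn ℝ ∞ F U) (hF' : ContDiffOn ℝ ∞ F' U) :
    DualNumber (SmoothFun U) := (SmoothFun.mk F hF, SmoothFun.mk F' hF')

variable {F F' : E → ℂ} {hF : ContDiffOn ℝ ∞ F U} {hF' : ContDiffOn ℝ ∞ F' U}

lemma ev₀_dual (w : U) : ev₀ w (dual F F' hF hF') = F w := rfl

lemma ev₁_dual (w : U) : ev₁ w (dual F F' hF hF') = F' w := rfl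

/-- The extension to dual numbers of the derivation `wirt`. -/
def smoothDualDer (U : TopologicalSpace.Opens E) (s : ℂ) (a b : E) :
    Derivation ℂ (DualNumber (SmoothFun U)) (DualNumber (SmoothFun U)) :=
  dualDer (SmoothFun.der U s a b)

lemma smoothDualDer_dual (s : ℂ) (a b : E) : smoothDualDer U s a b (dual F F' hF hF') =
    dual (wirt s a b F) (wirt s a b F') (hF.wirt s a b U.2) (hF'.wirt s a b U.2) :=
  TrivSqZeroExt.ext (SmoothFun.der_mk s a b F hF) (SmoothFun.der_mk s a b F' hF')

lemma smoothDualDer_comm (s s' : ℂ) (a b a' b' : E) (f : DualNumber (SmoothFun U)) :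
    smoothDualDer U s a b (smoothDualDer U s' a' b' f) =
      smoothDualDer U s' a' b' (smoothDualDer U s a b f) :=
  TrivSqZeroExt.ext (SmoothFun.der_comm s s' a b a' b' _) (SmoothFun.der_comm s s' a b a' b' _)

end evaluation

/-! ### The phase space of a coordinate chart -/

section phase

variable {n : ℕ}

/-- The coefficient in `wd i = (∂_1 + s ∂_I) / 2`. -/
def wsgn : Fin n ⊕ Fin n → ℂ := Sum.elim (fun _ => -Complex.I) fun _ => Complex.I

/-- The coordinate number of a direction. -/
def widx : Fin n ⊕ Fin n → Fin n := Sum.elim id id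

lemma wd_eq (i : Fin n ⊕ Fin n) :
    wd i = wirt (wsgn i) (Pi.single (widx i) 1 : Cn n) (Pi.single (widx i) Complex.I) := by
  cases i with
  | inl k => exact dz_eq_wirt k
  | inr k => exact dzb_eq_wirt k

/-- The derivation in the base direction `i`. -/
def baseDer (U : TopologicalSpace.Opens (Cn n × Cn n)) (i : Fin n ⊕ Fin n) :
    Derivation ℂ (DualNumber (SmoothFun U)) (DualNumber (SmoothFun U)) :=
  smoothDualDer U (wsgn i) (Pi.single (widx i) 1, 0) (Pi.single (widx i) Complex.I, 0)

/-- The derivation in the fibre direction `i`. -/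
def fibDer (U : TopologicalSpace.Opens (Cn n × Cn n)) (i : Fin n ⊕ Fin n) :
    Derivation ℂ (DualNumber (SmoothFun U)) (DualNumber (SmoothFun U)) :=
  smoothDualDer U (wsgn i) (0, Pi.single (widx i) 1) (0, Pi.single (widx i) Complex.I)

lemma wirt_fst (s : ℂ) (a b : Cn n) {F : Cn n × Cn n → ℂ} {w : Cn n × Cn n}
    (hF : DifferentiableAt ℝ F w) :
    wirt s (a, 0) (b, 0) F w = wirt s a b (fun y => F (y, w.2)) w.1 := by
  have h : HasFDerivAt (fun y => F (y, w.2))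
      ((fderiv ℝ F w).comp (ContinuousLinearMap.inl ℝ (Cn n) (Cn n))) w.1 :=
    HasFDerivAt.comp w.1 (f := fun y => (y, w.2)) hF.hasFDerivAt (hasFDerivAt_prodMk_left w.1 w.2)
  simp [wirt, h.fderiv]

lemma wirt_snd (s : ℂ) (a b : Cn n) {F : Cn n × Cn n → ℂ} {w : Cn n × Cn n}
    (hF : DifferentiableAt ℝ F w) :
    wirt s (0, a) (0, b) F w = wirt s a b (fun ζ => F (w.1, ζ)) w.2 := by
  have h : HasFDerivAt (fun ζ => F (w.1, ζ))
      ((fderiv ℝ F w).comp (ContinuousLinearMap.inr ℝ (Cn n) (Cn n))) w.2 :=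
    HasFDerivAt.comp w.2 (f := fun ζ => (w.1, ζ)) hF.hasFDerivAt (hasFDerivAt_prodMk_right w.1 w.2)
  simp [wirt, h.fderiv]

variable {U : TopologicalSpace.Opens (Cn n × Cn n)} {F F' : Cn n × Cn n → ℂ}
  {hF : ContDiffOn ℝ ∞ F U} {hF' : ContDiffOn ℝ ∞ F' U}

lemma ev₀_baseDer_dual (i : Fin n ⊕ Fin n) (w : U) : ev₀ w (baseDer U i (dual F F' hF hF')) =
    wd i (fun y => F (y, w.1.2)) w.1.1 := by
  rw [baseDer, smoothDualDer_dual, ev₀_dual, wirt_fst _ _ _ (hF.diffAt U.2 w.2), wd_eq]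

lemma ev₁_baseDer_dual (i : Fin n ⊕ Fin n) (w : U) : ev₁ w (baseDer U i (dual F F' hF hF')) =
    wd i (fun y => F' (y, w.1.2)) w.1.1 := by
  rw [baseDer, smoothDualDer_dual, ev₁_dual, wirt_fst _ _ _ (hF'.diffAt U.2 w.2), wd_eq]

lemma ev₀_fibDer_dual (i : Fin n ⊕ Fin n) (w : U) : ev₀ w (fibDer U i (dual F F' hF hF')) =
    wd i (fun ζ => F (w.1.1, ζ)) w.1.2 := by
  rw [fibDer, smoothDualDer_dual, ev₀_dual, wirt_snd _ _ _ (hF.diffAt U.2 w.2), wd_eq]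

lemma ev₁_fibDer_dual (i : Fin n ⊕ Fin n) (w : U) : ev₁ w (fibDer U i (dual F F' hF hF')) =
    wd i (fun ζ => F' (w.1.1, ζ)) w.1.2 := by
  rw [fibDer, smoothDualDer_dual, ev₁_dual, wirt_snd _ _ _ (hF'.diffAt U.2 w.2), wd_eq]

lemma contDiff_fibCoord (i : Fin n ⊕ Fin n) : ContDiff ℝ ∞ (fun ζ : Cn n => fibCoord ζ i) := by
  cases i with
  | inl k => exact contDiff_apply ℝ ℂ k
  | inr k => exact Complex.conjCLE.contDiff.comp (contDiff_apply ℝ ℂ k)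

lemma wd_fibCoord (i j : Fin n ⊕ Fin n) (ζ : Cn n) :
    wd i (fun ζ => fibCoord ζ j) ζ = if i = j then 1 else 0 := by
  have h1 : ∀ k, fderiv ℝ (fun ζ : Cn n => ζ k) ζ = ContinuousLinearMap.proj k :=
    fun k => (ContinuousLinearMap.proj (R := ℝ) (φ := fun _ : Fin n => ℂ) k).fderiv
  have h2 : ∀ k, fderiv ℝ (fun ζ : Cn n => (starRingEnd ℂ) (ζ k)) ζ =
      (Complex.conjCLE : ℂ →L[ℝ] ℂ).comp (ContinuousLinearMap.proj k) :=
    fun k => ((Complex.conjCLE : ℂ →L[ℝ] ℂ).comp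
      (ContinuousLinearMap.proj (R := ℝ) (φ := fun _ : Fin n => ℂ) k)).fderiv
  rcases i with i | i <;> rcases j with j | j
  · change dz i (fun ζ : Cn n => ζ j) ζ = _
    rw [dz, h1]
    by_cases h : i = j
    · subst h
      simp
    · simp [h]
  · change dz i (fun ζ : Cn n => (starRingEnd ℂ) (ζ j)) ζ = _
    rw [dz, h2]
    by_cases h : i = j
    · subst h
      simp
    · simp [Ne.symm h]
  · change dzb i (fun ζ : Cn n => ζ j) ζ = _
    rw [dzb, h1]
    by_cases h : i = j
    · subst h
      simp
    · simp [h]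
  · change dzb i (fun ζ : Cn n => (starRingEnd ℂ) (ζ j)) ζ = _
    rw [dzb, h2]
    by_cases h : i = j
    · subst h
      simp
    · simp [h, Ne.symm h]

end phase

/-! ### Exponential sequences of functions on phase space -/

section phaseFun

variable {n : ℕ}

/-- The part of the cotangent bundle over an open set. -/
def phaseOpens (D : TopologicalSpace.Opens (Cn n)) : TopologicalSpace.Opens (Cn n × Cn n) :=
  ⟨(D : Set (Cn n)) ×ˢ Set.univ, D.2.prod isOpen_univ⟩

/-- A point of the cotangent bundle. -/
def phasePt {D : TopologicalSpace.Opens (Cn n)} {y : Cn n} (hy : y ∈ D) (ζ : Cn n) :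
    phaseOpens D := ⟨(y, ζ), hy, trivial⟩

/-- `G + ε κ` is a closed matrix function on `D`, with inverse `H + ε H'`, for the polarizations
`σ` and `τ`. -/
structure IsClosedPair (σ τ : Fin n → Fin n ⊕ Fin n) (D : TopologicalSpace.Opens (Cn n))
    (G κ H H' : Cn n → Matrix (Fin n) (Fin n) ℂ) : Prop where
  inj : ∀ i j, σ i = σ j ↔ i = j
  inj' : ∀ i j, τ i = τ j ↔ i = j
  ne : ∀ i j, σ i ≠ τ j
  smooth_G : ∀ k l, ContDiffOn ℝ ∞ (fun y => G y k l) D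
  smooth_κ : ∀ k l, ContDiffOn ℝ ∞ (fun y => κ y k l) D
  smooth_H : ∀ l k, ContDiffOn ℝ ∞ (fun y => H y l k) D
  smooth_H' : ∀ l k, ContDiffOn ℝ ∞ (fun y => H' y l k) D
  inverse : ∀ y ∈ D, G y * H y = 1
  eps : ∀ y ∈ D, H' y = -(H y * κ y * H y)
  closed_σ : ∀ j k l, ∀ y ∈ D, wd (σ j) (fun z => G z k l) y = wd (σ k) (fun z => G z j l) y
  closed_τ : ∀ j k l, ∀ y ∈ D, wd (τ j) (fun z => G z k l) y = wd (τ l) (fun z => G z k j) y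
  closed_σ' : ∀ j k l, ∀ y ∈ D, wd (σ j) (fun z => κ z k l) y = wd (σ k) (fun z => κ z j l) y
  closed_τ' : ∀ j k l, ∀ y ∈ D, wd (τ j) (fun z => κ z k l) y = wd (τ l) (fun z => κ z k j) y

/-- `P + ε Q` is the sequence of components of `exp(∑ ζ_k (H + ε H')_{lk} ∂_l) (P_0 + ε Q_0)`. -/
structure IsExpPair (σ τ : Fin n → Fin n ⊕ Fin n) (D : TopologicalSpace.Opens (Cn n))
    (H H' : Cn n → Matrix (Fin n) (Fin n) ℂ) (P Q : ℕ → Cn n → Cn n → ℂ) : Prop where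
  smooth_P : ∀ r, ContDiffOn ℝ ∞ (Function.uncurry (P r)) (phaseOpens D)
  smooth_Q : ∀ r, ContDiffOn ℝ ∞ (Function.uncurry (Q r)) (phaseOpens D)
  zero_P : ∀ y ∈ D, ∀ ζ, P 0 y ζ = P 0 y 0
  zero_Q : ∀ y ∈ D, ∀ ζ, Q 0 y ζ = Q 0 y 0
  succ_P : ∀ r : ℕ, ∀ y ∈ D, ∀ ζ, (r + 1 : ℂ) * P (r + 1) y ζ =
    ∑ k, fibCoord ζ (σ k) * ∑ l, H y l k * wd (τ l) (fun z => P r z ζ) y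
  succ_Q : ∀ r : ℕ, ∀ y ∈ D, ∀ ζ, (r + 1 : ℂ) * Q (r + 1) y ζ =
    ∑ k, fibCoord ζ (σ k) * ∑ l,
      (H y l k * wd (τ l) (fun z => Q r z ζ) y + H' y l k * wd (τ l) (fun z => P r z ζ) y)

/-- The pull-back of `F + ε F'` to the cotangent bundle. -/
def pullBack {D : TopologicalSpace.Opens (Cn n)} {F F' : Cn n → ℂ} (hF : ContDiffOn ℝ ∞ F D)
    (hF' : ContDiffOn ℝ ∞ F' D) : DualNumber (SmoothFun (phaseOpens D)) :=
  dual (fun w => F w.1) (fun w => F' w.1) (hF.comp contDiffOn_fst fun _ h => h.1)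
    (hF'.comp contDiffOn_fst fun _ h => h.1)

/-- A fibre coordinate as a function on the cotangent bundle. -/
def fibVar (D : TopologicalSpace.Opens (Cn n)) (i : Fin n ⊕ Fin n) :
    DualNumber (SmoothFun (phaseOpens D)) :=
  dual (fun w => fibCoord w.2 i) (fun _ => 0)
    ((contDiff_fibCoord i).comp_contDiffOn contDiffOn_snd) contDiffOn_const

/-- The Poisson bracket on phase space. -/
def phaseBracket (σ τ : Fin n → Fin n ⊕ Fin n) (P Q : Cn n → Cn n → ℂ) (z ζ : Cn n) : ℂ :=
  ∑ k, (wd (σ k) (fun η => P z η) ζ * wd (σ k) (fun y => Q y ζ) z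
      - wd (σ k) (fun y => P y ζ) z * wd (σ k) (fun η => Q z η) ζ
      + (wd (τ k) (fun η => P z η) ζ * wd (τ k) (fun y => Q y ζ) z
      - wd (τ k) (fun y => P y ζ) z * wd (τ k) (fun η => Q z η) ζ))

variable {σ τ : Fin n → Fin n ⊕ Fin n} {D : TopologicalSpace.Opens (Cn n)}
  {G κ H H' : Cn n → Matrix (Fin n) (Fin n) ℂ}

namespace IsClosedPair

/-- Transposition exchanges the two polarizations; all facts about the target map arise from those
about the source map in this way. -/
lemma swap (h : IsClosedPair σ τ D G κ H H') :
    IsClosedPair τ σ D (fun y => (G y).transpose) (fun y => (κ y).transpose)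
      (fun y => (H y).transpose) (fun y => (H' y).transpose) where
  inj := h.inj'
  inj' := h.inj
  ne i j := (h.ne j i).symm
  smooth_G k l := h.smooth_G l k
  smooth_κ k l := h.smooth_κ l k
  smooth_H k l := h.smooth_H l k
  smooth_H' k l := h.smooth_H' l k
  inverse y hy := by
    rw [← Matrix.transpose_mul, mul_eq_one_comm.1 (h.inverse y hy), Matrix.transpose_one]
  eps y hy := by
    rw [h.eps y hy, Matrix.transpose_neg, Matrix.transpose_mul, Matrix.transpose_mul, mul_assoc]
  closed_σ j k l y hy := h.closed_τ j l k y hy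
  closed_τ j k l y hy := h.closed_σ j l k y hy
  closed_σ' j k l y hy := h.closed_τ' j l k y hy
  closed_τ' j k l y hy := h.closed_σ' j l k y hy

/-- The matrix `G + ε κ` over the functions on phase space. -/
def matG (h : IsClosedPair σ τ D G κ H H') :
    Matrix (Fin n) (Fin n) (DualNumber (SmoothFun (phaseOpens D))) :=
  fun k l => pullBack (h.smooth_G k l) (h.smooth_κ k l)

/-- The matrix `H + ε H'` over the functions on phase space. -/
def matH (h : IsClosedPair σ τ D G κ H H') :
    Matrix (Fin n) (Fin n) (DualNumber (SmoothFun (phaseOpens D))) :=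
  fun l k => pullBack (h.smooth_H l k) (h.smooth_H' l k)

lemma matG_mul_matH (h : IsClosedPair σ τ D G κ H H') : h.matG * h.matH = 1 := by
  ext1 k k'
  have hone : ∀ w : phaseOpens D, (1 : Matrix (Fin n) (Fin n)
      (DualNumber (SmoothFun (phaseOpens D)))) k k' = if k = k' then 1 else 0 := fun _ =>
    Matrix.one_apply
  refine dual_ext (fun w => ?_) fun w => ?_
  · have e := congrFun (congrFun (h.inverse w.1.1 w.2.1) k) k'
    rw [Matrix.mul_apply, Matrix.one_apply] at e
    rw [Matrix.mul_apply, ev₀_sum, hone w, apply_ite (ev₀ w), ev₀_one, ev₀_zero, ← e]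
    rfl
  -- The `ε` part of `(G + εκ)(H + εH') = 1` holds exactly because `H' = -HκH`.
  · have e : (G w.1.1 * H' w.1.1 + κ w.1.1 * H w.1.1) k k' = 0 := by
      rw [h.eps w.1.1 w.2.1, mul_neg, mul_assoc, ← mul_assoc (G w.1.1), h.inverse w.1.1 w.2.1,
        one_mul, neg_add_cancel, Matrix.zero_apply]
    rw [Matrix.add_apply, Matrix.mul_apply, Matrix.mul_apply, ← Finset.sum_add_distrib] at e
    rw [Matrix.mul_apply, ev₁_sum, hone w, apply_ite (ev₁ w), ev₁_one, ev₁_zero, ite_self, ← e]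
    rfl

/-- Closedness and invertibility over the dual numbers comprise the conditions on `G` and their
first order variations. Pull-backs from the base have no fibre derivatives, and coordinate
derivations commute. -/
lemma isPhaseSpace (h : IsClosedPair σ τ D G κ H H') :
    IsPhaseSpace (fun k => baseDer (phaseOpens D) (σ k)) (fun k => baseDer (phaseOpens D) (τ k))
      (fun k => fibDer (phaseOpens D) (σ k)) (fun k => fibDer (phaseOpens D) (τ k))
      (fun k => fibVar D (σ k)) h.matG h.matH where
  xy _ _ := smoothDualDer_comm _ _ _ _ _ _
  yy _ _ := smoothDualDer_comm _ _ _ _ _ _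
  px _ _ := smoothDualDer_comm _ _ _ _ _ _
  py _ _ := smoothDualDer_comm _ _ _ _ _ _
  qx _ _ := smoothDualDer_comm _ _ _ _ _ _
  qy _ _ := smoothDualDer_comm _ _ _ _ _ _
  pp _ _ := smoothDualDer_comm _ _ _ _ _ _
  qp _ _ := smoothDualDer_comm _ _ _ _ _ _
  yζ i j := dual_ext
    (fun w => (ev₀_baseDer_dual _ w).trans (wd_const _ (fibCoord w.1.2 (σ j)) _))
    fun w => (ev₁_baseDer_dual _ w).trans (wd_const _ 0 _)
  xζ i j := dual_ext
    (fun w => (ev₀_baseDer_dual _ w).trans (wd_const _ (fibCoord w.1.2 (σ j)) _))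
    fun w => (ev₁_baseDer_dual _ w).trans (wd_const _ 0 _)
  pζ i j := by
    refine dual_ext (fun w => (ev₀_fibDer_dual _ w).trans ?_)
      fun w => (ev₁_fibDer_dual _ w).trans ?_
    · rw [apply_ite (ev₀ w), ev₀_one, ev₀_zero, wd_fibCoord]
      simp only [h.inj]
    · rw [apply_ite (ev₁ w), ev₁_one, ev₁_zero, ite_self, wd_const]
  qζ i j := by
    refine dual_ext (fun w => (ev₀_fibDer_dual _ w).trans ?_)
      fun w => (ev₁_fibDer_dual _ w).trans (wd_const _ _ _)
    rw [wd_fibCoord, if_neg (h.ne j i).symm]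
    rfl
  pG i k l := dual_ext (fun w => (ev₀_fibDer_dual _ w).trans (wd_const _ (G w.1.1 k l) _))
    fun w => (ev₁_fibDer_dual _ w).trans (wd_const _ (κ w.1.1 k l) _)
  pH i k l := dual_ext (fun w => (ev₀_fibDer_dual _ w).trans (wd_const _ (H w.1.1 k l) _))
    fun w => (ev₁_fibDer_dual _ w).trans (wd_const _ (H' w.1.1 k l) _)
  qH i k l := dual_ext (fun w => (ev₀_fibDer_dual _ w).trans (wd_const _ (H w.1.1 k l) _))
    fun w => (ev₁_fibDer_dual _ w).trans (wd_const _ (H' w.1.1 k l) _)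
  GH := h.matG_mul_matH
  closed_x j k l := dual_ext
    (fun w => by
      refine (ev₀_baseDer_dual _ w).trans (Eq.trans ?_ (ev₀_baseDer_dual _ w).symm)
      exact h.closed_σ j k l _ w.2.1)
    (fun w => by
      refine (ev₁_baseDer_dual _ w).trans (Eq.trans ?_ (ev₁_baseDer_dual _ w).symm)
      exact h.closed_σ' j k l _ w.2.1)
  closed_y j k l := dual_ext
    (fun w => by
      refine (ev₀_baseDer_dual _ w).trans (Eq.trans ?_ (ev₀_baseDer_dual _ w).symm)
      exact h.closed_τ j k l _ w.2.1)
    (fun w => by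
      refine (ev₁_baseDer_dual _ w).trans (Eq.trans ?_ (ev₁_baseDer_dual _ w).symm)
      exact h.closed_τ' j k l _ w.2.1)

/-- The first-order part of the Jacobi identity for `H + ε H'`. -/
lemma jacobi (h : IsClosedPair σ τ D G κ H H') (k m i : Fin n) {y : Cn n} (hy : y ∈ D) :
    ∑ l, (H y l k * wd (τ l) (fun z => H' z i m) y + H' y l k * wd (τ l) (fun z => H z i m) y) =
    ∑ l, (H y l m * wd (τ l) (fun z => H' z i k) y +
      H' y l m * wd (τ l) (fun z => H z i k) y) := by
  have e := congrArg (ev₁ (phasePt hy 0))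
    (jacobi_of_closed h.isPhaseSpace.GH h.isPhaseSpace.closed_y k m i)
  simp only [ev₁_sum, ev₁_mul] at e
  simp only [matH, pullBack, ev₀_baseDer_dual, ev₁_baseDer_dual, ev₀_dual, ev₁_dual] at e
  exact e

end IsClosedPair

namespace IsExpPair

variable {P Q P' Q' P'' Q'' : ℕ → Cn n → Cn n → ℂ}

/-- The exponential sequence as a sequence of functions on phase space. -/
def seq (h : IsExpPair σ τ D H H' P Q) (r : ℕ) : DualNumber (SmoothFun (phaseOpens D)) :=
  dual (Function.uncurry (P r)) (Function.uncurry (Q r)) (h.smooth_P r) (h.smooth_Q r)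

lemma ev₀_baseDer_seq (h : IsExpPair σ τ D H H' P Q) (i : Fin n ⊕ Fin n) (r : ℕ)
    (w : phaseOpens D) :
    ev₀ w (baseDer _ i (h.seq r)) = wd i (fun y => P r y w.1.2) w.1.1 := ev₀_baseDer_dual i w

lemma ev₁_baseDer_seq (h : IsExpPair σ τ D H H' P Q) (i : Fin n ⊕ Fin n) (r : ℕ)
    (w : phaseOpens D) :
    ev₁ w (baseDer _ i (h.seq r)) = wd i (fun y => Q r y w.1.2) w.1.1 := ev₁_baseDer_dual i w

lemma ev₀_fibDer_seq (h : IsExpPair σ τ D H H' P Q) (i : Fin n ⊕ Fin n) (r : ℕ)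
    (w : phaseOpens D) :
    ev₀ w (fibDer _ i (h.seq r)) = wd i (fun ζ => P r w.1.1 ζ) w.1.2 := ev₀_fibDer_dual i w

lemma ev₁_fibDer_seq (h : IsExpPair σ τ D H H' P Q) (i : Fin n ⊕ Fin n) (r : ℕ)
    (w : phaseOpens D) :
    ev₁ w (fibDer _ i (h.seq r)) = wd i (fun ζ => Q r w.1.1 ζ) w.1.2 := ev₁_fibDer_dual i w

lemma isExpSeq (h : IsExpPair σ τ D H H' P Q) (hD : IsClosedPair σ τ D G κ H H') :
    IsExpSeq (fun k => baseDer (phaseOpens D) (τ k))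
      (fun k => fibDer (phaseOpens D) (σ k)) (fun k => fibDer (phaseOpens D) (τ k))
      (fun k => fibVar D (σ k)) hD.matH h.seq := by
  have h0 : ∀ i, fibDer (phaseOpens D) i (h.seq 0) = 0 := by
    intro i
    refine dual_ext (fun w => ?_) fun w => ?_
    · simp only [ev₀_fibDer_seq, ev₀_zero, h.zero_P w.1.1 w.2.1, wd_const]
    · simp only [ev₁_fibDer_seq, ev₁_zero, h.zero_Q w.1.1 w.2.1, wd_const]
  refine ⟨fun k => h0 _, fun k => h0 _, fun r => dual_ext (fun w => ?_) fun w => ?_⟩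
  · rw [map_smul, ev₀_sum]
    simp only [ev₀_mul, ev₀_sum, ev₀_baseDer_seq]
    exact h.succ_P r w.1.1 w.2.1 w.1.2
  · rw [map_smul, ev₁_sum]
    simp only [ev₁_mul, ev₁_sum, ev₀_baseDer_seq, ev₁_baseDer_seq]
    refine (h.succ_Q r w.1.1 w.2.1 w.1.2).trans (Finset.sum_congr rfl fun k _ => ?_)
    -- Fibre coordinates have no `ε` part, so the `ε` component of the recursion has only the two
    -- terms with `H` and `H'`.
    have e : ev₁ w (fibVar D (σ k)) = 0 := rfl
    rw [e, zero_mul, add_zero]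
    rfl

/-- The recursion is linear over dual numbers and `ε(P' + εQ') = εP'`. This represents the image of
`b₀ + εb₁`, namely `S₀b₀ + ε(S₁b₀ + S₀b₁)`. -/
lemma add_eps (h : IsExpPair σ τ D H H' P Q) (h' : IsExpPair σ τ D H H' P' Q') :
    IsExpPair σ τ D H H' P (fun r y ζ => Q r y ζ + P' r y ζ) where
  smooth_P := h.smooth_P
  smooth_Q r := (h.smooth_Q r).add (h'.smooth_P r)
  zero_P := h.zero_P
  zero_Q y hy ζ := by
    rw [h.zero_Q y hy, h'.zero_P y hy]
  succ_P := h.succ_P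
  succ_Q r y hy ζ := by
    have e : ∀ F : Cn n → Cn n → ℂ,
        ContDiffOn ℝ ∞ (Function.uncurry F) (phaseOpens D) →
        DifferentiableAt ℝ (fun z => F z ζ) y := fun F hF =>
      (hF.diffAt (phaseOpens D).2 (show (y, ζ) ∈ phaseOpens D from ⟨hy, trivial⟩)).comp y
        (f := fun z => (z, ζ)) (by fun_prop)
    rw [mul_add, h.succ_Q r y hy, h'.succ_P r y hy, ← Finset.sum_add_distrib]
    refine Finset.sum_congr rfl fun k _ => ?_
    rw [← mul_add, ← Finset.sum_add_distrib]
    congr 1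
    refine Finset.sum_congr rfl fun l _ => ?_
    have e' : wd (τ l) (fun z => Q r z ζ + P' r z ζ) y = _ :=
      wd_add (τ l) (e _ (h.smooth_Q r)) (e _ (h'.smooth_P r))
    rw [e']
    ring

/-- Multiplicativity of the exponential. -/
lemma mul_eq (hD : IsClosedPair σ τ D G κ H H') (h : IsExpPair σ τ D H H' P Q)
    (h' : IsExpPair σ τ D H H' P' Q') (h'' : IsExpPair σ τ D H H' P'' Q'')
    (hP : ∀ y ∈ D, ∀ ζ, P'' 0 y ζ = P 0 y ζ * P' 0 y ζ)
    (hQ : ∀ y ∈ D, ∀ ζ, Q'' 0 y ζ = P 0 y ζ * Q' 0 y ζ + Q 0 y ζ * P' 0 y ζ)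
    (r : ℕ) {y : Cn n} (hy : y ∈ D) (ζ : Cn n) :
    P'' r y ζ = ∑ a ∈ Finset.HasAntidiagonal.antidiagonal r, P a.1 y ζ * P' a.2 y ζ ∧
    Q'' r y ζ = ∑ a ∈ Finset.HasAntidiagonal.antidiagonal r,
      (P a.1 y ζ * Q' a.2 y ζ + Q a.1 y ζ * P' a.2 y ζ) := by
  have e := (h''.isExpSeq hD).ext ((h.isExpSeq hD).mul (h'.isExpSeq hD)) (by
    rw [Finset.Nat.antidiagonal_zero, Finset.sum_singleton]
    exact dual_ext (fun w => hP _ w.2.1 _) fun w => hQ _ w.2.1 _) r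
  constructor
  · have e₀ := congrArg (ev₀ (phasePt hy ζ)) e
    rw [ev₀_sum] at e₀
    exact e₀
  · have e₁ := congrArg (ev₁ (phasePt hy ζ)) e
    rw [ev₁_sum] at e₁
    exact e₁

/-- The exponential is a Poisson map. -/
lemma bracket_eq (hD : IsClosedPair σ τ D G κ H H') (h : IsExpPair σ τ D H H' P Q)
    (h' : IsExpPair σ τ D H H' P' Q') (h'' : IsExpPair σ τ D H H' P'' Q'')
    (hP : ∀ y ∈ D, ∀ ζ, P'' 0 y ζ = ∑ l, ∑ k, H y l k *
      (wd (τ l) (fun z => P 0 z ζ) y * wd (σ k) (fun z => P' 0 z ζ) y -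
        wd (τ l) (fun z => P' 0 z ζ) y * wd (σ k) (fun z => P 0 z ζ) y))
    (hQ : ∀ y ∈ D, ∀ ζ, Q'' 0 y ζ = ∑ l, ∑ k, (H y l k *
      (wd (τ l) (fun z => P 0 z ζ) y * wd (σ k) (fun z => Q' 0 z ζ) y +
        wd (τ l) (fun z => Q 0 z ζ) y * wd (σ k) (fun z => P' 0 z ζ) y -
        (wd (τ l) (fun z => P' 0 z ζ) y * wd (σ k) (fun z => Q 0 z ζ) y +
        wd (τ l) (fun z => Q' 0 z ζ) y * wd (σ k) (fun z => P 0 z ζ) y)) + H' y l k *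
      (wd (τ l) (fun z => P 0 z ζ) y * wd (σ k) (fun z => P' 0 z ζ) y -
        wd (τ l) (fun z => P' 0 z ζ) y * wd (σ k) (fun z => P 0 z ζ) y)))
    (r : ℕ) {y : Cn n} (hy : y ∈ D) (ζ : Cn n) :
    P'' r y ζ = ∑ a ∈ Finset.HasAntidiagonal.antidiagonal (r + 1),
      phaseBracket σ τ (P a.1) (P' a.2) y ζ ∧
    Q'' r y ζ = ∑ a ∈ Finset.HasAntidiagonal.antidiagonal (r + 1),
      (phaseBracket σ τ (P a.1) (Q' a.2) y ζ + phaseBracket σ τ (Q a.1) (P' a.2) y ζ) := by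
  have hR := hD.isPhaseSpace
  have e := (h''.isExpSeq hD).ext (hR.bracket_expSeq (h.isExpSeq hD) (h'.isExpSeq hD)) (by
    rw [hR.bracket_zero (h.isExpSeq hD) (h'.isExpSeq hD)]
    refine dual_ext (fun w => (hP _ w.2.1 w.1.2).trans ?_) fun w => (hQ _ w.2.1 w.1.2).trans ?_
    · simp only [ev₀_sum, ev₀_mul, ev₀_sub, ev₀_baseDer_seq]
      rfl
    · simp only [ev₁_sum, ev₀_mul, ev₁_mul, ev₀_sub, ev₁_sub, ev₀_baseDer_seq, ev₁_baseDer_seq]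
      rfl) r
  -- Both series are independent of the `τ` fibre variables, so only the `σ` half of the phase space
  -- bracket remains.
  have hq : ∀ a k, fibDer (phaseOpens D) (τ k) (h.seq a) = 0 := fun a k =>
    hR.q_eq_zero (h.isExpSeq hD) k a
  have hq' : ∀ a k, fibDer (phaseOpens D) (τ k) (h'.seq a) = 0 := fun a k =>
    hR.q_eq_zero (h'.isExpSeq hD) k a
  have hqP : ∀ a k, wd (τ k) (fun η => P a y η) ζ = 0 := fun a k =>
    (ev₀_fibDer_dual (τ k) (phasePt hy ζ)).symm.trans
      ((congrArg (ev₀ (phasePt hy ζ)) (hq a k)).trans (ev₀_zero _))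
  have hqQ : ∀ a k, wd (τ k) (fun η => Q a y η) ζ = 0 := fun a k =>
    (ev₁_fibDer_dual (τ k) (phasePt hy ζ)).symm.trans
      ((congrArg (ev₁ (phasePt hy ζ)) (hq a k)).trans (ev₁_zero _))
  have hqP' : ∀ a k, wd (τ k) (fun η => P' a y η) ζ = 0 := fun a k =>
    (ev₀_fibDer_dual (τ k) (phasePt hy ζ)).symm.trans
      ((congrArg (ev₀ (phasePt hy ζ)) (hq' a k)).trans (ev₀_zero _))
  have hqQ' : ∀ a k, wd (τ k) (fun η => Q' a y η) ζ = 0 := fun a k =>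
    (ev₁_fibDer_dual (τ k) (phasePt hy ζ)).symm.trans
      ((congrArg (ev₁ (phasePt hy ζ)) (hq' a k)).trans (ev₁_zero _))
  simp only [phaseBracket, hqP, hqQ, hqP', hqQ', zero_mul, mul_zero, sub_zero, add_zero]
  constructor
  · have e₀ := congrArg (ev₀ (phasePt hy ζ)) e
    simp only [ev₀_sum, ev₀_mul, ev₀_sub, ev₀_baseDer_seq, ev₀_fibDer_seq] at e₀
    exact e₀
  · have e₁ := congrArg (ev₁ (phasePt hy ζ)) e
    simp only [ev₁_sum, ev₁_mul, ev₁_sub, ev₀_baseDer_seq, ev₀_fibDer_seq, ev₁_baseDer_seq,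
      ev₁_fibDer_seq] at e₁
    refine Eq.trans e₁ (Finset.sum_congr rfl fun a _ => ?_)
    rw [← Finset.sum_add_distrib]
    refine Finset.sum_congr rfl fun k _ => ?_
    simp only [phasePt]
    ring

/-- The exponentials for the two polarizations Poisson commute. -/
lemma bracket_eq_zero (hD : IsClosedPair σ τ D G κ H H') (h : IsExpPair σ τ D H H' P Q)
    (h' : IsExpPair τ σ D (fun y => (H y).transpose) (fun y => (H' y).transpose) P' Q')
    (r : ℕ) {y : Cn n} (hy : y ∈ D) (ζ : Cn n) :
    ∑ a ∈ Finset.HasAntidiagonal.antidiagonal (r + 1),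
      phaseBracket σ τ (P a.1) (P' a.2) y ζ = 0 ∧
    ∑ a ∈ Finset.HasAntidiagonal.antidiagonal (r + 1),
      (phaseBracket σ τ (P a.1) (Q' a.2) y ζ + phaseBracket σ τ (Q a.1) (P' a.2) y ζ) = 0 := by
  have e := hD.isPhaseSpace.bracket_eq_zero hD.swap.isPhaseSpace (h.isExpSeq hD)
    (h'.isExpSeq hD.swap) r
  constructor
  · have e₀ := congrArg (ev₀ (phasePt hy ζ)) e
    simp only [ev₀_sum, ev₀_add, ev₀_mul, ev₀_sub, ev₀_baseDer_seq, ev₀_fibDer_seq] at e₀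
    exact e₀.trans (ev₀_zero _)
  · have e₁ := congrArg (ev₁ (phasePt hy ζ)) e
    simp only [ev₁_sum, ev₁_add, ev₁_mul, ev₁_sub, ev₀_baseDer_seq, ev₀_fibDer_seq,
      ev₁_baseDer_seq, ev₁_fibDer_seq] at e₁
    refine Eq.trans (Finset.sum_congr rfl fun a _ => ?_) (e₁.trans (ev₁_zero _))
    rw [phaseBracket, phaseBracket, ← Finset.sum_add_distrib]
    refine Finset.sum_congr rfl fun k _ => ?_
    simp only [phasePt]
    ring

end IsExpPair

end phaseFun

section polarized

variable {n : ℕ} {M : Type*} [TopologicalSpace M] [ChartedSpace (Cn n) M]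

/-! ### The deformation groupoid mapping of a pair of families of operators -/

/-- The families of operators `f ↦ ∑ ν^r B_r(f, ·)` and `f ↦ ∑ ν^r B'_r(f, ·)` deform the
multiplication by functions, differentiate in the directions `σ`, and commute with families of
first order operators in the directions `τ`. -/
structure IsPolarizedPair (σ τ : Fin n → Fin n ⊕ Fin n) (B B' : BilinSeq n M)
    (G κ H H' : Tensor11 n M) : Prop where
  closed : ∀ φ : OpenPartialHomeomorph M (Cn n), IsHolChart φ →
    IsClosedPair σ τ ⟨φ.target, φ.open_target⟩ (G φ) (κ φ) (H φ) (H' φ)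
  pair : ∀ f, IsCommutingPair σ τ (fun r => B r f) (fun r => B' r f) G H κ
  zero : ∀ f v, B 0 f v = f * v
  one : ∀ r f, B (r + 1) f 1 = 0
  one' : ∀ r f, B' (r + 1) f 1 = 0

lemma contDiff_fibMon (γ : MultiIdx n) : ContDiff ℝ ∞ (fun ζ : Cn n => fibMon γ ζ) := by
  simp only [fibMon_eq_mon, mon]
  exact contDiff_prod fun i _ => (contDiff_fibCoord i).pow _

lemma IsFibrePolynomial.contDiffOn {r : ℕ} {P : CotFn n M} (h : IsFibrePolynomial r P)
    {φ : OpenPartialHomeomorph M (Cn n)} (hφ : IsHolChart φ) :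
    ContDiffOn ℝ ∞ (Function.uncurry (cotLoc φ P)) (phaseOpens ⟨φ.target, φ.open_target⟩) := by
  intro w hw
  obtain ⟨V, hV, hyV, hVt, a, ha, hP⟩ := h φ hφ w.1 hw.1
  have h1 : ContDiffOn ℝ ∞ (fun w : Cn n × Cn n => ∑ γ ∈ idxEq n r, a γ w.1 * fibMon γ w.2)
      (V ×ˢ Set.univ) :=
    ContDiffOn.sum fun γ _ => ((ha γ).comp contDiffOn_fst fun _ h => h.1).mul
      ((contDiff_fibMon γ).comp_contDiffOn contDiffOn_snd)
  have hn := (hV.prod isOpen_univ).mem_nhds (show w ∈ V ×ˢ Set.univ from ⟨hyV, trivial⟩)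
  refine ((h1.contDiffAt hn).congr_of_eventuallyEq ?_).contDiffWithinAt
  exact Filter.eventuallyEq_of_mem hn fun w hw => hP w.1 hw.1 w.2

lemma cotLoc_formalMul (φ : OpenPartialHomeomorph M (Cn n)) (F G : FormalFn n M) (r : ℕ)
    (z ζ : Cn n) : cotLoc φ (formalMul F G r) z ζ =
      ∑ p ∈ Finset.HasAntidiagonal.antidiagonal r,
        cotLoc φ (fcomp F p.1) z ζ * cotLoc φ (fcomp G p.2) z ζ := by
  simp [cotLoc, formalMul, Finset.sum_apply]

lemma sum_mul_sum_swap {ι R : Type*} [Fintype ι] [CommRing R] (a : ι → R) (A : ι → ι → R)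
    (b : ι → R) : ∑ l, (∑ k, a k * A l k) * b l = ∑ k, a k * ∑ l, A l k * b l := by
  simp only [Finset.mul_sum, Finset.sum_mul]
  rw [Finset.sum_comm]
  exact Finset.sum_congr rfl fun _ _ => Finset.sum_congr rfl fun _ _ => mul_assoc _ _ _

lemma symb_sub (A B : Sm n M →ₗ[ℂ] Sm n M) (r : ℕ) : symb (A - B) r = symb A r - symb B r := by
  funext x ξ
  exact sub_div _ _ _

namespace IsPolarizedPair

variable [T2Space M] [IsManifold 𝓘(ℂ, Cn n) ω M]

variable {σ τ : Fin n → Fin n ⊕ Fin n} {B B' : BilinSeq n M} {G κ H H' : Tensor11 n M}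
  (h : IsPolarizedPair σ τ B B' G κ H H')

/-- The map `f ↦ σ(∑ ν^r B_r(f, ·)) + ε σ(∑ ν^{r-1} (B_r - B'_r)(f, ·))`. -/
def epsMap : EpsMap n M where
  c0 :=
    { toFun := fun f => ⟨fun r => symb (B r f) r, fun r =>
        ((h.pair f).hasSidedOrder r).hasPrincipalSymbol.isFibrePolynomial⟩
      map_add' := fun f g => Subtype.ext <| funext fun r => by
        change symb (B r (f + g)) r = symb (B r f) r + symb (B r g) r
        rw [map_add, symb_add]
      map_smul' := fun c f => Subtype.ext <| funext fun r => by
        change symb (B r (c • f)) r = c • symb (B r f) r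
        rw [map_smul, symb_smul] }
  c1 :=
    { toFun := fun f => ⟨fun r => symb (B (r + 1) f - B' (r + 1) f) r, fun r =>
        ((h.pair f).hasSidedOrder_sub r).hasPrincipalSymbol.isFibrePolynomial⟩
      map_add' := fun f g => Subtype.ext <| funext fun r => by
        change symb (B (r + 1) (f + g) - B' (r + 1) (f + g)) r =
          symb (B (r + 1) f - B' (r + 1) f) r + symb (B (r + 1) g - B' (r + 1) g) r
        simp only [map_add, symb_sub, symb_add, add_sub_add_comm]
      map_smul' := fun c f => Subtype.ext <| funext fun r => by
        change symb (B (r + 1) (c • f) - B' (r + 1) (c • f)) r =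
          c • symb (B (r + 1) f - B' (r + 1) f) r
        simp only [map_smul, symb_sub, symb_smul, smul_sub] }

lemma hasSigmaSymbol (f : Sm n M) : HasSigmaSymbol (fun r => B r f) (h.epsMap.c0 f) :=
  fun r => ((h.pair f).hasSidedOrder r).hasPrincipalSymbol

lemma hasSigmaSymbol' (f : Sm n M) : HasSigmaSymbol (fun r => B' r f) (h.epsMap.c0 f) := by
  intro r
  have e : fcomp (h.epsMap.c0 f) r = symb (B' r f) r := (h.pair f).symb_eq r
  rw [e]
  exact ((h.pair f).symm.hasSidedOrder r).hasPrincipalSymbol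

lemma hasSigmaSymbol_sub (f : Sm n M) :
    HasSigmaSymbol (fun r => B (r + 1) f - B' (r + 1) f) (h.epsMap.c1 f) :=
  fun r => ((h.pair f).hasSidedOrder_sub r).hasPrincipalSymbol

lemma fcomp_c0_zero (f : Sm n M) : fcomp (h.epsMap.c0 f) 0 = fun x _ => (f : M → ℂ) x := by
  funext x ξ
  change symb (B 0 f) 0 x ξ = _
  rw [symb, pow_zero, h.zero, mul_one, Nat.factorial_zero, Nat.cast_one, div_one]

/-- The symbol of order zero is the value on the constant `1`, which both operators of index one
annihilate by the unit axiom. -/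
lemma fcomp_c1_zero (f : Sm n M) : fcomp (h.epsMap.c1 f) 0 = fun _ _ => 0 := by
  funext x ξ
  change symb (B 1 f - B' 1 f) 0 x ξ = _
  rw [symb, pow_zero, LinearMap.sub_apply, h.one, h.one', sub_zero]
  exact zero_div _

lemma cotLoc_c0_zero (φ : OpenPartialHomeomorph M (Cn n)) (f : Sm n M) (z ζ : Cn n) :
    cotLoc φ (fcomp (h.epsMap.c0 f) 0) z ζ = loc φ f z := by
  rw [h.fcomp_c0_zero]
  rfl

lemma cotLoc_c1_zero (φ : OpenPartialHomeomorph M (Cn n)) (f : Sm n M) (z ζ : Cn n) :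
    cotLoc φ (fcomp (h.epsMap.c1 f) 0) z ζ = 0 := by
  rw [h.fcomp_c1_zero]
  rfl

/-- The link between the analytic and the algebraic half: the symbols satisfy the exponential
recursion for `H + εH'` in every chart. -/
lemma isExpPair {φ : OpenPartialHomeomorph M (Cn n)} (hφ : IsHolChart φ) (f : Sm n M) :
    IsExpPair σ τ ⟨φ.target, φ.open_target⟩ (H φ) (H' φ)
      (fun r => cotLoc φ (fcomp (h.epsMap.c0 f) r))
      (fun r => cotLoc φ (fcomp (h.epsMap.c1 f) r)) where
  smooth_P r := ((h.epsMap.c0 f).2 r).contDiffOn hφ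
  smooth_Q r := ((h.epsMap.c1 f).2 r).contDiffOn hφ
  zero_P y _ ζ := by rw [h.cotLoc_c0_zero, h.cotLoc_c0_zero]
  zero_Q y _ ζ := by rw [h.cotLoc_c1_zero, h.cotLoc_c1_zero]
  succ_P r y hy ζ := ((h.pair f).cotLoc_symb_succ r hφ hy ζ).trans (sum_mul_sum_swap _ _ _)
  succ_Q r y hy ζ := by
    refine ((h.pair f).cotLoc_symb_sub_succ r hφ hy ζ).trans ((sum_mul_sum_swap _ _ _).trans ?_)
    refine Finset.sum_congr rfl fun k _ => ?_
    -- The `κ` term of the recursion for the difference, with its minus sign, is the `H'` term.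
    have e : ∀ l, H' φ y l k = -∑ q, ∑ j, H φ y l j * κ φ y j q * H φ y q k := by
      intro l
      rw [(h.closed φ hφ).eps y hy, Matrix.neg_apply, Matrix.mul_apply]
      simp only [Matrix.mul_apply, Finset.sum_mul]
    rw [Finset.sum_add_distrib]
    congr 1
    simp only [mul_sub, Finset.sum_sub_distrib]
    rw [sub_eq_add_neg]
    congr 1
    simp only [e, neg_mul, Finset.sum_neg_distrib, Finset.mul_sum, Finset.sum_mul]
    congr 1
    rw [Finset.sum_comm]
    refine Finset.sum_congr rfl fun l _ => Finset.sum_congr rfl fun _ _ =>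
      Finset.sum_congr rfl fun _ _ => ?_
    change _ = _ * wd (τ l) (fun z => cotLoc φ (symb (B r f) r) z ζ) y
    ring

/-- The operator `ζ_k H_{lk} ∂_l` for the polarizations `σ`, `τ`. -/
def expField (σ τ : Fin n → Fin n ⊕ Fin n) (H : Cn n → Matrix (Fin n) (Fin n) ℂ)
    (F : Cn n → Cn n → ℂ) (z ζ : Cn n) : ℂ :=
  ∑ k, fibCoord ζ (σ k) * ∑ l, H z l k * wd (τ l) (fun y => F y ζ) z

/-- The `r`-th iterate of the field is `r!` times the component of degree `r`. Both sides have to be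
compared on the whole chart domain, since the next iterate differentiates. -/
lemma isExpOf (D E : OpenPartialHomeomorph M (Cn n) → (Cn n → Cn n → ℂ) → Cn n → Cn n → ℂ)
    (hD : ∀ φ F z ζ, D φ F z ζ = expField σ τ (H φ) F z ζ)
    (hE : ∀ φ F z ζ, E φ F z ζ = expField σ τ (H' φ) F z ζ) : IsExpOf h.epsMap D E := by
  intro φ hφ f r
  have hX := h.isExpPair hφ f
  have hdiff : ∀ F : Cn n → Cn n → ℂ,
      ContDiffOn ℝ ∞ (Function.uncurry F) (phaseOpens ⟨φ.target, φ.open_target⟩) → ∀ y ∈ φ.target,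
      ∀ ζ, DifferentiableAt ℝ (fun z => F z ζ) y := fun F hF y hy ζ =>
    (hF.diffAt (phaseOpens _).2 (show (y, ζ) ∈ phaseOpens _ from ⟨hy, trivial⟩)).comp y
      (f := fun z => (z, ζ)) (by fun_prop)
  suffices hs : ∀ z ∈ φ.target, ∀ ζ,
      ((epsOp (D φ) (E φ))^[r] (fun y _ => loc φ f y, 0)).1 z ζ =
        (r.factorial : ℂ) * cotLoc φ (fcomp (h.epsMap.c0 f) r) z ζ ∧
      ((epsOp (D φ) (E φ))^[r] (fun y _ => loc φ f y, 0)).2 z ζ =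
        (r.factorial : ℂ) * cotLoc φ (fcomp (h.epsMap.c1 f) r) z ζ by
    intro z hz ζ
    have h0 : (r.factorial : ℂ) ≠ 0 := by exact_mod_cast r.factorial_ne_zero
    rw [(hs z hz ζ).1, (hs z hz ζ).2, mul_div_cancel_left₀ _ h0, mul_div_cancel_left₀ _ h0]
    exact ⟨rfl, rfl⟩
  induction r with
  | zero =>
    intro z hz ζ
    rw [h.cotLoc_c0_zero, h.cotLoc_c1_zero]
    simp
  | succ r ih =>
    intro z hz ζ
    rw [Function.iterate_succ_apply']
    set X := (epsOp (D φ) (E φ))^[r] (fun y _ => loc φ f y, 0)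
    have e1 : ∀ l, wd (τ l) (fun y => X.1 y ζ) z =
        (r.factorial : ℂ) * wd (τ l) (fun y => cotLoc φ (fcomp (h.epsMap.c0 f) r) y ζ) z :=
      fun l => by
        rw [wd_congr_of_eqOn (τ l) φ.open_target (fun y hy => (ih y hy ζ).1) hz,
          wd_const_mul _ _ (hdiff _ (hX.smooth_P r) z hz ζ)]
    have e2 : ∀ l, wd (τ l) (fun y => X.2 y ζ) z =
        (r.factorial : ℂ) * wd (τ l) (fun y => cotLoc φ (fcomp (h.epsMap.c1 f) r) y ζ) z :=
      fun l => by
        rw [wd_congr_of_eqOn (τ l) φ.open_target (fun y hy => (ih y hy ζ).2) hz,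
          wd_const_mul _ _ (hdiff _ (hX.smooth_Q r) z hz ζ)]
    have hf : ((r + 1).factorial : ℂ) = r.factorial * (r + 1) := by
      rw [Nat.factorial_succ]
      push_cast
      ring
    rw [hf, mul_assoc, mul_assoc, hX.succ_P r z hz ζ, hX.succ_Q r z hz ζ]
    constructor
    · change D φ X.1 z ζ = _
      rw [hD, expField, Finset.mul_sum]
      refine Finset.sum_congr rfl fun k _ => ?_
      rw [mul_left_comm, Finset.mul_sum (a := (r.factorial : ℂ))]
      congr 1
      refine Finset.sum_congr rfl fun l _ => ?_
      rw [e1]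
      ring
    · change D φ X.2 z ζ + E φ X.1 z ζ = _
      rw [hD, hE, expField, expField, Finset.mul_sum, ← Finset.sum_add_distrib]
      refine Finset.sum_congr rfl fun k _ => ?_
      rw [mul_left_comm, Finset.mul_sum (a := (r.factorial : ℂ)), ← mul_add,
        ← Finset.sum_add_distrib]
      congr 1
      refine Finset.sum_congr rfl fun l _ => ?_
      rw [e1, e2]
      ring

lemma isUnitalMorphism : IsUnitalMorphism h.epsMap := by
  have hmul : ∀ (f g : Sm n M) r (x : M) (ξ : TangentSpace 𝓘(ℝ, Cn n) x →L[ℝ] ℝ),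
      fcomp (h.epsMap.c0 (f * g)) r x ξ = formalMul (h.epsMap.c0 f) (h.epsMap.c0 g) r x ξ ∧
      fcomp (h.epsMap.c1 (f * g)) r x ξ = (formalMul (h.epsMap.c0 f) (h.epsMap.c1 g) r +
        formalMul (h.epsMap.c1 f) (h.epsMap.c0 g) r) x ξ := by
    intro f g r x ξ
    have hφ := isHolChart_chartAt (n := n) x
    have hx := mem_chart_source (Cn n) x
    obtain ⟨ζ, hζ⟩ := exists_cotLoc hφ hx ξ
    have e := IsExpPair.mul_eq (h.closed _ hφ) (h.isExpPair hφ f) (h.isExpPair hφ g)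
      (h.isExpPair hφ (f * g)) (fun y _ ζ => by simp only [h.cotLoc_c0_zero]; rfl)
      (fun y _ ζ => by simp only [h.cotLoc_c0_zero, h.cotLoc_c1_zero, mul_zero, zero_mul, add_zero])
      r (OpenPartialHomeomorph.map_source _ hx) ζ
    refine ⟨?_, ?_⟩
    · rw [hζ (fcomp _ r), e.1, hζ (formalMul _ _ r), cotLoc_formalMul]
    · rw [hζ (fcomp _ r), e.2, hζ (formalMul _ _ r + _), Finset.sum_add_distrib, ← cotLoc_formalMul,
        ← cotLoc_formalMul]
      rfl
  refine ⟨fun f => ?_, fun f => ?_, fun f g r => ?_, fun f g r => ?_⟩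
  · funext x
    rw [restrictZero, h.fcomp_c0_zero]
  · funext x
    rw [restrictZero, h.fcomp_c1_zero]
    rfl
  · exact funext fun x => funext fun ξ => (hmul f g r x ξ).1
  · exact funext fun x => funext fun ξ => (hmul f g r x ξ).2

/-- The sign `s` is put on the bracket on the base: `s b` is the bracket with tensor `H + εH'` in
the polarization at hand, and `s² = 1` brings the sign to the other side. With `s = 1` this serves
the source, with `s = -1` the target, whose polarization reverses the bracket. -/
lemma isPoissonMap {g g' : Tensor11 n M} {s : ℂ} (hs : s * s = 1)
    (hpb : ∀ φ (P Q : CotFn n M) z ζ,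
      pbLoc φ P Q z ζ = phaseBracket σ τ (cotLoc φ P) (cotLoc φ Q) z ζ)
    (hg : ∀ f₁ f₂ b, IsBracket g f₁ f₂ b → ∀ φ : OpenPartialHomeomorph M (Cn n), IsHolChart φ →
      ∀ y ∈ φ.target, s * loc φ b y = ∑ l, ∑ k, H φ y l k *
        (wd (τ l) (loc φ f₁) y * wd (σ k) (loc φ f₂) y -
          wd (τ l) (loc φ f₂) y * wd (σ k) (loc φ f₁) y))
    (hg' : ∀ f₁ f₂ b, IsBracket g' f₁ f₂ b → ∀ φ : OpenPartialHomeomorph M (Cn n), IsHolChart φ →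
      ∀ y ∈ φ.target, s * loc φ b y = ∑ l, ∑ k, H' φ y l k *
        (wd (τ l) (loc φ f₁) y * wd (σ k) (loc φ f₂) y -
          wd (τ l) (loc φ f₂) y * wd (σ k) (loc φ f₁) y))
    (hex : ∀ f₁ f₂, ∃ b, IsBracket g' f₁ f₂ b) : IsPoissonMap s g g' h.epsMap := by
  have hc0 : ∀ φ f r z ζ, cotLoc φ (fcomp (h.epsMap.c0 (s • f)) r) z ζ =
      s * cotLoc φ (fcomp (h.epsMap.c0 f) r) z ζ := by
    intro φ f r z ζ
    rw [map_smul]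
    rfl
  have hc1 : ∀ φ f r z ζ, cotLoc φ (fcomp (h.epsMap.c1 (s • f)) r) z ζ =
      s * cotLoc φ (fcomp (h.epsMap.c1 f) r) z ζ := by
    intro φ f r z ζ
    rw [map_smul]
    rfl
  have key : ∀ f₁ f₂ b₀ b₁ : Sm n M, IsBracket g f₁ f₂ b₀ → IsBracket g' f₁ f₂ b₁ →
      ∀ φ : OpenPartialHomeomorph M (Cn n), IsHolChart φ → ∀ z ∈ φ.target, ∀ ζ r,
      s * cotLoc φ (fcomp (h.epsMap.c0 b₀) r) z ζ =
        formalPbLoc φ (h.epsMap.c0 f₁) (h.epsMap.c0 f₂) r z ζ ∧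
      s * cotLoc φ (fcomp (h.epsMap.c1 b₀) r) z ζ + s * cotLoc φ (fcomp (h.epsMap.c0 b₁) r) z ζ =
        formalPbLoc φ (h.epsMap.c0 f₁) (h.epsMap.c1 f₂) r z ζ +
          formalPbLoc φ (h.epsMap.c1 f₁) (h.epsMap.c0 f₂) r z ζ := by
    intro f₁ f₂ b₀ b₁ hb₀ hb₁ φ hφ z hz ζ r
    have e := IsExpPair.bracket_eq (h.closed _ hφ) (h.isExpPair hφ f₁) (h.isExpPair hφ f₂)
      ((h.isExpPair hφ (s • b₀)).add_eps (h.isExpPair hφ (s • b₁)))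
      (fun y hy ζ => by
        simp only [hc0, h.cotLoc_c0_zero]
        exact hg f₁ f₂ b₀ hb₀ φ hφ y hy)
      (fun y hy ζ => by
        simp only [hc0, h.cotLoc_c0_zero, h.cotLoc_c1_zero, wd_const, mul_zero, zero_mul, add_zero,
          sub_zero, zero_add]
        exact hg' f₁ f₂ b₁ hb₁ φ hφ y hy) r hz ζ
    rw [Finset.sum_add_distrib] at e
    simp only [hc0, hc1, ← hpb] at e
    exact e
  have hs' : ∀ a b : ℂ, s * a = b → a = s * b := by
    rintro a b rfl
    rw [← mul_assoc, hs, one_mul]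
  refine ⟨fun f₁ f₂ b₀ hb₀ φ hφ z hz ζ r => ?_, fun f₁ f₂ b₀ b₁ hb₀ hb₁ φ hφ z hz ζ r => ?_⟩
  · obtain ⟨b₁, hb₁⟩ := hex f₁ f₂
    exact hs' _ _ (key f₁ f₂ b₀ b₁ hb₀ hb₁ φ hφ z hz ζ r).1
  · refine hs' _ _ ?_
    rw [mul_add]
    exact (key f₁ f₂ b₀ b₁ hb₀ hb₁ φ hφ z hz ζ r).2

lemma bracket_eq_zero {B₂ B₂' : BilinSeq n M}
    (h₂ : IsPolarizedPair τ σ B₂ B₂' (fun φ y => (G φ y).transpose)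
      (fun φ y => (κ φ y).transpose) (fun φ y => (H φ y).transpose)
      (fun φ y => (H' φ y).transpose))
    (hpb : ∀ φ (P Q : CotFn n M) z ζ,
      pbLoc φ P Q z ζ = phaseBracket σ τ (cotLoc φ P) (cotLoc φ Q) z ζ)
    (f₁ f₂ : Sm n M) {φ : OpenPartialHomeomorph M (Cn n)} (hφ : IsHolChart φ) {z : Cn n}
    (hz : z ∈ φ.target) (ζ : Cn n) (r : ℕ) :
    formalPbLoc φ (h.epsMap.c0 f₁) (h₂.epsMap.c0 f₂) r z ζ = 0 ∧
    formalPbLoc φ (h.epsMap.c0 f₁) (h₂.epsMap.c1 f₂) r z ζ +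
      formalPbLoc φ (h.epsMap.c1 f₁) (h₂.epsMap.c0 f₂) r z ζ = 0 := by
  have e := IsExpPair.bracket_eq_zero (h.closed _ hφ) (h.isExpPair hφ f₁) (h₂.isExpPair hφ f₂) r
    hz ζ
  rw [Finset.sum_add_distrib] at e
  simp only [← hpb] at e
  exact e

/-- If `f` is constant along `τ` near the point, the recursion gives zero in all positive degrees.
The vanishing is carried along on an open set because each step differentiates the previous
component. -/
lemma fixesAt (f : Sm n M) {x : M} {V : Set (Cn n)} (hV : IsOpen V)
    (hx : chartAt (Cn n) x x ∈ V) (hVt : V ⊆ (chartAt (Cn n) x).target)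
    (hf : ∀ l, ∀ y ∈ V, wd (τ l) (loc (chartAt (Cn n) x) f) y = 0) : FixesAt h.epsMap f x := by
  set φ := chartAt (Cn n) x with hφx
  have hφ : IsHolChart φ := isHolChart_chartAt x
  have hX := h.isExpPair hφ f
  intro r ξ
  obtain ⟨ζ, hζ⟩ := exists_cotLoc hφ (mem_chart_source (Cn n) x) ξ
  rcases r with _ | r
  · rw [h.fcomp_c0_zero, h.fcomp_c1_zero, if_pos rfl]
    exact ⟨rfl, rfl⟩
  have hne : ∀ r : ℕ, (r + 1 : ℂ) ≠ 0 := fun r => by exact_mod_cast r.succ_ne_zero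
  have hP : ∀ r, ∀ y ∈ V, ∀ l,
      wd (τ l) (fun z => cotLoc φ (fcomp (h.epsMap.c0 f) r) z ζ) y = 0 := by
    intro r
    induction r with
    | zero =>
      intro y hy l
      simp only [h.cotLoc_c0_zero]
      exact hf l y hy
    | succ r ih =>
      intro y hy l
      refine wd_eq_zero_of_eqOn hV (fun z hz => ?_) _ hy
      have e := hX.succ_P r z (hVt hz) ζ
      simp only [ih z hz, mul_zero, Finset.sum_const_zero] at e
      exact (mul_eq_zero.1 e).resolve_left (hne r)
  have hQ : ∀ r, ∀ y ∈ V, cotLoc φ (fcomp (h.epsMap.c1 f) r) y ζ = 0 := by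
    intro r
    induction r with
    | zero => exact fun y _ => h.cotLoc_c1_zero φ f y ζ
    | succ r ih =>
      intro y hy
      have e := hX.succ_Q r y (hVt hy) ζ
      simp only [hP r y hy, wd_eq_zero_of_eqOn hV ih _ hy, mul_zero, add_zero,
        Finset.sum_const_zero] at e
      exact (mul_eq_zero.1 e).resolve_left (hne r)
  rw [if_neg r.succ_ne_zero, hζ (fcomp (h.epsMap.c0 f) _), hζ (fcomp (h.epsMap.c1 f) _), hQ _ _ hx]
  refine ⟨?_, rfl⟩
  have e := hX.succ_P r _ (hVt hx) ζ
  simp only [hP r _ hx, mul_zero, Finset.sum_const_zero] at e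
  exact (mul_eq_zero.1 e).resolve_left (hne r)

end IsPolarizedPair

/-- The second order parts of the operators of a pair. -/
lemma IsPolarizedPair.loc_sub_two [T2Space M] [IsManifold 𝓘(ℂ, Cn n) ω M] {B B' : BilinSeq n M}
    {G κ H H' : Tensor11 n M} (h : IsPolarizedPair Sum.inl Sum.inr B B' G κ H H')
    {φ : OpenPartialHomeomorph M (Cn n)} (hφ : IsHolChart φ) {y : Cn n} (hy : y ∈ φ.target)
    (f v : Sm n M) : loc φ ((B 2 f v - B' 2 f v : Sm n M) : M → ℂ) y =
      ∑ l, ∑ k, H' φ y l k * (dzb l (loc φ f) y * dz k (loc φ v) y) := by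
  obtain ⟨V, hV, hyV, hVt, a, ha, has⟩ := (h.pair f).hasSidedOrder_sub 1 φ hφ y hy
  set A := B 2 f - B' 2 f with hA
  -- `A` has order at most one and kills constants, so its value at a point is its symbol on the
  -- differential of `v`.
  have h1 : A 1 = 0 := by rw [hA, LinearMap.sub_apply, h.one, h.one', sub_zero]
  have h2 : A v = A (centered φ y v ^ 1) := by
    rw [pow_one, centered, map_sub, Algebra.algebraMap_eq_smul_one, map_smul, h1, smul_zero,
      sub_zero]
  have h3 := ha.pow_eq hφ hV hVt hyV (m := 1) (fun γ hγ => ha.order γ hγ y hyV)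
    (v := centered φ y v) (sub_self _)
  -- For complex-valued `v` no real covector need match both kinds of derivatives. Matching the
  -- holomorphic ones suffices, because `A` differentiates in these directions only.
  have h4 := cotLoc_symb hφ hV hVt ha hyV fun k => dz k (loc φ v) y
  have h5 := (h.isExpPair hφ f).succ_Q 0 y hy fun k => dz k (loc φ v) y
  change loc φ (A v) y = _
  rw [h2, h3, sum_mon_congr (h.pair f).side (fun γ hγ => has γ hγ y hyV)
    (t' := fibCoord fun k => dz k (loc φ v) y)
    (fun k => wd_loc_centered hφ y v (Sum.inl k) hy), ← h4]
  simp only [h.cotLoc_c0_zero, h.cotLoc_c1_zero, wd_const, mul_zero, zero_add, Nat.cast_zero,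
    one_mul] at h5
  rw [Nat.factorial_one, Nat.cast_one, one_mul]
  refine h5.trans ?_
  simp only [Finset.mul_sum]
  rw [Finset.sum_comm]
  refine Finset.sum_congr rfl fun l _ => Finset.sum_congr rfl fun k _ => ?_
  change dz k (loc φ v) y * (H' φ y l k * dzb l (loc φ f) y) = _
  ring

end polarized

/-! ### Smoothness of the inverse matrix -/

section matrix

variable {E : Type*} [NormedAddCommGroup E] [NormedSpace ℝ E] {n : ℕ}

lemma contDiffOn_matrix_det {A : E → Matrix (Fin n) (Fin n) ℂ} {U : Set E}
    (hA : ∀ k l, ContDiffOn ℝ ∞ (fun y => A y k l) U) : ContDiffOn ℝ ∞ (fun y => (A y).det) U := by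
  simp only [Matrix.det_apply']
  exact ContDiffOn.sum fun s _ => contDiffOn_const.mul (contDiffOn_prod fun i _ => hA _ _)

lemma contDiffOn_matrix_inv {A : E → Matrix (Fin n) (Fin n) ℂ} {U : Set E}
    (hA : ∀ k l, ContDiffOn ℝ ∞ (fun y => A y k l) U) (hU : ∀ y ∈ U, (A y).det ≠ 0)
    (k l : Fin n) : ContDiffOn ℝ ∞ (fun y => (A y)⁻¹ k l) U := by
  simp only [Matrix.inv_def, Matrix.smul_apply, Ring.inverse_eq_inv', Matrix.adjugate_apply,
    smul_eq_mul]
  refine ((contDiffOn_matrix_det hA).inv hU).mul (contDiffOn_matrix_det fun i j => ?_)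
  by_cases h : i = l
  · subst h
    simp only [Matrix.updateRow_self]
    exact contDiffOn_const
  · simp only [Matrix.updateRow_ne h]
    exact hA i j

end matrix

section product

variable {n : ℕ} {M : Type*} [TopologicalSpace M] [ChartedSpace (Cn n) M]

/-! ### Potentials -/

/-- Locally `G_{kl} = ∂_k ∂̄_l Φ`. -/
def HasPotentials (G : Tensor11 n M) : Prop :=
  LocallyInCharts M fun φ V => ∃ Φ : Cn n → ℂ, ContDiffOn ℝ ∞ Φ V ∧
    ∀ y ∈ V, ∀ k l, G φ y k l = dz k (dzb l Φ) y

lemma HasPotentials.sub {G G' : Tensor11 n M} (h : HasPotentials G) (h' : HasPotentials G') :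
    HasPotentials (fun φ y => G φ y - G' φ y) := by
  intro φ hφ y hy
  obtain ⟨V, hV, hyV, hVt, Φ, hΦ, e⟩ := h φ hφ y hy
  obtain ⟨V', hV', hyV', -, Φ', hΦ', e'⟩ := h' φ hφ y hy
  have hW := hV.inter hV'
  have d := hΦ.mono (Set.inter_subset_left (t := V'))
  have d' := hΦ'.mono (Set.inter_subset_right (s := V))
  refine ⟨V ∩ V', hW, ⟨hyV, hyV'⟩, Set.inter_subset_left.trans hVt, Φ - Φ', d.sub d',
    fun z hz k l => ?_⟩
  have e1 : Set.EqOn (dzb l (Φ - Φ')) (dzb l Φ - dzb l Φ') (V ∩ V') := fun w hw =>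
    wd_sub (Sum.inr l) (d.diffAt hW hw) (d'.diffAt hW hw)
  have e2 := wd_congr_of_eqOn (Sum.inl k) hW e1 hz
  have e3 := wd_sub (Sum.inl k) ((d.wd (Sum.inr l) hW).diffAt hW hz)
    ((d'.wd (Sum.inr l) hW).diffAt hW hz)
  change G φ z k l - G' φ z k l = _
  rw [e z hz.1, e' z hz.2]
  exact (e2.trans e3).symm

lemma HasPotentials.contDiffOn {G : Tensor11 n M} (h : HasPotentials G)
    {φ : OpenPartialHomeomorph M (Cn n)} (hφ : IsHolChart φ) (k l : Fin n) :
    ContDiffOn ℝ ∞ (fun y => G φ y k l) φ.target := by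
  intro y hy
  obtain ⟨V, hV, hyV, hVt, Φ, hΦ, e⟩ := h φ hφ y hy
  have hn := hV.mem_nhds hyV
  exact ((((hΦ.wd (Sum.inr l) hV).wd (Sum.inl k) hV).contDiffAt hn).congr_of_eventuallyEq
    (Filter.eventuallyEq_of_mem hn fun z hz => e z hz k l)).contDiffWithinAt

lemma HasPotentials.closed_left {G : Tensor11 n M} (h : HasPotentials G)
    {φ : OpenPartialHomeomorph M (Cn n)} (hφ : IsHolChart φ) (j k l : Fin n) {y : Cn n}
    (hy : y ∈ φ.target) : dz j (fun z => G φ z k l) y = dz k (fun z => G φ z j l) y := by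
  obtain ⟨V, hV, hyV, hVt, Φ, hΦ, e⟩ := h φ hφ y hy
  refine (wd_congr_of_eqOn (Sum.inl j) hV (fun z hz => e z hz k l) hyV).trans
    (Eq.trans ?_ (wd_congr_of_eqOn (Sum.inl k) hV (fun z hz => e z hz j l) hyV).symm)
  exact wd_comm (Sum.inl j) (hΦ.wd (Sum.inr l) hV) hV (Sum.inl k) hyV

lemma HasPotentials.closed_right {G : Tensor11 n M} (h : HasPotentials G)
    {φ : OpenPartialHomeomorph M (Cn n)} (hφ : IsHolChart φ) (j k l : Fin n) {y : Cn n}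
    (hy : y ∈ φ.target) : dzb j (fun z => G φ z k l) y = dzb l (fun z => G φ z k j) y := by
  obtain ⟨V, hV, hyV, hVt, Φ, hΦ, e⟩ := h φ hφ y hy
  refine (wd_congr_of_eqOn (Sum.inr j) hV (fun z hz => e z hz k l) hyV).trans
    (Eq.trans ?_ (wd_congr_of_eqOn (Sum.inr l) hV (fun z hz => e z hz k j) hyV).symm)
  refine (wd_comm (Sum.inr j) (hΦ.wd (Sum.inr l) hV) hV (Sum.inl k) hyV).trans
    (Eq.trans ?_ (wd_comm (Sum.inr l) (hΦ.wd (Sum.inr j) hV) hV (Sum.inl k) hyV).symm)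
  exact wd_congr_of_eqOn (Sum.inl k) hV
    (fun z hz => wd_comm (Sum.inr j) hΦ hV (Sum.inr l) hz) hyV

/-- All closedness conditions are the symmetry of third derivatives of local potentials. -/
lemma HasPotentials.isClosedPair {G κ : Tensor11 n M} (hG : HasPotentials G)
    (hκ : HasPotentials κ) {φ : OpenPartialHomeomorph M (Cn n)} (hφ : IsHolChart φ)
    (hdet : ∀ y ∈ φ.target, (G φ y).det ≠ 0) :
    IsClosedPair Sum.inl Sum.inr ⟨φ.target, φ.open_target⟩ (G φ) (κ φ) (fun y => (G φ y)⁻¹)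
      (fun y => -((G φ y)⁻¹ * κ φ y * (G φ y)⁻¹)) where
  inj _ _ := Sum.inl_injective.eq_iff
  inj' _ _ := Sum.inr_injective.eq_iff
  ne _ _ := Sum.inl_ne_inr
  smooth_G := hG.contDiffOn hφ
  smooth_κ := hκ.contDiffOn hφ
  smooth_H := contDiffOn_matrix_inv (hG.contDiffOn hφ) hdet
  smooth_H' l k := by
    have h := contDiffOn_matrix_inv (hG.contDiffOn hφ) hdet
    simp only [Matrix.neg_apply, Matrix.mul_apply]
    exact (ContDiffOn.sum fun j _ => (ContDiffOn.sum fun i _ =>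
      (h _ _).mul (hκ.contDiffOn hφ _ _)).mul (h _ _)).neg
  inverse y hy := Matrix.mul_nonsing_inv _ (hdet y hy).isUnit
  eps _ _ := rfl
  closed_σ j k l y hy := hG.closed_left hφ j k l hy
  closed_τ j k l y hy := hG.closed_right hφ j k l hy
  closed_σ' j k l y hy := hκ.closed_left hφ j k l hy
  closed_τ' j k l y hy := hκ.closed_right hφ j k l hy

/-! ### Polarized products -/

/-- `B` is an associative product deforming the pointwise product of functions which differentiates
its second argument in the directions `σ` only, and for which the multiplication by the `τ`
derivatives of local potentials `Φ` from the right is a first order operator;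
`G_{kl} = ∂_{σ k} ∂_{τ l} Φ_0` and `K_{kl} = ∂_{σ k} ∂_{τ l} Φ_1`. -/
structure IsPolarizedProduct (σ τ : Fin n → Fin n ⊕ Fin n) (B : BilinSeq n M)
    (G K : Tensor11 n M) : Prop where
  side : ∀ i, (∃ k, i = σ k) ∨ ∃ k, i = τ k
  assoc : ∀ f₁ f₂ f₃ r,
    ∑ p ∈ Finset.HasAntidiagonal.antidiagonal r, B p.1 (B p.2 f₁ f₂) f₃ =
    ∑ p ∈ Finset.HasAntidiagonal.antidiagonal r, B p.1 f₁ (B p.2 f₂ f₃)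
  zero : ∀ f v, B 0 f v = f * v
  one : ∀ r f, B (r + 1) f 1 = 0
  sided : ∀ r f, LocallyInCharts M fun φ V => ∃ N a, IsRep φ V (B r f) N a ∧ IsSided τ V a
  potential : LocallyInCharts M fun φ V => ∃ Φ : ℕ → Cn n → ℂ,
    (∀ r, ContDiffOn ℝ ∞ (Φ r) V) ∧
    (∀ y ∈ V, ∀ k l, wd (σ k) (wd (τ l) (Φ 0)) y = G φ y k l) ∧
    (∀ y ∈ V, ∀ k l, wd (σ k) (wd (τ l) (Φ 1)) y = K φ y k l) ∧
    ∀ y ∈ V, ∀ l, ∀ u : ℕ → Sm n M, (∀ r, loc φ (u r) =ᶠ[𝓝 y] wd (τ l) (Φ r)) →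
      ∀ (v : Sm n M) (r : ℕ),
        ∑ p ∈ Finset.HasAntidiagonal.antidiagonal r, loc φ (B p.1 v (u p.2)) y =
          wd (τ l) (Φ r) y * loc φ v y + if r = 1 then wd (τ l) (loc φ v) y else 0

/-- Both sides run over the triples of indices with sum `r`. -/
lemma sum_antidiagonal_assoc {A : Type*} [AddCommMonoid A] (F : ℕ → ℕ → ℕ → A) (r : ℕ) :
    ∑ p ∈ Finset.HasAntidiagonal.antidiagonal r,
      ∑ q ∈ Finset.HasAntidiagonal.antidiagonal p.1, F q.1 q.2 p.2 =
    ∑ p ∈ Finset.HasAntidiagonal.antidiagonal r,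
      ∑ q ∈ Finset.HasAntidiagonal.antidiagonal p.2, F p.1 q.1 q.2 := by
  rw [Finset.sum_sigma', Finset.sum_sigma']
  refine Finset.sum_nbij' (fun s => ⟨(s.2.1, s.2.2 + s.1.2), (s.2.2, s.1.2)⟩)
    (fun s => ⟨(s.1.1 + s.2.1, s.2.2), (s.1.1, s.2.1)⟩) ?_ ?_ ?_ ?_ ?_ <;>
    rintro ⟨⟨a, b⟩, c, d⟩ h <;>
    simp only [Finset.mem_sigma, Finset.HasAntidiagonal.mem_antidiagonal] at h ⊢ <;>
    obtain ⟨rfl, rfl⟩ := h <;>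
    simp [add_assoc]

lemma pderiv_zero (F : Cn n → ℂ) : pderiv 0 F = F := by
  unfold pderiv
  induction List.finRange n with
  | nil => rfl
  | cons k l ih => simp

lemma hasSidedOrder_of_mul (τ : Fin n → Fin n ⊕ Fin n) {A : Sm n M →ₗ[ℂ] Sm n M} {f : Sm n M}
    (h : ∀ v, A v = f * v) : HasSidedOrder τ A 0 := by
  classical
  intro φ hφ y hy
  refine ⟨φ.target, φ.open_target, hy, subset_rfl, fun γ => if γ = 0 then loc φ f else 0,
    ⟨fun γ => ?_, fun γ hγ z _ => ?_, fun v z _ => ?_⟩, fun γ hγ z _ => ?_⟩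
  · split_ifs
    · exact contDiffOn_loc hφ f
    · exact contDiffOn_const
  · rw [if_neg (by rintro rfl; simp at hγ)]
    rfl
  · rw [Finset.sum_eq_single 0 (fun γ _ hγ => by rw [if_neg hγ]; exact zero_mul _)
      (fun h => absurd (mem_idxLE.2 (by simp)) h), if_pos rfl, pderiv_zero, h]
    rfl
  · have h0 : γ ≠ 0 := fun h => hγ fun k => congrFun h (τ k)
    simp only [if_neg h0]
    rfl

namespace IsPolarizedProduct

variable {σ τ : Fin n → Fin n ⊕ Fin n} {B B' : BilinSeq n M} {G K K' : Tensor11 n M}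

/-- Associativity read as `R_u L_f = L_f R_u`, coefficient by coefficient, for a formal function
`u`. The inner sums are transposed so that the associator appears with `p.2` as the `ν` degree of
`u`. -/
lemma commute (h : IsPolarizedProduct σ τ B G K) (u : ℕ → Sm n M) (f v : Sm n M) (r : ℕ) :
    ∑ p ∈ Finset.HasAntidiagonal.antidiagonal r,
      ∑ q ∈ Finset.HasAntidiagonal.antidiagonal p.1, B q.1 (B p.2 f v) (u q.2) =
    ∑ p ∈ Finset.HasAntidiagonal.antidiagonal r,
      B p.1 f (∑ q ∈ Finset.HasAntidiagonal.antidiagonal p.2, B q.1 v (u q.2)) := by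
  simp only [map_sum]
  rw [sum_antidiagonal_assoc fun i j k => B i (B k f v) (u j)]
  simp only [← Finset.Nat.sum_antidiagonal_swap (f := fun q : ℕ × ℕ => B _ (B q.2 f v) (u q.1)),
    Prod.fst_swap, Prod.snd_swap]
  rw [← sum_antidiagonal_assoc fun i k j => B i (B k f v) (u j),
    ← sum_antidiagonal_assoc fun i k j => B i f (B k v (u j))]
  exact Finset.sum_congr rfl fun p _ => h.assoc f v (u p.2) p.1

lemma isCommutant (h : IsPolarizedProduct σ τ B G K) {φ : OpenPartialHomeomorph M (Cn n)}
    {V : Set (Cn n)} (hV : IsOpen V) {Φ : ℕ → Cn n → ℂ} {u : Fin n → ℕ → Sm n M}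
    (hu : ∀ l r, Set.EqOn (loc φ (u l r)) (wd (τ l) (Φ r)) V)
    (hΦ : ∀ y ∈ V, ∀ l, ∀ u : ℕ → Sm n M, (∀ r, loc φ (u r) =ᶠ[𝓝 y] wd (τ l) (Φ r)) →
      ∀ (v : Sm n M) (r : ℕ),
        ∑ p ∈ Finset.HasAntidiagonal.antidiagonal r, loc φ (B p.1 v (u p.2)) y =
          wd (τ l) (Φ r) y * loc φ v y + if r = 1 then wd (τ l) (loc φ v) y else 0) (f : Sm n M) :
    IsCommutant τ φ V (fun r => B r f) u := by
  intro l
  refine ⟨fun q => ∑ p ∈ Finset.HasAntidiagonal.antidiagonal q, (B p.1).flip (u l p.2),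
    fun q v z hz => ?_, fun r v => ?_⟩
  · rw [LinearMap.sum_apply, loc_sum, hu l q hz]
    exact hΦ z hz l (u l) (fun r => (hu l r).eventuallyEq_of_mem (hV.mem_nhds hz)) v q
  · simp only [LinearMap.sum_apply, LinearMap.flip_apply]
    exact h.commute (u l) f v r

lemma isPolarizedPair [T2Space M] [IsManifold 𝓘(ℂ, Cn n) ω M]
    (h : IsPolarizedProduct σ τ B G K) (h' : IsPolarizedProduct σ τ B' G K')
    {κ H H' : Tensor11 n M}
    (hκ : ∀ φ : OpenPartialHomeomorph M (Cn n), IsHolChart φ → ∀ y ∈ φ.target,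
      κ φ y = K φ y - K' φ y)
    (hc : ∀ φ : OpenPartialHomeomorph M (Cn n), IsHolChart φ →
      IsClosedPair σ τ ⟨φ.target, φ.open_target⟩ (G φ) (κ φ) (H φ) (H' φ)) :
    IsPolarizedPair σ τ B B' G κ H H' where
  closed := hc
  zero := h.zero
  one := h.one
  one' := h'.one
  pair f :=
    { side := h.side
      inverse := fun φ hφ y hy k k' => by
        rw [← Matrix.one_apply, ← (hc φ hφ).inverse y hy, Matrix.mul_apply]
      sided := fun r => h.sided r f
      sided' := fun r => h'.sided r f
      zero := hasSidedOrder_of_mul τ (h.zero f)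
      zero_eq := LinearMap.ext fun v => (h.zero f v).trans (h'.zero f v).symm
      commutant := by
        intro φ hφ y hy
        obtain ⟨V, hV, hyV, hVt, Φ, hΦ, hG, hK, hB⟩ := h.potential φ hφ y hy
        obtain ⟨V', hV', hyV', hVt', Φ', hΦ', hG', hK', hB'⟩ := h'.potential φ hφ y hy
        -- The parametrization mentions germs only. The derivatives of both potentials are extended
        -- to global functions on one common neighbourhood, so that right multiplication by them
        -- makes sense.
        obtain ⟨U, hU, hyU, hUV, hext⟩ := exists_loc_eqOn hφ (hV.inter hV')
          (Set.inter_subset_left.trans hVt) ⟨hyV, hyV'⟩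
        have hUV1 := hUV.trans Set.inter_subset_left
        have hUV2 := hUV.trans Set.inter_subset_right
        choose u hu using fun l r =>
          hext _ (((hΦ r).wd (τ l) hV).mono Set.inter_subset_left)
        choose u' hu' using fun l r =>
          hext _ (((hΦ' r).wd (τ l) hV').mono Set.inter_subset_right)
        refine ⟨U, hU, hyU, hUV1.trans hVt, u, u',
          h.isCommutant hU hu (fun y hy => hB y (hUV1 hy)) f,
          h'.isCommutant hU hu' (fun y hy => hB' y (hUV2 hy)) f, fun k l z hz => ?_,
          fun k l z hz => ?_, fun k l z hz => ?_⟩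
        · rw [wd_congr_of_eqOn _ hU (hu l 0) hz, hG z (hUV1 hz)]
        · rw [wd_congr_of_eqOn _ hU (hu' l 0) hz, hG' z (hUV2 hz)]
        · rw [wd_congr_of_eqOn _ hU (hu l 1) hz, wd_congr_of_eqOn _ hU (hu' l 1) hz,
            hK z (hUV1 hz), hK' z (hUV2 hz), hκ φ hφ z (hVt (hUV1 hz)), Matrix.sub_apply] }

end IsPolarizedProduct

end product

/-! ### Star products in both polarizations; holomorphic functions -/

section products

variable {n : ℕ} {M : Type*} [TopologicalSpace M] [ChartedSpace (Cn n) M]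

lemma coef_sub (φ : OpenPartialHomeomorph M (Cn n)) (w w' : ClosedForm11 n M) (y : Cn n) :
    coef φ ((w - w' : ClosedForm11 n M) : TwoForm n M) y =
      coef φ (w : TwoForm n M) y - coef φ (w' : TwoForm n M) y := by
  have h : ∀ v, formLoc φ ((w - w' : ClosedForm11 n M) : TwoForm n M) y v =
      formLoc φ (w : TwoForm n M) y v - formLoc φ (w' : TwoForm n M) y v := fun _ => rfl
  ext k l
  simp only [coef, h, Matrix.sub_apply]
  ring

lemma IsBidifferential.exists_isRep {A : MultiIdx n → MultiIdx n → Prop}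
    {τ : Fin n → Fin n ⊕ Fin n} (hA : ∀ γ δ, A γ δ → OffSide τ δ)
    {C : Sm n M →ₗ[ℂ] Sm n M →ₗ[ℂ] Sm n M} (h : IsBidifferential A C) (f : Sm n M) :
    LocallyInCharts M fun φ V => ∃ N a, IsRep φ V (C f) N a ∧ IsSided τ V a := by
  intro φ hφ y hy
  obtain ⟨V, hV, hyV, hVt, N, c, hc, hc0, hC⟩ := h φ hφ y hy
  have hf := (contDiffOn_loc hφ f).mono hVt
  -- Freezing the first argument turns its derivatives into coefficients. They are cut off above
  -- length `N`, since the given `c` is unconstrained there.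
  refine ⟨V, hV, hyV, hVt, N, fun δ z => if ∑ i, δ i ≤ N then
    ∑ γ ∈ idxLE n N, c γ δ z * pderiv γ (loc φ f) z else 0,
    ⟨fun δ => ?_, fun δ hδ z _ => if_neg (by omega), fun g z hz => ?_⟩, fun δ hδ z _ => ?_⟩
  · split_ifs
    · exact ContDiffOn.sum fun γ _ => (hc γ δ).mul (hf.pderiv γ hV)
    · exact contDiffOn_const
  · rw [hC f g z hz, Finset.sum_comm]
    refine Finset.sum_congr rfl fun δ hδ => ?_
    rw [if_pos (mem_idxLE.1 hδ), Finset.sum_mul]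
  · have e : ∀ γ, c γ δ = 0 := fun γ => hc0 γ δ fun h => hδ (hA γ δ h)
    simp [e]

lemma IsBidifferential.flip {A : MultiIdx n → MultiIdx n → Prop}
    {C : Sm n M →ₗ[ℂ] Sm n M →ₗ[ℂ] Sm n M} (h : IsBidifferential A C) :
    IsBidifferential (fun γ δ => A δ γ) C.flip := by
  intro φ hφ y hy
  obtain ⟨V, hV, hyV, hVt, N, c, hc, hc0, hC⟩ := h φ hφ y hy
  refine ⟨V, hV, hyV, hVt, N, fun γ δ => c δ γ, fun γ δ => hc δ γ, fun γ δ => hc0 δ γ,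
    fun f g z hz => ?_⟩
  rw [LinearMap.flip_apply, hC g f z hz, Finset.sum_comm]
  exact Finset.sum_congr rfl fun γ _ => Finset.sum_congr rfl fun δ _ => by ring

variable {wm : ClosedForm11 n M} {W : ℕ → ClosedForm11 n M} {C : BilinSeq n M}

lemma IsParametrizedBy.hasPotentials (h : IsParametrizedBy C wm W) (r : ℕ) :
    HasPotentials fun φ y => coef φ (formalForm wm W r : TwoForm n M) y := by
  intro φ hφ y hy
  obtain ⟨V, hV, hyV, hVt, Φ, hΦ, hw, -⟩ := h φ hφ y hy
  exact ⟨V, hV, hyV, hVt, Φ r, hΦ r, hw r⟩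

lemma IsStarProduct.isPolarizedProduct {g : Tensor11 n M} (hC : IsStarProduct g C)
    (hs : HasSeparationOfVariables C) (hW : IsParametrizedBy C wm W) :
    IsPolarizedProduct Sum.inl Sum.inr C (fun φ y => coef φ (wm : TwoForm n M) y)
      (fun φ y => coef φ (W 0 : TwoForm n M) y) where
  side i := by cases i <;> simp
  assoc := hC.assoc
  zero := hC.zero
  one r f := hC.one_right (r + 1) f (by omega)
  sided r := (hs r).exists_isRep fun _ _ h => h.2
  potential := by
    intro φ hφ y hy
    obtain ⟨V, hV, hyV, hVt, Φ, hΦ, hw, -, hR⟩ := hW φ hφ y hy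
    exact ⟨V, hV, hyV, hVt, Φ, hΦ, fun z hz k l => (hw 0 z hz k l).symm,
      fun z hz k l => (hw 1 z hz k l).symm, hR⟩

/-- The opposite product has the directions exchanged, the condition on left multiplications takes
the place of that on right ones, and the matrices are transposed because mixed derivatives of a
potential commute. -/
lemma IsStarProduct.isPolarizedProduct_flip {g : Tensor11 n M} (hC : IsStarProduct g C)
    (hs : HasSeparationOfVariables C) (hW : IsParametrizedBy C wm W) :
    IsPolarizedProduct Sum.inr Sum.inl (fun r => (C r).flip)
      (fun φ y => (coef φ (wm : TwoForm n M) y).transpose)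
      (fun φ y => (coef φ (W 0 : TwoForm n M) y).transpose) where
  side i := by cases i <;> simp
  assoc f₁ f₂ f₃ r := by
    simp only [LinearMap.flip_apply]
    exact (hC.assoc f₃ f₂ f₁ r).symm
  zero f v := (hC.zero v f).trans (mul_comm v f)
  one r f := hC.one_left (r + 1) f (by omega)
  sided r := (hs r).flip.exists_isRep fun _ _ h => h.1
  potential := by
    intro φ hφ y hy
    obtain ⟨V, hV, hyV, hVt, Φ, hΦ, hw, hL, -⟩ := hW φ hφ y hy
    refine ⟨V, hV, hyV, hVt, Φ, hΦ, fun z hz k l => ?_, fun z hz k l => ?_, hL⟩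
    · exact (wd_comm (Sum.inr k) (hΦ 0) hV (Sum.inl l) hz).trans (hw 0 z hz l k).symm
    · exact (wd_comm (Sum.inr k) (hΦ 1) hV (Sum.inl l) hz).trans (hw 1 z hz l k).symm

lemma pbLoc_eq (φ : OpenPartialHomeomorph M (Cn n)) (P Q : CotFn n M) (z ζ : Cn n) :
    pbLoc φ P Q z ζ = phaseBracket Sum.inl Sum.inr (cotLoc φ P) (cotLoc φ Q) z ζ :=
  Finset.sum_congr rfl fun k _ => by simp only [wd]; ring

lemma phaseBracket_swap (σ τ : Fin n → Fin n ⊕ Fin n) (P Q : Cn n → Cn n → ℂ) (z ζ : Cn n) :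
    phaseBracket σ τ P Q z ζ = phaseBracket τ σ P Q z ζ :=
  Finset.sum_congr rfl fun _ _ => add_comm _ _

omit [ChartedSpace (Cn n) M] in
lemma sourceField_eq (g : Tensor11 n M) (φ : OpenPartialHomeomorph M (Cn n))
    (F : Cn n → Cn n → ℂ) (z ζ : Cn n) :
    sourceField g φ F z ζ = IsPolarizedPair.expField Sum.inl Sum.inr (g φ) F z ζ := by
  simp only [sourceField, IsPolarizedPair.expField, Finset.mul_sum, mul_assoc]
  rfl

omit [ChartedSpace (Cn n) M] in
lemma targetField_eq (g : Tensor11 n M) (φ : OpenPartialHomeomorph M (Cn n))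
    (F : Cn n → Cn n → ℂ) (z ζ : Cn n) :
    targetField g φ F z ζ =
      IsPolarizedPair.expField Sum.inr Sum.inl (fun y => (g φ y).transpose) F z ζ := by
  rw [targetField, Finset.sum_comm]
  simp only [IsPolarizedPair.expField, Finset.mul_sum, mul_assoc]
  rfl

/-! ### Holomorphic functions -/

lemma dzb_eq_zero_of_differentiableAt {F : Cn n → ℂ} {y : Cn n} (h : DifferentiableAt ℂ F y)
    (l : Fin n) : dzb l F y = 0 := by
  have e : (Pi.single l Complex.I : Cn n) = Complex.I • Pi.single l 1 := by
    rw [← Pi.single_smul, smul_eq_mul, mul_one]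
  rw [dzb, h.fderiv_restrictScalars ℝ, e]
  simp only [ContinuousLinearMap.coe_restrictScalars', map_smul, smul_eq_mul, ← mul_assoc,
    Complex.I_mul_I]
  ring

lemma dz_eq_zero_of_differentiableAt_conj {F : Cn n → ℂ} {y : Cn n}
    (h : DifferentiableAt ℂ (fun z => (starRingEnd ℂ) (F z)) y) (k : Fin n) : dz k F y = 0 := by
  have e : (Pi.single k Complex.I : Cn n) = Complex.I • Pi.single k 1 := by
    rw [← Pi.single_smul, smul_eq_mul, mul_one]
  have e1 : F = Complex.conjCLE ∘ fun z => (starRingEnd ℂ) (F z) := by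
    funext z
    simp
  have e2 : fderiv ℝ F y = (Complex.conjCLE : ℂ →L[ℝ] ℂ).comp
      (fderiv ℝ (fun z => (starRingEnd ℂ) (F z)) y) := by
    conv_lhs => rw [e1]
    exact Complex.conjCLE.comp_fderiv
  rw [dz, e2, h.fderiv_restrictScalars ℝ, e]
  simp only [ContinuousLinearMap.comp_apply, ContinuousLinearMap.coe_restrictScalars', map_smul,
    smul_eq_mul, ContinuousLinearEquiv.coe_coe, Complex.conjCLE_apply, map_mul, Complex.conj_I]
  rw [← mul_assoc, mul_neg, Complex.I_mul_I]
  ring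

lemma exists_isOpen_differentiableAt [IsManifold 𝓘(ℂ, Cn n) ω M] {f : M → ℂ} {x : M}
    (h : ∀ᶠ p in 𝓝 x, MDifferentiableAt 𝓘(ℂ, Cn n) 𝓘(ℂ, ℂ) f p) :
    ∃ V : Set (Cn n), IsOpen V ∧ chartAt (Cn n) x x ∈ V ∧ V ⊆ (chartAt (Cn n) x).target ∧
      ∀ y ∈ V, DifferentiableAt ℂ (loc (chartAt (Cn n) x) f) y := by
  set φ := chartAt (Cn n) x with hφx
  have hφ : IsHolChart φ := isHolChart_chartAt x
  have hx : x ∈ φ.source := mem_chart_source _ x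
  have hc := φ.continuousAt_symm (φ.map_source hx)
  rw [ContinuousAt, φ.left_inv hx] at hc
  obtain ⟨V, hV, hVo, hxV⟩ := eventually_nhds_iff.1
    ((hc.eventually h).and (φ.open_target.mem_nhds (φ.map_source hx)))
  refine ⟨V, hVo, hxV, fun y hy => (hV y hy).2, fun y hy => ?_⟩
  rw [← mdifferentiableAt_iff_differentiableAt]
  refine MDifferentiableAt.comp y (g := f) (hV y hy).1 ?_
  exact ((contMDiffOn_symm_of_mem_maximalAtlas hφ).contMDiffAt
    (φ.open_target.mem_nhds (hV y hy).2)).mdifferentiableAt (by simp)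

end products

end

/-! ### Assembly of the proposition -/

theorem mainTheorem5 {n : ℕ} {M : Type*} [TopologicalSpace M] [T2Space M]
    [SecondCountableTopology M] [ChartedSpace (Cn n) M] [IsManifold 𝓘(ℂ, Cn n) ω M]
    (wm : ClosedForm11 n M) (hwm : IsPseudoKahler wm)
    (W W' : ℕ → ClosedForm11 n M) (C C' : BilinSeq n M)
    (hC : IsStarProduct (kahlerPoisson wm) C) (hCs : HasSeparationOfVariables C)
    (hCW : IsParametrizedBy C wm W)
    (hC' : IsStarProduct (kahlerPoisson wm) C') (hCs' : HasSeparationOfVariables C')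
    (hCW' : IsParametrizedBy C' wm W') :
    (∀ f₁ f₂ : Sm n M,
      IsBracket (deformationTensor wm (W 0 - W' 0)) f₁ f₂ (pairBracket C C' f₁ f₂)) ∧
    ∃ S T : EpsMap n M, IsGroupoidOfPair C C' S T ∧
      IsGroupoidOfDeformation (kahlerPoisson wm) (deformationTensor wm (W 0 - W' 0)) S T := by
  set g := kahlerPoisson wm with hg
  set h := deformationTensor wm (W 0 - W' 0) with hh
  set κ : Tensor11 n M := fun φ y => coef φ ((W 0 - W' 0 : ClosedForm11 n M) : TwoForm n M) y
    with hκ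
  have hκp : HasPotentials κ := by
    -- The index is one because `formalForm` lists the coefficients of `νω`, so `ω₀` stands in
    -- degree one.
    have e := (hCW.hasPotentials 1).sub (hCW'.hasPotentials 1)
    have e' : κ = fun φ y => coef φ (formalForm wm W 1 : TwoForm n M) y -
        coef φ (formalForm wm W' 1 : TwoForm n M) y := by
      funext φ y
      exact coef_sub φ _ _ y
    rwa [e']
  have hcl : ∀ φ : OpenPartialHomeomorph M (Cn n), IsHolChart φ →
      IsClosedPair Sum.inl Sum.inr ⟨φ.target, φ.open_target⟩
        (fun y => coef φ (wm : TwoForm n M) y) (κ φ) (g φ) (h φ) := fun φ hφ =>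
    (hCW.hasPotentials 0).isClosedPair hκp hφ (hwm.nondeg φ hφ)
  have hS : IsPolarizedPair Sum.inl Sum.inr C C' (fun φ y => coef φ (wm : TwoForm n M) y) κ g h :=
    (hC.isPolarizedProduct hCs hCW).isPolarizedPair (hC'.isPolarizedProduct hCs' hCW')
      (fun φ _ y _ => coef_sub φ _ _ y) hcl
  -- The target map is the source map of the pair of opposite products.
  have hT : IsPolarizedPair Sum.inr Sum.inl (fun r => (C r).flip) (fun r => (C' r).flip)
      (fun φ y => (coef φ (wm : TwoForm n M) y).transpose) (fun φ y => (κ φ y).transpose)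
      (fun φ y => (g φ y).transpose) (fun φ y => (h φ y).transpose) :=
    (hC.isPolarizedProduct_flip hCs hCW).isPolarizedPair
      (hC'.isPolarizedProduct_flip hCs' hCW')
      (fun φ _ y _ => (congrArg Matrix.transpose (coef_sub φ _ _ y)).trans
        (Matrix.transpose_sub _ _)) fun φ hφ => (hcl φ hφ).swap
  have hbr : ∀ f₁ f₂ : Sm n M, IsBracket h f₁ f₂ (pairBracket C C' f₁ f₂) := by
    intro f₁ f₂ φ hφ y hy
    have e : loc φ (pairBracket C C' f₁ f₂ : Sm n M) y =
        loc φ ((C 2 f₁ f₂ - C' 2 f₁ f₂ : Sm n M) : M → ℂ) y -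
          loc φ ((C 2 f₂ f₁ - C' 2 f₂ f₁ : Sm n M) : M → ℂ) y := by
      change loc φ (C 2 f₁ f₂) y - loc φ (C 2 f₂ f₁) y -
          (loc φ (C' 2 f₁ f₂) y - loc φ (C' 2 f₂ f₁) y) =
        loc φ (C 2 f₁ f₂) y - loc φ (C' 2 f₁ f₂) y - (loc φ (C 2 f₂ f₁) y - loc φ (C' 2 f₂ f₁) y)
      ring
    rw [e, hS.loc_sub_two hφ hy, hS.loc_sub_two hφ hy, ← Finset.sum_sub_distrib]
    refine Finset.sum_congr rfl fun l _ => ?_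
    rw [← Finset.sum_sub_distrib]
    exact Finset.sum_congr rfl fun k _ => (mul_sub _ _ _).symm
  have hone : ∀ (t : Tensor11 n M) f₁ f₂ b, IsBracket t f₁ f₂ b →
      ∀ φ : OpenPartialHomeomorph M (Cn n), IsHolChart φ → ∀ y ∈ φ.target,
      1 * loc φ b y = ∑ l, ∑ k, t φ y l k *
        (wd (Sum.inr l) (loc φ f₁) y * wd (Sum.inl k) (loc φ f₂) y -
          wd (Sum.inr l) (loc φ f₂) y * wd (Sum.inl k) (loc φ f₁) y) :=
    fun t f₁ f₂ b hb φ hφ y hy => by rw [one_mul]; exact hb φ hφ y hy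
  -- Exchanging holomorphic and antiholomorphic directions reverses the sign of the bracket, which
  -- makes the target map anti-Poisson.
  have hneg : ∀ (t : Tensor11 n M) f₁ f₂ b, IsBracket t f₁ f₂ b →
      ∀ φ : OpenPartialHomeomorph M (Cn n), IsHolChart φ → ∀ y ∈ φ.target,
      -1 * loc φ b y = ∑ l, ∑ k, (t φ y).transpose l k *
        (wd (Sum.inl l) (loc φ f₁) y * wd (Sum.inr k) (loc φ f₂) y -
          wd (Sum.inl l) (loc φ f₂) y * wd (Sum.inr k) (loc φ f₁) y) := by
    intro t f₁ f₂ b hb φ hφ y hy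
    rw [hb φ hφ y hy, Finset.sum_comm, Finset.mul_sum]
    refine Finset.sum_congr rfl fun l _ => ?_
    rw [Finset.mul_sum]
    refine Finset.sum_congr rfl fun k _ => ?_
    simp only [wd, Matrix.transpose_apply]
    ring
  have hpb : ∀ (φ : OpenPartialHomeomorph M (Cn n)) (P Q : CotFn n M) z ζ, pbLoc φ P Q z ζ =
      phaseBracket Sum.inr Sum.inl (cotLoc φ P) (cotLoc φ Q) z ζ := fun φ P Q z ζ =>
    (pbLoc_eq φ P Q z ζ).trans (phaseBracket_swap _ _ _ _ _ _)
  refine ⟨hbr, hS.epsMap, hT.epsMap, ?_, ?_⟩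
  · exact
      { source0 := fun f => ⟨hS.hasSigmaSymbol f, hS.hasSigmaSymbol' f⟩
        source1 := hS.hasSigmaSymbol_sub
        target0 := fun f => ⟨hT.hasSigmaSymbol f, hT.hasSigmaSymbol' f⟩
        target1 := hT.hasSigmaSymbol_sub }
  · exact
      -- The two families of first order Jacobi equations are the `ε` parts of the Jacobi identity
      -- in the two polarizations.
      { deformation := fun φ hφ y hy => ⟨fun l q p => (hcl φ hφ).swap.jacobi l q p hy,
          fun k q p => (hcl φ hφ).jacobi k p q hy⟩
        groupoid :=
          { source := hS.isUnitalMorphism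
            target := hT.isUnitalMorphism
            source_poisson := hS.isPoissonMap (one_mul 1) pbLoc_eq (hone g) (hone h)
              fun f₁ f₂ => ⟨_, hbr f₁ f₂⟩
            target_antiPoisson := hT.isPoissonMap (by norm_num) hpb (hneg g) (hneg h)
              fun f₁ f₂ => ⟨_, hbr f₁ f₂⟩
            commute0 := fun f₁ f₂ φ hφ z hz ζ r =>
              (hS.bracket_eq_zero hT pbLoc_eq f₁ f₂ hφ hz ζ r).1
            commute1 := fun f₁ f₂ φ hφ z hz ζ r =>
              (hS.bracket_eq_zero hT pbLoc_eq f₁ f₂ hφ hz ζ r).2 }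
        separation :=
          { source := fun a x ha => by
              obtain ⟨V, hV, hx, hVt, hd⟩ := exists_isOpen_differentiableAt ha
              exact hS.fixesAt a hV hx hVt fun l y hy =>
                dzb_eq_zero_of_differentiableAt (hd y hy) l
            target := fun b x hb => by
              obtain ⟨V, hV, hx, hVt, hd⟩ := exists_isOpen_differentiableAt hb
              exact hT.fixesAt b hV hx hVt fun l y hy =>
                dz_eq_zero_of_differentiableAt_conj (hd y hy) l }
        source_exp := hS.isExpOf _ _ (sourceField_eq g) (sourceField_eq h)
        target_exp := hT.isExpOf _ _ (targetField_eq g) (targetField_eq h) }
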